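/- **Theorem 1.** Let $K=\mathbb C(q^{1/2})$, $n\ge 0$, and $[x]=\dfrac{q^{x/2}-q^{-x/2}}{q^{1/2}-q^{-1/2}}$. We treat two cases in parallel: the *parafermi* case, with $p=\bar 0$, and the *parabose* case, with $p=\bar 1$. Put $[\![x,y]\!]_c=xy-(-1)^{\deg x\deg y}c\,yx$, $[\![x,y]\!]=[\![x,y]\!]_1$, and $[x,y]_c=xy-c\,yx$. *Quantized enveloping algebras.* Let $U$ be $U_q(so(2n+1))$ in the parafermi case and $U_q(osp(1|2n))$ in the parabose case: the associative unital $K$-(super)algebra with generators $E_{\pm i}$, $q^{\pm H_i}$, $1\le i\le n$ (all even except $E_{\pm n}$, which has degree $p$), and relations $$q^{H_i}q^{-H_i}=q^{-H_i}q^{H_i}=1,\quad q^{H_i}q^{\pm H_j}=q^{\pm H_j}q^{H_i},\quad q^{H_i}E_{\pm j}q^{-H_i}=q^{\pm a_{ij}}E_{\pm j},$$ $$[\![E_i,E_{-j}]\!]=0\ (i\ne j),\quad [2][E_i,E_{-i}]=[2H_i]\ (i<n),\quad [\![E_n,E_{-n}]\!]=[2H_n],$$ $$[E_{\pm i},E_{\pm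 j}]=0\ (|i-j|\ge2),\quad [E_{\pm(i+1)},[E_{\pm(i+1)},E_{\pm i}]_q]_{q^{-1}}=0\ (i\le n-2),$$ $$[E_{\pm i},[E_{\pm i},E_{\pm(i+1)}]_q]_{q^{-1}}=0\ (i\le n-1),\quad [[\![[E_{\pm(n-1)},E_{\pm n}]_{q^{-1}},E_{\pm n}]\!],E_{\pm n}]_q=0\ (n\ge 2),$$ where $a_{ij}=2\delta_{ij}-\delta_{in}\delta_{jn}-\delta_{i+1,j}-\delta_{i,j+1}$ and $[2X]=(q^X-q^{-X})/(q^{1/2}-q^{-1/2})$. *Deformed parastatistics algebras.* Let $\epsilon_{ij}=1,-1,0$ for $i<j$, $i>j$, $i=j$; let $\theta_{i,j;k}=1$ if $i<k<j$, $-1$ if $i>k>j$, and $0$ otherwise; let $\tau\in\{1,-1\}$ and $\sigma_{i,j}=\epsilon_{ij}+\tau\delta_{ij}$. The deformed parafermi algebra $\mathfrak{pF}_q(n)$ (parabose algebra $\mathfrak{pB}_q(n)$) is the associative unital $K$-(super)algebra with generators $a_i^\pm$ of degree $p$ and even generators $q^{\pm h_i}$, $1\le i\le n$, and the following relations, for all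 $i,j,k$ and all $i_1,i_2,i_3$ as indicated: $$q^{h_i}q^{-h_i}=q^{-h_i}q^{h_i}=1,\qquad q^{h_i}q^{h_j}=q^{h_j}q^{h_i}\ (i<j),$$ $$q^{h_i}a_j^\pm q^{-h_i}=q^{\pm\delta_{ij}}a_j^\pm,\qquad [\![a_i^+,a_i^-]\!]=[2h_i],\tag{fe}$$ $$[\![[\![a_i^+,a_j^-]\!],a_k^+]\!]_{q^{-\delta_{ik}\sigma_{j,k}}}=[2]\delta_{jk}a_i^+q^{\sigma_{i,j}h_j}+(q-q^{-1})\theta_{i,j;k}\,a_i^+[\![a_k^+,a_j^-]\!],\tag{I}$$ $$[\![[\![a_i^+,a_j^-]\!],a_k^-]\!]_{q^{-\delta_{jk}\sigma_{i,k}}}=-[2]\delta_{ik}a_j^-q^{-\sigma_{j,i}h_i}-(q-q^{-1})\theta_{i,j;k}\,[\![a_i^+,a_k^-]\!]a_j^-,\tag{I*}$$ $$[\![[\![a_{i_1}^\pm,a_{i_3}^\pm]\!],a_{i_2}^\pm]\!]_{q^2}+q[\![[\![a_{i_1}^\pm,a_{i_2}^\pm]\!],a_{i_3}^\pm]\!]=0\quad(i_1<i_2\le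 i_3),\tag{II}$$ $$[\![a_{i_2}^\pm,[\![a_{i_1}^\pm,a_{i_3}^\pm]\!]]\!]_{q^2}+q[\![a_{i_1}^\pm,[\![a_{i_2}^\pm,a_{i_3}^\pm]\!]]\!]=0\quad(i_1\le i_2<i_3).\tag{II*}$$ Then, in both cases and for both choices of $\tau$: 1. the relations listed (left-hand side minus right-hand side) are linearly independent over $K$ in the free algebra on $a_i^\pm,q^{\pm h_i}$; 2. the degrees of the generators define a $\mathbb Z/2$-grading of the algebra so presented (that is, it is a superalgebra, concentrated in even degree in the parafermi case); 3. these relations are a complete set of relations for $U$ in the generators $a_i^\pm,q^{\pm h_i}$: there is an isomorphism of $K$-algebras $\varphi:\mathfrak{pF}_q(n)\to U_q(so(2n+1))$, respectively $\varphi:\mathfrak{pB}_q(n)\to U_q(osp(1|2n))$, that maps the part of each degree $d\in\mathbb Z/2$ onto the part of degree $d$, with $$\varphi(a_i^+)=[E_i,[E_{i+1},\dots[E_{n-1},E_n]_{q^{-1}}\dots]_{q^{-1}}]_{q^{-1}},\quad \varphi(a_i^-)=[[\dots[E_{-n},E_{-n+1}]_q\dots,E_{-(i+1)}]_q,E_{-i}]_q,\quad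 \varphi(q^{\pm h_i})=\prod_{k=i}^nq^{\pm H_k},$$ and with inverse $$\varphi^{-1}(E_i)=\tfrac1{[2]}q^{-h_{i+1}}[\![a_i^+,a_{i+1}^-]\!],\quad \varphi^{-1}(E_{-i})=\tfrac1{[2]}[\![a_{i+1}^+,a_i^-]\!]q^{h_{i+1}},\quad \varphi^{-1}(q^{\pm H_i})=q^{\pm h_i}q^{\mp h_{i+1}}\quad(i<n),$$ $$\varphi^{-1}(E_{\pm n})=a_n^\pm,\quad \varphi^{-1}(q^{\pm H_n})=q^{\pm h_n}.$$ -/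

import Mathlib

noncomputable section

namespace Parastat

/-! ### Scalars -/

/-- The ground field: rational functions over `ℂ` in the indeterminate `q^(1/2)`. -/
abbrev Kq : Type := RatFunc ℂ

/-- The indeterminate `q^(1/2)`. -/
def sq : Kq := RatFunc.X

/-- The deformation parameter `q`. -/
def q : Kq := sq ^ 2

/-- The quantum bracket `[x] = (q^(x/2) - q^(-x/2)) / (q^(1/2) - q^(-1/2))` of an integer. -/
def qnum (x : ℤ) : Kq := (sq ^ x - sq ^ (-x)) / (sq - sq⁻¹)

/-! ### The two cases, degrees and (super)commutators -/

/-- `fermi`: the parafermi algebra and `so(2n+1)`. `bose`: the parabose algebra and `osp(1|2n)`. -/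
inductive Kind where
  | fermi
  | bose

/-- The common degree of the operators `a_i^±`: even for parafermi, odd for parabose. -/
def Kind.deg : Kind → ZMod 2
  | .fermi => 0
  | .bose => 1

/-- The sign `(-1)^(d e)`. -/
def koszul (d e : ZMod 2) : Kq := if d = 1 ∧ e = 1 then -1 else 1

section Algebra

variable {A : Type*} [Ring A] [Algebra Kq A]

/-- The `c`-deformed supercommutator `x y - (-1)^(d e) c y x` of `x` of degree `d` and
`y` of degree `e`. -/
def sbr (d e : ZMod 2) (c : Kq) (x y : A) : A := x * y - (koszul d e * c) • (y * x)

/-- The `c`-commutator `[x, y]_c = x y - c y x`. -/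
def qbr (c : Kq) (x y : A) : A := x * y - c • (y * x)

/-- `(q^x - q^(-x)) / (q^(1/2) - q^(-1/2)) = [2x]`, from `k = q^x` and `k' = q^(-x)`. -/
def cartanNum (k k' : A) : A := (sq - sq⁻¹)⁻¹ • (k - k')

/-- `descend f e i = f (e i) (f (e (i+1)) (⋯ f (e (n-2)) (e (n-1)) ⋯))` (indices from `0`). -/
def descend {n : ℕ} (f : A → A → A) (e : Fin n → A) (i : Fin n) : A :=
  if h : i.val + 1 < n then f (e i) (descend f e ⟨i.val + 1, h⟩) else e i
termination_by n - i.val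

/-- The homogeneous part of degree `d` of an algebra generated by the elements `f g`, to which
the degrees `deg g` are assigned: the span of the words of degree `d` in the generators. -/
def homPart {G : Type} (deg : G → ZMod 2) (f : G → A) (d : ZMod 2) : Submodule Kq A :=
  Submodule.span Kq {x | ∃ w : List G, (w.map deg).sum = d ∧ x = (w.map f).prod}

end Algebra

/-! ### The quantized universal enveloping algebras in Chevalley generators -/

/-- Chevalley generators, indexed by `0, …, n-1`, with a sign `s = ±1`. -/
inductive ChevGen (n : ℕ) where
  /-- `e s i` is `E_{s i}`. -/
  | e (s : ℤˣ) (i : Fin n)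
  /-- `k s i` is `q^(s H_i)`. -/
  | k (s : ℤˣ) (i : Fin n)

/-- The simple root vectors are even, except for the last one, which is odd for `osp(1|2n)`. -/
def ChevGen.deg (κ : Kind) {n : ℕ} : ChevGen n → ZMod 2
  | .e _ i => if i.val + 1 = n then κ.deg else 0
  | .k _ _ => 0

/-- The symmetrized Cartan matrix of type `B_n`, with `(α_n, α_n) = 1`. -/
def cartan {n : ℕ} (i j : Fin n) : ℤ :=
  if i = j then (if i.val + 1 = n then 1 else 2)
  else if i.val + 1 = j.val ∨ j.val + 1 = i.val then -1 else 0

/-- `E_{s i}` in the free algebra. -/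
abbrev fE {n : ℕ} (s : ℤˣ) (i : Fin n) : FreeAlgebra Kq (ChevGen n) := FreeAlgebra.ι Kq (.e s i)

/-- `q^(s H_i)` in the free algebra. -/
abbrev fK {n : ℕ} (s : ℤˣ) (i : Fin n) : FreeAlgebra Kq (ChevGen n) := FreeAlgebra.ι Kq (.k s i)

/-- The Chevalley-Serre relations of `U_q(so(2n+1))` (`fermi`) and `U_q(osp(1|2n))` (`bose`). -/
inductive ChevRel (κ : Kind) (n : ℕ) :
    FreeAlgebra Kq (ChevGen n) → FreeAlgebra Kq (ChevGen n) → Prop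
  | k_inv (s : ℤˣ) (i : Fin n) : ChevRel κ n (fK s i * fK (-s) i) 1
  | k_comm (s : ℤˣ) (i j : Fin n) : ChevRel κ n (fK 1 i * fK s j) (fK s j * fK 1 i)
  | k_e (s : ℤˣ) (i j : Fin n) :
      ChevRel κ n (fK 1 i * fE s j * fK (-1) i) (q ^ ((s : ℤ) * cartan i j) • fE s j)
  | e_f_ne (i j : Fin n) (h : i ≠ j) :
      ChevRel κ n
        (sbr (ChevGen.deg κ (.e 1 i)) (ChevGen.deg κ (.e (-1) j)) 1 (fE 1 i) (fE (-1) j)) 0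
  | e_f (i : Fin n) (h : i.val + 1 < n) :
      ChevRel κ n (qnum 2 • qbr 1 (fE 1 i) (fE (-1) i)) (cartanNum (fK 1 i) (fK (-1) i))
  | e_f_last (i : Fin n) (h : i.val + 1 = n) :
      ChevRel κ n (sbr κ.deg κ.deg 1 (fE 1 i) (fE (-1) i)) (cartanNum (fK 1 i) (fK (-1) i))
  | serre_far (s : ℤˣ) (i j : Fin n) (h : i.val + 2 ≤ j.val) :
      ChevRel κ n (qbr 1 (fE s i) (fE s j)) 0
  | serre_down (s : ℤˣ) (i j : Fin n) (h : j.val = i.val + 1) (hj : j.val + 1 < n) :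
      ChevRel κ n (qbr q⁻¹ (fE s j) (qbr q (fE s j) (fE s i))) 0
  | serre_up (s : ℤˣ) (i j : Fin n) (h : j.val = i.val + 1) :
      ChevRel κ n (qbr q⁻¹ (fE s i) (qbr q (fE s i) (fE s j))) 0
  | serre_last (s : ℤˣ) (i j : Fin n) (h : j.val = i.val + 1) (hj : j.val + 1 = n) :
      ChevRel κ n (qbr q (sbr κ.deg κ.deg 1 (qbr q⁻¹ (fE s i) (fE s j)) (fE s j)) (fE s j)) 0

/-- `U_q(so(2n+1))` for `κ = fermi`, and `U_q(osp(1|2n))` for `κ = bose`. -/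
abbrev QUEA (κ : Kind) (n : ℕ) : Type := RingQuot (ChevRel κ n)

/-- A Chevalley generator as an element of the quantized enveloping algebra. -/
def QUEA.gen (κ : Kind) (n : ℕ) (g : ChevGen n) : QUEA κ n :=
  RingQuot.mkAlgHom Kq (ChevRel κ n) (FreeAlgebra.ι Kq g)

/-- `E_{s i}`. -/
def QUEA.E (κ : Kind) (n : ℕ) (s : ℤˣ) (i : Fin n) : QUEA κ n := QUEA.gen κ n (.e s i)

/-- `q^(s H_i)`. -/
def QUEA.K (κ : Kind) (n : ℕ) (s : ℤˣ) (i : Fin n) : QUEA κ n := QUEA.gen κ n (.k s i)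

/-- The `ℤ/2`-grading of the quantized enveloping algebra. -/
def QUEA.part (κ : Kind) (n : ℕ) : ZMod 2 → Submodule Kq (QUEA κ n) :=
  homPart (ChevGen.deg κ) (QUEA.gen κ n)

/-! ### The deformed parastatistics algebras -/

/-- Generators of the deformed parastatistics algebras, with a sign `s = ±1`. -/
inductive ParaGen (n : ℕ) where
  /-- `a s i` is `a_i^s`: creation for `s = 1`, annihilation for `s = -1`. -/
  | a (s : ℤˣ) (i : Fin n)
  /-- `k s i` is `q^(s h_i)`. -/
  | k (s : ℤˣ) (i : Fin n)

/-- The `a_i^±` have degree `κ.deg`, the Cartan generators are even. -/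
def ParaGen.deg (κ : Kind) {n : ℕ} : ParaGen n → ZMod 2
  | .a _ _ => κ.deg
  | .k _ _ => 0

/-- The symbol `ε_{ij}`, with `ε_{ij} = 1` for `i < j`. -/
def eps {n : ℕ} (i j : Fin n) : ℤ := if i < j then 1 else if j < i then -1 else 0

/-- The symbol `σ_{ij} = ε_{ij} + τ δ_{ij}`, as a sign; the choice of `τ = ±1` is free. -/
def sigma (τ : ℤˣ) {n : ℕ} (i j : Fin n) : ℤˣ := if i < j then 1 else if j < i then -1 else τ

theorem sigma_eq (τ : ℤˣ) {n : ℕ} (i j : Fin n) :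
    (sigma τ i j : ℤ) = eps i j + τ * (if i = j then 1 else 0) := by
  unfold sigma eps
  rcases lt_trichotomy i j with h | h | h
  · simp [h, h.ne]
  · simp [h]
  · simp [h, h.ne', h.not_gt]

/-- The symbol `θ_{i,j;k}`: `1` for `i < k < j`, `-1` for `i > k > j`, and `0` otherwise. -/
def theta {n : ℕ} (i j k : Fin n) : ℤ :=
  if i < k ∧ k < j then 1 else if j < k ∧ k < i then -1 else 0

/-- With `ε_{ijk} = ε_{ij} ε_{ik} ε_{jk}`, one has
`θ_{i,j;k} = ε_{ij} ε_{ijk} (ε_{jk} - ε_{ik}) / 2`. -/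
theorem two_mul_theta {n : ℕ} (i j k : Fin n) :
    2 * theta i j k
      = eps i j * (eps i j * eps i k * eps j k) * (eps j k - eps i k) := by
  unfold theta eps
  rcases lt_trichotomy i j with h | h | h <;> rcases lt_trichotomy i k with h' | h' | h' <;>
    rcases lt_trichotomy j k with h'' | h'' | h'' <;> grind

/-- `a_i^s` in the free algebra. -/
abbrev fa {n : ℕ} (s : ℤˣ) (i : Fin n) : FreeAlgebra Kq (ParaGen n) := FreeAlgebra.ι Kq (.a s i)

/-- `q^(s h_i)` in the free algebra. -/
abbrev fk {n : ℕ} (s : ℤˣ) (i : Fin n) : FreeAlgebra Kq (ParaGen n) := FreeAlgebra.ι Kq (.k s i)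

/-- The supercommutator of two of the operators `a_i^±`. -/
abbrev abr {A : Type*} [Ring A] [Algebra Kq A] (κ : Kind) (x y : A) : A := sbr κ.deg κ.deg 1 x y

/-- Labels of the defining relations. -/
inductive ParaIdx (n : ℕ) where
  | k_inv (s : ℤˣ) (i : Fin n)
  | k_comm (i j : Fin n) (h : i < j)
  | k_a (s : ℤˣ) (i j : Fin n)
  | a_a (i : Fin n)
  | tri (i j k : Fin n)
  | triStar (i j k : Fin n)
  | serre (s : ℤˣ) (i₁ i₂ i₃ : Fin n) (h : i₁ < i₂) (h' : i₂ ≤ i₃)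
  | serreStar (s : ℤˣ) (i₁ i₂ i₃ : Fin n) (h : i₁ ≤ i₂) (h' : i₂ < i₃)

/-- The defining relations, each written as left-hand side minus right-hand side. -/
def relator (κ : Kind) (n : ℕ) (τ : ℤˣ) : ParaIdx n → FreeAlgebra Kq (ParaGen n)
  | .k_inv s i => fk s i * fk (-s) i - 1
  | .k_comm i j _ => fk 1 i * fk 1 j - fk 1 j * fk 1 i
  | .k_a s i j => fk 1 i * fa s j * fk (-1) i - q ^ (if i = j then (s : ℤ) else 0) • fa s j
  | .a_a i => abr κ (fa 1 i) (fa (-1) i) - cartanNum (fk 1 i) (fk (-1) i)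
  | .tri i j k =>
      sbr (κ.deg + κ.deg) κ.deg (q ^ (if i = k then -(sigma τ j k : ℤ) else 0))
          (abr κ (fa 1 i) (fa (-1) j)) (fa 1 k)
        - ((if j = k then qnum 2 • (fa 1 i * fk (sigma τ i j) j) else 0)
          + ((q - q⁻¹) * (theta i j k : Kq)) • (fa 1 i * abr κ (fa 1 k) (fa (-1) j)))
  | .triStar i j k =>
      sbr (κ.deg + κ.deg) κ.deg (q ^ (if j = k then -(sigma τ i k : ℤ) else 0))
          (abr κ (fa 1 i) (fa (-1) j)) (fa (-1) k)
        - (-(if i = k then qnum 2 • (fa (-1) j * fk (-(sigma τ j i)) i) else 0)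
          - ((q - q⁻¹) * (theta i j k : Kq)) • (abr κ (fa 1 i) (fa (-1) k) * fa (-1) j))
  | .serre s i₁ i₂ i₃ _ _ =>
      sbr (κ.deg + κ.deg) κ.deg (q ^ 2) (abr κ (fa s i₁) (fa s i₃)) (fa s i₂)
        + q • sbr (κ.deg + κ.deg) κ.deg 1 (abr κ (fa s i₁) (fa s i₂)) (fa s i₃)
  | .serreStar s i₁ i₂ i₃ _ _ =>
      sbr κ.deg (κ.deg + κ.deg) (q ^ 2) (fa s i₂) (abr κ (fa s i₁) (fa s i₃))
        + q • sbr κ.deg (κ.deg + κ.deg) 1 (fa s i₁) (abr κ (fa s i₂) (fa s i₃))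

/-- Every element of the family `relator` is set to zero. -/
def ParaRel (κ : Kind) (n : ℕ) (τ : ℤˣ) (x y : FreeAlgebra Kq (ParaGen n)) : Prop :=
  ∃ r : ParaIdx n, x = relator κ n τ r ∧ y = 0

/-- The deformed parafermi algebra (`κ = fermi`) and parabose algebra (`κ = bose`). -/
abbrev ParaAlg (κ : Kind) (n : ℕ) (τ : ℤˣ) : Type := RingQuot (ParaRel κ n τ)

/-- A generator as an element of the deformed parastatistics algebra. -/
def ParaAlg.gen (κ : Kind) (n : ℕ) (τ : ℤˣ) (g : ParaGen n) : ParaAlg κ n τ :=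
  RingQuot.mkAlgHom Kq (ParaRel κ n τ) (FreeAlgebra.ι Kq g)

/-- `a_i^s`. -/
def ParaAlg.a (κ : Kind) (n : ℕ) (τ s : ℤˣ) (i : Fin n) : ParaAlg κ n τ :=
  ParaAlg.gen κ n τ (.a s i)

/-- `q^(s h_i)`. -/
def ParaAlg.k (κ : Kind) (n : ℕ) (τ s : ℤˣ) (i : Fin n) : ParaAlg κ n τ :=
  ParaAlg.gen κ n τ (.k s i)

/-- The `ℤ/2`-grading of the deformed parastatistics algebra. -/
def ParaAlg.part (κ : Kind) (n : ℕ) (τ : ℤˣ) : ZMod 2 → Submodule Kq (ParaAlg κ n τ) :=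
  homPart (ParaGen.deg κ) (ParaAlg.gen κ n τ)

/-! ### The change of basis -/

/-- `a_i^+ = [E_i, [E_{i+1}, … [E_{n-1}, E_n]_{1/q} … ]_{1/q}]_{1/q}` for `s = 1`, and
`a_i^- = [[… [E_{-n}, E_{-n+1}]_q …, E_{-(i+1)}]_q, E_{-i}]_q` for `s = -1`. -/
def chevA (κ : Kind) (n : ℕ) (s : ℤˣ) (i : Fin n) : QUEA κ n :=
  if s = 1 then descend (fun x y => qbr q⁻¹ x y) (QUEA.E κ n 1) i
  else descend (fun x y => qbr q y x) (QUEA.E κ n (-1)) i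

/-- `q^(s h_i)` with `h_i = H_i + … + H_n`. -/
def chevK (κ : Kind) (n : ℕ) (s : ℤˣ) (i : Fin n) : QUEA κ n :=
  descend (fun x y => x * y) (QUEA.K κ n s) i

/-- `E_i = [2]⁻¹ q^(-h_{i+1}) [[a_i^+, a_{i+1}^-]]` and
`E_{-i} = [2]⁻¹ [[a_{i+1}^+, a_i^-]] q^(h_{i+1})` for `i < n`, and `E_{±n} = a_n^±`. -/
def paraE (κ : Kind) (n : ℕ) (τ s : ℤˣ) (i : Fin n) : ParaAlg κ n τ :=
  if h : i.val + 1 < n then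
    if s = 1 then
      (qnum 2)⁻¹ • (ParaAlg.k κ n τ (-1) ⟨i.val + 1, h⟩
        * abr κ (ParaAlg.a κ n τ 1 i) (ParaAlg.a κ n τ (-1) ⟨i.val + 1, h⟩))
    else
      (qnum 2)⁻¹ • (abr κ (ParaAlg.a κ n τ 1 ⟨i.val + 1, h⟩) (ParaAlg.a κ n τ (-1) i)
        * ParaAlg.k κ n τ 1 ⟨i.val + 1, h⟩)
  else ParaAlg.a κ n τ s i

/-- `q^(s H_i)` with `H_i = h_i - h_{i+1}` for `i < n`, and `H_n = h_n`. -/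
def paraK (κ : Kind) (n : ℕ) (τ s : ℤˣ) (i : Fin n) : ParaAlg κ n τ :=
  if h : i.val + 1 < n then
    ParaAlg.k κ n τ s i * ParaAlg.k κ n τ (-s) ⟨i.val + 1, h⟩
  else ParaAlg.k κ n τ s i

end Parastat

end

/-! Count the nodes from the short root, so that node 0 is the short one, and put `k_i = K_0 ⋯ K_i`.
With `x_0 = E_0`, `x_{m+1} = [E_{m+1}, x_m]_{1/q}` and dually `y_m`, the element `x_i` has weight
`ε_i`, and `E_j` (`j ≥ 1`) has weight `ε_j - ε_{j-1}`. The simple root vectors of the `gl_n` part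
are thus visible inside the brackets `L_{ij} = [[x_i, y_j]]`: one finds `L_{ii} = c (k_i - k_i⁻¹)`,
and for `i > j` that `L_{ij} = [2] k_j e_{ij}`, where `e_{ij}` is a root vector of weight `ε_i -
ε_j` that raises `x_j` to `x_i` and lowers `y_i` to `y_j`.

From the Chevalley relations to the parastatistics relations: the relations (I) and (I*) with `i ≠
j` describe the action of `k_j e_{ij}` on the `x_m` and `y_m` (`Chev.exists_rootVec`,
`IsRootVec.L_eq`). The intermediate cases, with coefficient `q - q⁻¹`, come from applying one more
root vector to a quasi-commutation relation (`mid_of_raise`, `mid_of_lower`). All relations (II) and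
(II*) come from the single Serre relation at the short root by applying root vectors
(`half_of_rootVec`). The sign `τ` enters (I) and (I*) only for `i = j = k`, where both versions
follow from the weight of `a_i^±` and the value of `[[a_i^+, a_i^-]]`.

Conversely, `E_{m+1} = [2]⁻¹ k_m⁻¹ L_{m+1,m}` is a root vector by (I) and (I*), and the
Chevalley-Serre relations follow from its action (`Half.rootVec`, `Half.chev`). The two
substitutions are inverse to each other on generators (`Chev.ec_xs`, `Half.xs_ec` and their mirror
images), which gives the isomorphism.

Half of the work is saved by an anti-involution: in the opposite algebra, with raising and lowering
generators exchanged, `k` exchanged with `k⁻¹`, and `q`, `c` replaced by `q⁻¹`, `-c`, the same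
relations hold (`Chev.star`). Hence only the relations of `Half` are proved, once in the algebra and
once in its opposite; together they amount to the full list (`relatorIn_of_half`).

The grading follows from the automorphism that acts on each generator by the sign of its degree: its
eigenspaces for `1` and `-1` separate the two parts. Linear independence is shown by linear
functionals dual to the relators, built from coefficients of words of the free algebra. -/

namespace Parastat

/-! ### Commutation up to a scalar. -/

section QuasiCommutation

variable {F A : Type*} [Field F] [Ring A] [Algebra F A]

/-- The `c`-commutator over an arbitrary field. -/
def cbr (c : F) (x y : A) : A := x * y - c • (y * x)

/-- `a` and `b` commute up to the scalar `c`. -/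
def QComm (c : F) (a b : A) : Prop := a * b = c • (b * a)

theorem mul_mul_of {a b c : A} (h : a * b = c) (w : A) : a * (b * w) = c * w := by
  rw [← mul_assoc, h]

theorem QComm.mul_right {c d : F} {a x y : A} (hx : QComm c a x) (hy : QComm d a y) :
    QComm (c * d) a (x * y) := by
  unfold QComm at *
  rw [← mul_assoc, hx, smul_mul_assoc, mul_assoc, hy, mul_smul_comm, smul_smul, mul_assoc]

theorem QComm.smul_right {c : F} {a x : A} (r : F) (hx : QComm c a x) : QComm c a (r • x) := by
  unfold QComm at *
  rw [mul_smul_comm, hx, smul_mul_assoc, smul_comm]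

theorem QComm.sub_right {c : F} {a x y : A} (hx : QComm c a x) (hy : QComm c a y) :
    QComm c a (x - y) := by
  unfold QComm at *
  rw [mul_sub, hx, hy, sub_mul, smul_sub]

theorem QComm.cbr_right {c d : F} {a x y : A} (r : F) (hx : QComm c a x) (hy : QComm d a y) :
    QComm (c * d) a (cbr r x y) :=
  (hx.mul_right hy).sub_right ((mul_comm d c ▸ hy.mul_right hx).smul_right r)

theorem QComm.of_eq {c d : F} {a x : A} (hx : QComm c a x) (h : c = d) : QComm d a x := h ▸ hx

theorem QComm.inv_left {c : F} {a a' x : A} (hx : QComm c a x) (hc : c ≠ 0)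
    (h : a * a' = 1) (h' : a' * a = 1) : QComm c⁻¹ a' x := by
  unfold QComm at *
  have : a' * (a * x) * a' = a' * (c • (x * a)) * a' := by rw [hx]
  rw [← mul_assoc, h', one_mul, mul_smul_comm, smul_mul_assoc, mul_assoc, mul_assoc, h,
    mul_one] at this
  rw [this, smul_smul, inv_mul_cancel₀ hc, one_smul]

theorem QComm.commute {a x : A} (hx : QComm (1 : F) a x) : Commute a x := by
  unfold QComm at hx; rwa [one_smul] at hx

theorem _root_.Commute.qcomm {a x : A} (hx : Commute a x) : QComm (1 : F) a x := by
  unfold QComm; rw [one_smul]; exact hx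

theorem _root_.Commute.cbr_right {a x y : A} (r : F) (hx : Commute a x) (hy : Commute a y) :
    Commute a (cbr r x y) :=
  (hx.mul_right hy).sub_right ((hy.mul_right hx).smul_right r)

theorem _root_.Commute.cbr_left {a x y : A} (r : F) (hx : Commute x a) (hy : Commute y a) :
    Commute (cbr r x y) a :=
  (Commute.cbr_right r hx.symm hy.symm).symm

end QuasiCommutation

/-! ### Chevalley relations counted from the short root, and their anti-involution. -/

/-- The scalars of the construction: `b = [2]`, `c = 1 / (q^(1/2) - q^(-1/2))`, and a sign `ε`. -/
structure QParam {F : Type*} [Field F] (q b c ε : F) : Prop where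
  q0 : q ≠ 0
  b0 : b ≠ 0
  hc : c * (q - q⁻¹) = b
  h2 : q * q + 1 ≠ 0
  h1 : 1 + q ≠ 0
  hε : ε * ε = 1

/-- The weight of the root vector `E_j` with respect to `k_i = K_0 ⋯ K_i`. -/
def rootWt {F : Type*} [Field F] (q : F) (i j : ℕ) : F :=
  if i = j then q else if i + 1 = j then q⁻¹ else 1

/-- The weight of `x_j` with respect to `k_i`. -/
def vecWt {F : Type*} [Field F] (q : F) (i j : ℕ) : F := if i = j then q else 1

/-- The weight of a root vector from `x_j` to `x_i` with respect to `k_m`. -/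
def pairWt {F : Type*} [Field F] (q : F) (i j m : ℕ) : F :=
  if m = i then q else if m = j then q⁻¹ else 1

/-- The Chevalley-Serre relations in an algebra, with nodes counted from the short root, and
in terms of `k_i = K_0 ⋯ K_i`. -/
structure Chev {F A : Type*} [Field F] [Ring A] [Algebra F A] (q b c ε : F) (n : ℕ)
    (E Y k k' : ℕ → A) : Prop where
  kk' : ∀ i < n, k i * k' i = 1
  k'k : ∀ i < n, k' i * k i = 1
  comm : ∀ i < n, ∀ j < n, Commute (k i) (k j)
  kE : ∀ i < n, ∀ j < n, QComm (rootWt q i j) (k i) (E j)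
  kY : ∀ i < n, ∀ j < n, QComm (rootWt q i j)⁻¹ (k i) (Y j)
  EY_ne : ∀ i < n, ∀ j < n, i ≠ j → Commute (E i) (Y j)
  EY : ∀ i, i + 1 < n → b • (E (i + 1) * Y (i + 1) - Y (i + 1) * E (i + 1)) =
    c • (k (i + 1) * k' i - k i * k' (i + 1))
  EY_zero : 0 < n → E 0 * Y 0 - ε • (Y 0 * E 0) = c • (k 0 - k' 0)
  farE : ∀ i j, i + 2 ≤ j → j < n → Commute (E j) (E i)
  farY : ∀ i j, i + 2 ≤ j → j < n → Commute (Y j) (Y i)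
  serreE : ∀ i < n, ∀ j < n, (i + 1 = j ∨ j + 1 = i) → 1 ≤ j →
    E j * E j * E i - (q + q⁻¹) • (E j * E i * E j) + E i * E j * E j = 0
  serreY : ∀ i < n, ∀ j < n, (i + 1 = j ∨ j + 1 = i) → 1 ≤ j →
    Y j * Y j * Y i - (q + q⁻¹) • (Y j * Y i * Y j) + Y i * Y j * Y j = 0
  lastE : 1 < n → cbr q (cbr ε (cbr q⁻¹ (E 1) (E 0)) (E 0)) (E 0) = 0
  lastY : 1 < n → cbr q (cbr ε (Y 0) (cbr q (Y 0) (Y 1))) (Y 0) = 0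

open MulOpposite in
theorem QComm.op {F A : Type*} [Field F] [Ring A] [Algebra F A] {c : F} {a x : A} (hc : c ≠ 0)
    (h : QComm c a x) : QComm c⁻¹ (op a) (op x) := by
  unfold QComm at *
  rw [← op_mul, ← op_mul, h, op_smul, smul_smul, inv_mul_cancel₀ hc, one_smul]

/-- Inverting `q` changes the sign of `q - q⁻¹`; the sign change of `c` compensates, so `b` is kept.
-/
theorem QParam.star {F : Type*} [Field F] {q b c ε : F} (h : QParam q b c ε) :
    QParam q⁻¹ b (-c) ε where
  q0 := inv_ne_zero h.q0
  b0 := h.b0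
  hc := by rw [← h.hc, inv_inv]; ring
  h2 := by
    have := h.h2; have := h.q0
    intro h'; field_simp at h'; apply h.h2; linear_combination h'
  h1 := by
    have := h.h1; have := h.q0
    intro h'; field_simp at h'; apply h.h1; linear_combination h'
  hε := h.hε

theorem rootWt_ne {F : Type*} [Field F] {q : F} (h : q ≠ 0) (i j : ℕ) : rootWt q i j ≠ 0 := by
  unfold rootWt; split_ifs <;> simp [h]

theorem vecWt_ne {F : Type*} [Field F] {q : F} (h : q ≠ 0) (i j : ℕ) : vecWt q i j ≠ 0 := by
  unfold vecWt; split_ifs <;> simp [h]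

theorem pairWt_ne {F : Type*} [Field F] {q : F} (h : q ≠ 0) (i j m : ℕ) : pairWt q i j m ≠ 0 := by
  unfold pairWt; split_ifs <;> simp [h]

theorem rootWt_inv {F : Type*} [Field F] (q : F) (i j : ℕ) :
    rootWt q⁻¹ i j = (rootWt q i j)⁻¹ := by
  unfold rootWt; split_ifs <;> simp

theorem vecWt_inv {F : Type*} [Field F] (q : F) (i j : ℕ) :
    vecWt q⁻¹ i j = (vecWt q i j)⁻¹ := by
  unfold vecWt; split_ifs <;> simp

namespace Chev

variable {F A : Type*} [Field F] [Ring A] [Algebra F A] {q b c ε : F} {n : ℕ}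
  {E Y k k' : ℕ → A}

theorem kk'_comm (h : Chev q b c ε n E Y k k') {i j : ℕ} (hi : i < n) (hj : j < n) :
    Commute (k i) (k' j) :=
  (QComm.inv_left (F := F) (h.comm j hj i hi).qcomm one_ne_zero (h.kk' j hj) (h.k'k j hj)
    |>.of_eq inv_one).commute.symm

theorem k'k'_comm (h : Chev q b c ε n E Y k k') {i j : ℕ} (hi : i < n) (hj : j < n) :
    Commute (k' i) (k' j) :=
  (QComm.inv_left (F := F) (h.kk'_comm hi hj).qcomm one_ne_zero (h.kk' i hi) (h.k'k i hi)
    |>.of_eq inv_one).commute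

-- The Cartan anti-involution, phrased through the opposite algebra. It turns every later statement
-- about `E` and `x` into one about `Y` and `y`.
open MulOpposite in
theorem star (hp : QParam q b c ε) (h : Chev q b c ε n E Y k k') :
    Chev q⁻¹ b (-c) ε n (fun i => op (Y i)) (fun i => op (E i)) (fun i => op (k' i))
      (fun i => op (k i)) where
  kk' i hi := by rw [← op_mul, h.kk' i hi, op_one]
  k'k i hi := by rw [← op_mul, h.k'k i hi, op_one]
  comm i hi j hj := (h.k'k'_comm hi hj).op
  kE i hi j hj := by
    have := (h.kY i hi j hj).inv_left (inv_ne_zero (rootWt_ne hp.q0 i j)) (h.kk' i hi) (h.k'k i hi)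
    exact (this.op (inv_ne_zero (inv_ne_zero (rootWt_ne hp.q0 i j)))).of_eq
      (by rw [inv_inv, rootWt_inv])
  kY i hi j hj := by
    have := (h.kE i hi j hj).inv_left (rootWt_ne hp.q0 i j) (h.kk' i hi) (h.k'k i hi)
    exact (this.op (inv_ne_zero (rootWt_ne hp.q0 i j))).of_eq (by rw [rootWt_inv])
  EY_ne i hi j hj hij := (h.EY_ne j hj i hi hij.symm).symm.op
  EY i hi := by
    have := congrArg op (h.EY i hi)
    simp only [op_smul, op_sub, op_mul] at this
    rw [this]; module
  EY_zero hi := by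
    have := congrArg op (h.EY_zero hi)
    simp only [op_smul, op_sub, op_mul] at this
    rw [this]; module
  farE i j hij hj := (h.farY i j hij hj).op
  farY i j hij hj := (h.farE i j hij hj).op
  serreE i hi j hj hij hj1 := by
    have := congrArg op (h.serreY i hi j hj hij hj1)
    simp only [op_smul, op_sub, op_mul, op_add, op_zero, ← mul_assoc] at this
    rw [← this, inv_inv]; module
  serreY i hi j hj hij hj1 := by
    have := congrArg op (h.serreE i hi j hj hij hj1)
    simp only [op_smul, op_sub, op_mul, op_add, op_zero, ← mul_assoc] at this
    rw [← this, inv_inv]; module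
  lastE hn := by
    have := congrArg op (h.lastY hn)
    have q0 := hp.q0
    simp only [cbr, op_smul, op_sub, op_mul, op_zero] at this ⊢
    -- Reversal of products affects the outermost bracket only through `[u, v]_{1/q} = -q⁻¹ [v,
    -- u]_q`.
    linear_combination (norm := skip) (-q⁻¹) • this
    simp only [mul_sub, sub_mul, mul_smul_comm, smul_mul_assoc, mul_assoc]
    match_scalars <;> field_simp <;> ring
  lastY hn := by
    have := congrArg op (h.lastE hn)
    have q0 := hp.q0
    simp only [cbr, op_smul, op_sub, op_mul, op_zero] at this ⊢
    linear_combination (norm := skip) (-q⁻¹) • this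
    simp only [mul_sub, sub_mul, mul_smul_comm, smul_mul_assoc, mul_assoc]
    match_scalars <;> field_simp <;> ring

end Chev

/-! ### Creation and annihilation operators as iterated brackets. -/

section Recursion

variable {F A : Type*} [Field F] [Ring A] [Algebra F A]

/-- The creation operators `x_0 = E_0`, `x_{m+1} = [E_{m+1}, x_m]_{1/q}`. -/
def xs (q : F) (E : ℕ → A) : ℕ → A
  | 0 => E 0
  | m + 1 => cbr q⁻¹ (E (m + 1)) (xs q E m)

/-- The annihilation operators `y_0 = Y_0`, `y_{m+1} = [y_m, Y_{m+1}]_q`. -/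
def ys (q : F) (Y : ℕ → A) : ℕ → A
  | 0 => Y 0
  | m + 1 => cbr q (ys q Y m) (Y (m + 1))

open MulOpposite in
theorem op_ys (q : F) (Y : ℕ → A) (m : ℕ) : xs q⁻¹ (fun i => op (Y i)) m = op (ys q Y m) := by
  induction m with
  | zero => rfl
  | succ m ih => simp [xs, ys, ih, cbr]

open MulOpposite in
theorem op_xs (q : F) (E : ℕ → A) (m : ℕ) : ys q⁻¹ (fun i => op (E i)) m = op (xs q E m) := by
  induction m with
  | zero => rfl
  | succ m ih => simp [xs, ys, ih, cbr]

/-- The element `L_{ij} = [[x_i, y_j]]`. -/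
def Lc (ε : F) (x y : ℕ → A) (i j : ℕ) : A := x i * y j - ε • (y j * x i)

end Recursion

/-! ### Consequences of the quantum Serre relation. -/

section Computations

variable {F A : Type*} [Field F] [Ring A] [Algebra F A] {q b c ε : F}

/-- The Serre operator in `a` is a polynomial in left and right multiplication by `a`, so it
commutes with left and right multiplication by `v`. -/
theorem serre_of_commute {a u v : A} (r s : F) (hv : Commute a v)
    (hu : a * a * u - s • (a * u * a) + u * a * a = 0) :
    a * a * cbr r u v - s • (a * cbr r u v * a) + cbr r u v * a * a = 0 := by
  have e1 := congrArg (· * v) hu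
  have e2 := congrArg (v * ·) hu
  have hv' := hv.eq
  simp only [mul_zero, zero_mul] at e1 e2
  linear_combination (norm := skip) e1 - r • e2
  simp only [cbr, mul_sub, sub_mul, mul_add, add_mul, mul_smul_comm, smul_mul_assoc, mul_assoc,
    hv', mul_mul_of hv']
  module

/-- With `l` and `r` the left and right multiplications by `a`, the Serre operator factors as `(l -
q r)(l - q⁻¹ r)`. -/
theorem qcomm_cbr_of_serre {a u : A} (hq : q ≠ 0)
    (hu : a * a * u - (q + q⁻¹) • (a * u * a) + u * a * a = 0) : QComm q a (cbr q⁻¹ a u) := by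
  unfold QComm cbr
  linear_combination (norm := skip) hu
  simp only [mul_sub, sub_mul, mul_smul_comm, smul_mul_assoc, mul_assoc]
  match_scalars <;> field_simp <;> ring

/-- The situation is that of a middle node `a` between two neighbours `d` and `u`. After
multiplication by `q + q⁻¹`, the commutator is a combination of the two Serre expressions multiplied
by `u` or `d` on either side. -/
theorem commute_cbr_of_serre {a d u : A} (hq : q ≠ 0) (h2 : q * q + 1 ≠ 0)
    (hd : a * a * d - (q + q⁻¹) • (a * d * a) + d * a * a = 0)
    (hu : a * a * u - (q + q⁻¹) • (a * u * a) + u * a * a = 0) (hdu : Commute d u) :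
    Commute a (cbr q⁻¹ d (cbr q⁻¹ a u)) := by
  have hs : q + q⁻¹ ≠ 0 := by
    intro h; apply h2; field_simp at h; linear_combination h
  have e1 := congrArg (· * u) hd
  have e2 := congrArg (u * ·) hd
  have e3 := congrArg (d * ·) hu
  have e4 := congrArg (· * d) hu
  simp only [mul_zero, zero_mul] at e1 e2 e3 e4
  have h := hdu.eq
  unfold Commute SemiconjBy
  refine smul_right_injective A hs ?_
  simp only
  linear_combination (norm := skip) -e1 + (q⁻¹ * q⁻¹) • e2 + e3 - (q⁻¹ * q⁻¹) • e4
  simp only [cbr, mul_sub, sub_mul, mul_add, add_mul, mul_smul_comm, smul_mul_assoc, mul_assoc,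
    h, mul_mul_of h]
  match_scalars <;> field_simp <;> ring

end Computations

/-! ### Action of the Chevalley generators on `x_m` and `y_m`. -/

namespace Chev

variable {F A : Type*} [Field F] [Ring A] [Algebra F A] {q b c ε : F} {n : ℕ}
  {E Y k k' : ℕ → A}

theorem E_xs_far (h : Chev q b c ε n E Y k k') {j m : ℕ} (hm : m + 1 < j) (hj : j < n) :
    Commute (E j) (xs q E m) := by
  induction m with
  | zero => exact h.farE 0 j hm hj
  | succ m ih => exact (h.farE _ _ hm hj).cbr_right _ (ih (by omega))

/-- In `x_m = [E_m, x_{m-1}]_{1/q}` the factor `x_{m-1}` commutes with `E_{m+1}`, so the relation is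
inherited from `E_m`. -/
theorem serre_xs (h : Chev q b c ε n E Y k k') {m : ℕ} (hm : m + 1 < n) :
    E (m + 1) * E (m + 1) * xs q E m - (q + q⁻¹) • (E (m + 1) * xs q E m * E (m + 1)) +
      xs q E m * E (m + 1) * E (m + 1) = 0 := by
  cases m with
  | zero => exact h.serreE 0 (by omega) 1 hm (.inl rfl) le_rfl
  | succ m =>
    exact serre_of_commute _ _ (h.E_xs_far (by omega) hm)
      (h.serreE (m + 1) (by omega) (m + 2) hm (.inl rfl) (by omega))

theorem E_xs_self (h : Chev q b c ε n E Y k k') (hp : QParam q b c ε) {m : ℕ} (hm : m + 1 < n) :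
    QComm q (E (m + 1)) (xs q E (m + 1)) :=
  qcomm_cbr_of_serre hp.q0 (h.serre_xs hm)

/-- The first case is `m = j + 1`: there `E_j` is the middle node between `E_{j+1}` and `x_{j-1}`.
Beyond it, the new factor `E_m` commutes with `E_j`. -/
theorem E_xs_low (h : Chev q b c ε n E Y k k') (hp : QParam q b c ε) {j m : ℕ} (hj : 1 ≤ j)
    (hjm : j < m) (hm : m < n) : Commute (E j) (xs q E m) := by
  induction m, hjm using Nat.le_induction with
  | base =>
    obtain ⟨j, rfl⟩ := Nat.exists_eq_add_of_le' hj
    exact commute_cbr_of_serre hp.q0 hp.h2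
      (h.serreE (j + 2) hm (j + 1) (by omega) (.inr rfl) (by omega)) (h.serre_xs (by omega))
      (h.E_xs_far (by omega) hm)
  | succ m hjm ih =>
    exact (h.farE j (m + 1) (by omega) hm).symm.cbr_right _ (ih (by omega))

theorem k_xs (h : Chev q b c ε n E Y k k') (hp : QParam q b c ε) {i m : ℕ} (hi : i < n)
    (hm : m < n) : QComm (vecWt q i m) (k i) (xs q E m) := by
  have := hp.q0
  induction m with
  | zero => exact (h.kE i hi 0 hm).of_eq (by simp [rootWt, vecWt])
  | succ m ih =>
    refine ((h.kE i hi _ hm).cbr_right q⁻¹ (ih (by omega))).of_eq ?_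
    unfold rootWt vecWt
    split_ifs <;> first | omega | simp_all

theorem k_ys (h : Chev q b c ε n E Y k k') (hp : QParam q b c ε) {i m : ℕ} (hi : i < n)
    (hm : m < n) : QComm (vecWt q i m)⁻¹ (k i) (ys q Y m) := by
  have := hp.q0
  induction m with
  | zero => exact (h.kY i hi 0 hm).of_eq (by simp [rootWt, vecWt])
  | succ m ih =>
    refine ((ih (by omega)).cbr_right q (h.kY i hi _ hm)).of_eq ?_
    unfold rootWt vecWt
    split_ifs <;> first | omega | simp_all

theorem Y_ys_far (h : Chev q b c ε n E Y k k') {j m : ℕ} (hm : m + 1 < j) (hj : j < n) :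
    Commute (Y j) (ys q Y m) := by
  induction m with
  | zero => exact h.farY 0 j hm hj
  | succ m ih => exact (ih (by omega)).cbr_right _ (h.farY _ _ hm hj)

theorem E_ys_high (h : Chev q b c ε n E Y k k') {j m : ℕ} (hm : m < j) (hj : j < n) :
    Commute (E j) (ys q Y m) := by
  induction m with
  | zero => exact h.EY_ne _ hj _ (by omega) (by omega)
  | succ m ih => exact (ih (by omega)).cbr_right _ (h.EY_ne _ hj _ (by omega) (by omega))

/-- Since `E_{m+1}` commutes with `y_m`, only `[y_m, [E_{m+1}, Y_{m+1}]]_q` is left. With `K =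
k_{m+1} k_m⁻¹`, the `K⁻¹` part of the Cartan element cancels in the `q`-bracket with `y_m`, and the
`K` part yields the factor `c (q - q⁻¹) = b`. -/
theorem E_ys_self (h : Chev q b c ε n E Y k k') (hp : QParam q b c ε) {m : ℕ} (hm : m + 1 < n) :
    E (m + 1) * ys q Y (m + 1) - ys q Y (m + 1) * E (m + 1) =
      -(k (m + 1) * k' m * ys q Y m) := by
  have hm' : m < n := by omega
  have q0 := hp.q0
  have hb := hp.hc
  have e1 : E (m + 1) * ys q Y m = ys q Y m * E (m + 1) := h.E_ys_high (by omega) hm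
  have k1 : k m * ys q Y m = q⁻¹ • (ys q Y m * k m) :=
    (h.k_ys hp hm' hm').of_eq (by simp [vecWt])
  have k2 : k' m * ys q Y m = q • (ys q Y m * k' m) :=
    ((h.k_ys hp hm' hm').inv_left (inv_ne_zero (vecWt_ne q0 _ _)) (h.kk' m hm')
      (h.k'k m hm')).of_eq (by simp [vecWt])
  have k3 : k (m + 1) * ys q Y m = ys q Y m * k (m + 1) :=
    ((h.k_ys hp hm hm').of_eq (d := 1) (by simp [vecWt])).commute
  have k4 : k' (m + 1) * ys q Y m = ys q Y m * k' (m + 1) :=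
    (((h.k_ys hp hm hm').inv_left (inv_ne_zero (vecWt_ne q0 _ _)) (h.kk' _ hm)
      (h.k'k _ hm)).of_eq (d := 1) (by simp [vecWt])).commute
  have r := h.EY m hm
  have r1 := congrArg (ys q Y m * ·) r
  have r2 := congrArg (· * ys q Y m) r
  refine smul_right_injective A hp.b0 ?_
  simp only [ys] at *
  linear_combination (norm := skip) r1 - q • r2
  rw [← hb]
  simp only [cbr, mul_sub, sub_mul, mul_smul_comm, smul_mul_assoc, mul_assoc, e1, mul_mul_of e1,
    k2, k4, mul_mul_of k1, mul_mul_of k3, smul_sub, smul_neg]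
  match_scalars <;> field_simp <;> ring

theorem E_ys_low (h : Chev q b c ε n E Y k k') (hp : QParam q b c ε) {j m : ℕ} (hj : 1 ≤ j)
    (hjm : j < m) (hm : m < n) : Commute (E j) (ys q Y m) := by
  induction m, hjm using Nat.le_induction with
  | base =>
    obtain ⟨j, rfl⟩ := Nat.exists_eq_add_of_le' hj
    have hj1 : j + 1 < n := by omega
    have hj0 : j < n := by omega
    have q0 := hp.q0
    -- The commutator with `y_{j+2} = [y_{j+1}, Y_{j+2}]_q` reduces to the `q`-bracket of `k_{j+1}
    -- k_j⁻¹ y_j` with `Y_{j+2}`, which vanishes because `k_{j+1}` has weight `q` on `Y_{j+2}` and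
    -- the other two factors commute with it.
    have e1 : E (j + 1) * ys q Y (j + 1) =
        ys q Y (j + 1) * E (j + 1) - k (j + 1) * (k' j * ys q Y j) := by
      rw [← mul_assoc]
      linear_combination (norm := module) h.E_ys_self hp hj1
    have e2 : E (j + 1) * Y (j + 2) = Y (j + 2) * E (j + 1) :=
      h.EY_ne _ hj1 _ hm (by omega)
    have e3 : Y (j + 2) * ys q Y j = ys q Y j * Y (j + 2) := h.Y_ys_far (by omega) hm
    have k1 : k (j + 1) * Y (j + 2) = q • (Y (j + 2) * k (j + 1)) :=
      (h.kY _ hj1 _ hm).of_eq (by simp [rootWt])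
    have k2 : k' j * Y (j + 2) = Y (j + 2) * k' j :=
      (((h.kY _ hj0 _ hm).inv_left (inv_ne_zero (rootWt_ne q0 _ _)) (h.kk' _ hj0)
      (h.k'k _ hj0)).of_eq (d := 1)
        (by rw [rootWt, if_neg (by omega), if_neg (by omega), inv_one, inv_one])).commute
    have k1' : Y (j + 2) * k (j + 1) = q⁻¹ • (k (j + 1) * Y (j + 2)) := by
      rw [k1, smul_smul, inv_mul_cancel₀ q0, one_smul]
    rw [ys]
    unfold Commute SemiconjBy
    simp only [cbr, mul_sub, sub_mul, mul_smul_comm, smul_mul_assoc, mul_assoc, e1, mul_mul_of e1,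
      e2, mul_mul_of e2, mul_mul_of k1', ← e3, mul_mul_of k2.symm, smul_sub, smul_smul,
      mul_inv_cancel₀ q0, one_smul]
    module
  | succ m hjm ih =>
    exact (ih (by omega)).cbr_right _ (h.EY_ne _ (by omega) _ hm (by omega))

open MulOpposite in
theorem Y_xs_self (h : Chev q b c ε n E Y k k') (hp : QParam q b c ε) {m : ℕ} (hm : m + 1 < n) :
    xs q E (m + 1) * Y (m + 1) - Y (m + 1) * xs q E (m + 1) =
      -(xs q E m * k m * k' (m + 1)) := by
  have := (h.star hp).E_ys_self hp.star hm
  rw [op_xs, op_xs] at this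
  apply op_injective
  simpa [mul_assoc] using this

/-- As `E_{m+1}` commutes with `y_m`, the left-hand side is `[E_{m+1}, L_{mm}]_{1/q}`; the term with
`k_m⁻¹` cancels. This identity is the source of the inverse formula for `E_{m+1}`. -/
theorem L_succ (h : Chev q b c ε n E Y k k') (hp : QParam q b c ε) {m : ℕ} (hm : m + 1 < n)
    (hL : Lc ε (xs q E) (ys q Y) m m = c • (k m - k' m)) :
    Lc ε (xs q E) (ys q Y) (m + 1) m = b • (k m * E (m + 1)) := by
  have hm' : m < n := by omega
  have q0 := hp.q0
  have e1 : E (m + 1) * ys q Y m = ys q Y m * E (m + 1) := h.E_ys_high (by omega) hm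
  have k1 : k m * E (m + 1) = q⁻¹ • (E (m + 1) * k m) :=
    (h.kE _ hm' _ hm).of_eq (by simp [rootWt])
  have k2 : k' m * E (m + 1) = q • (E (m + 1) * k' m) :=
    ((h.kE _ hm' _ hm).inv_left (rootWt_ne q0 _ _) (h.kk' m hm')
      (h.k'k m hm')).of_eq (by simp [rootWt])
  have r1 := congrArg (E (m + 1) * ·) hL
  have r2 := congrArg (· * E (m + 1)) hL
  simp only [Lc, xs] at *
  linear_combination (norm := skip) r1 - q⁻¹ • r2
  rw [← hp.hc]
  simp only [cbr, mul_sub, sub_mul, mul_smul_comm, smul_mul_assoc, mul_assoc, e1, mul_mul_of e1,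
    k1, k2, smul_sub]
  match_scalars <;> field_simp <;> ring

/-- The induction telescopes. The bracket of `L_{m+1,m} = b k_m E_{m+1}` with `Y_{m+1}` gives `c
(k_{m+1} - k_m² k_{m+1}⁻¹)`; the remaining terms give `L_{mm} k_m k_{m+1}⁻¹ = c (k_m² k_{m+1}⁻¹ -
k_{m+1}⁻¹)`. -/
theorem L_self (h : Chev q b c ε n E Y k k') (hp : QParam q b c ε) {m : ℕ} (hm : m < n) :
    Lc ε (xs q E) (ys q Y) m m = c • (k m - k' m) := by
  induction m with
  | zero => exact h.EY_zero hm
  | succ m ih =>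
    have hm' : m < n := by omega
    have q0 := hp.q0
    have hL := ih hm'
    have hL' := h.L_succ hp hm hL
    have hX := h.Y_xs_self hp hm
    have k1 : k m * Y (m + 1) = q • (Y (m + 1) * k m) :=
      (h.kY _ hm' _ hm).of_eq (by simp [rootWt])
    have k1' : Y (m + 1) * k m = q⁻¹ • (k m * Y (m + 1)) := by
      rw [k1, smul_smul, inv_mul_cancel₀ q0, one_smul]
    have k2 : k m * ys q Y m = q⁻¹ • (ys q Y m * k m) :=
      (h.k_ys hp hm' hm').of_eq (by simp [vecWt])
    have k3 : k' (m + 1) * ys q Y m = ys q Y m * k' (m + 1) :=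
      (((h.k_ys hp hm hm').inv_left (inv_ne_zero (vecWt_ne q0 _ _)) (h.kk' _ hm)
        (h.k'k _ hm)).of_eq (d := 1) (by simp [vecWt])).commute
    have r := congrArg (k m * ·) (h.EY m hm)
    have r1 := congrArg (· * Y (m + 1)) hL'
    have r2 := congrArg (Y (m + 1) * ·) hL'
    have r3 := congrArg (· * (k m * k' (m + 1))) hL
    have r4 := congrArg (ys q Y m * ·) hX
    have r5 := congrArg (· * ys q Y m) hX
    have c1 : k m * k (m + 1) = k (m + 1) * k m := h.comm _ hm' _ hm
    have c2 : k' (m + 1) * k m = k m * k' (m + 1) := (h.kk'_comm hm' hm).symm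
    have c3 := h.k'k m hm'
    have c4 := h.kk' m hm'
    -- A formal identity, obtained by expanding `y_{m+1} = [y_m, Y_{m+1}]_q`; no relation of the
    -- algebra enters.
    have e : Lc ε (xs q E) (ys q Y) (m + 1) (m + 1) =
      Lc ε (xs q E) (ys q Y) (m + 1) m * Y (m + 1) - q • (Y (m + 1) *
        Lc ε (xs q E) (ys q Y) (m + 1) m)
      + ε • (ys q Y m * (xs q E (m + 1) * Y (m + 1) - Y (m + 1) * xs q E (m + 1)))
      - q • ((xs q E (m + 1) * Y (m + 1) - Y (m + 1) * xs q E (m + 1)) * ys q Y m) := by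
      rw [Lc, Lc, ys]
      simp only [cbr, mul_sub, sub_mul, mul_smul_comm, smul_mul_assoc, mul_assoc]
      module
    rw [e, hL', hX]
    simp only [Lc] at r3
    linear_combination (norm := skip) r + r3
    simp only [mul_sub, sub_mul, mul_smul_comm, smul_mul_assoc, mul_assoc, smul_sub, mul_mul_of k1', k3, mul_mul_of k2, mul_mul_of c1, mul_mul_of c3,
      c4, one_mul, mul_one, neg_mul, mul_neg, smul_neg]
    match_scalars <;> field_simp <;> ring

end Chev

/-! ### Root vectors of weight `ε_i - ε_j`. -/

/-- `e` behaves as the root vector that raises `x_j` to `x_i`. -/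
structure IsRootVec {F A : Type*} [Field F] [Ring A] [Algebra F A] (q : F) (n : ℕ)
    (x y k k' : ℕ → A) (i j : ℕ) (e : A) : Prop where
  ex_j : e * x j = q⁻¹ • (x j * e) + x i
  ex_i : e * x i = q • (x i * e)
  ex_out : ∀ m < n, (m < j ∨ i < m) → Commute e (x m)
  ey_out : ∀ m < n, (m ≤ j ∨ i < m) → Commute e (y m)
  ey_i : e * y i = y i * e - k i * (k' j * y j)
  ke : ∀ m < n, QComm (pairWt q i j m) (k m) e

theorem Chev.exists_rootVec {F A : Type*} [Field F] [Ring A] [Algebra F A] {q b c ε : F} {n : ℕ}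
    {E Y k k' : ℕ → A} (h : Chev q b c ε n E Y k k') (hp : QParam q b c ε) {i j : ℕ} (hij : j < i)
    (hi : i < n) : ∃ e, IsRootVec q n (xs q E) (ys q Y) k k' i j e := by
  have q0 := hp.q0
  induction i, hij using Nat.le_induction with
  | base =>
    -- For adjacent indices the root vector is simple.
    refine ⟨E (j + 1), ?_, h.E_xs_self hp hi, ?_, ?_, ?_, ?_⟩
    · rw [xs, cbr]; module
    · rintro m hm (hmj | hjm)
      · exact h.E_xs_far (by omega) hi
      · exact h.E_xs_low hp (by omega) (by omega) hm
    · rintro m hm (hmj | hjm)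
      · exact h.E_ys_high (by omega) hi
      · exact h.E_ys_low hp (by omega) (by omega) hm
    · rw [← mul_assoc]
      linear_combination (norm := module) h.E_ys_self hp hi
    · intro m hm
      refine (h.kE m hm _ hi).of_eq ?_
      unfold rootWt pairWt
      split_ifs <;> first | omega | rfl
  | succ i hij ih =>
    have hi' : i < n := by omega
    obtain ⟨e, he⟩ := ih hi'
    have e1 : E (i + 1) * xs q E j = xs q E j * E (i + 1) := h.E_xs_far (by omega) hi
    have e2 : E (i + 1) * xs q E i = q⁻¹ • (xs q E i * E (i + 1)) + xs q E (i + 1) := by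
      rw [xs, cbr]; module
    have e3 : e * xs q E (i + 1) = xs q E (i + 1) * e := he.ex_out _ hi (by omega)
    have e4 : E (i + 1) * xs q E (i + 1) = q • (xs q E (i + 1) * E (i + 1)) := h.E_xs_self hp hi
    -- The bracket follows the path from `x_j` to `x_{i+1}` through `x_i`: `e` makes the first step
    -- and `E_{i+1}` the second.
    refine ⟨cbr q⁻¹ (E (i + 1)) e, ?_, ?_, ?_, ?_, ?_, ?_⟩
    · simp only [cbr, mul_sub, sub_mul, mul_smul_comm, smul_mul_assoc, mul_assoc, he.ex_j, e1,
        mul_add, mul_mul_of e1, e2, mul_mul_of he.ex_j, add_mul, smul_add]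
      module
    · simp only [cbr, mul_sub, sub_mul, mul_smul_comm, smul_mul_assoc, mul_assoc, e3,
        mul_mul_of e3, e4, mul_mul_of e4]
      match_scalars <;> field_simp
    · rintro m hm (hmj | hjm)
      · exact (h.E_xs_far (by omega) hi).cbr_left _ (he.ex_out _ hm (by omega))
      · exact (h.E_xs_low hp (by omega) hjm hm).cbr_left _ (he.ex_out _ hm (by omega))
    · rintro m hm (hmj | hjm)
      · exact (h.E_ys_high (by omega) hi).cbr_left _ (he.ey_out _ hm (by omega))
      · exact (h.E_ys_low hp (by omega) hjm hm).cbr_left _ (he.ey_out _ hm (by omega))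
    · have f1 : e * ys q Y (i + 1) = ys q Y (i + 1) * e := he.ey_out _ hi (by omega)
      have f2 : E (i + 1) * ys q Y (i + 1) =
          ys q Y (i + 1) * E (i + 1) - k (i + 1) * (k' i * ys q Y i) := by
        rw [← mul_assoc]
        linear_combination (norm := module) h.E_ys_self hp hi
      have f3 : k (i + 1) * e = e * k (i + 1) :=
        ((he.ke _ hi).of_eq (d := 1)
          (by rw [pairWt, if_neg (by omega), if_neg (by omega)])).commute
      have f4 : k' i * e = q⁻¹ • (e * k' i) :=
        ((he.ke _ hi').inv_left (pairWt_ne q0 _ _ _) (h.kk' i hi') (h.k'k i hi')).of_eq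
          (by simp [pairWt])
      have f4' : e * k' i = q • (k' i * e) := by
        rw [f4, smul_smul, mul_inv_cancel₀ q0, one_smul]
      simp only [cbr, mul_sub, sub_mul, mul_smul_comm, smul_mul_assoc, mul_assoc, f1, mul_mul_of f1,
        f2, mul_mul_of f2, mul_mul_of f3.symm, mul_mul_of f4', he.ey_i, mul_mul_of (h.k'k i hi'),
        one_mul, smul_sub, smul_smul]
      match_scalars <;> field_simp <;> ring
    · intro m hm
      refine ((h.kE m hm _ hi).cbr_right _ (he.ke m hm)).of_eq ?_
      unfold rootWt pairWt
      split_ifs <;> first | omega | simp_all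


/-! ### The deformed triple relations and their transport by root vectors. -/

section SerreForms

variable {F A : Type*} [Field F] [Ring A] [Algebra F A]

/-- The first form of the deformed triple relation. -/
def serreT (q ε : F) (u v w : A) : A :=
  cbr (F := F) (q ^ 2) (cbr ε u w) v + q • cbr (F := F) 1 (cbr ε u v) w

/-- The second form of the deformed triple relation. -/
def serreS (q ε : F) (u v w : A) : A :=
  cbr (F := F) (q ^ 2) v (cbr ε u w) + q • cbr (F := F) 1 u (cbr ε v w)

variable {q b c ε : F}

/-- When the last two arguments agree, the two summands of `serreT` combine to `1 + q` times the
Serre relation at the short root. -/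
theorem serreT_of_last {u v : A} (h : cbr q (cbr ε u v) v = 0) : serreT q ε u v v = 0 := by
  have : serreT q ε u v v = (1 + q) • cbr q (cbr ε u v) v := by
    simp only [serreT, cbr]; match_scalars <;> ring
  rw [this, h, smul_zero]

theorem last_of_serreT (h1 : 1 + q ≠ 0) {u v : A} (h : serreT q ε u v v = 0) :
    cbr q (cbr ε u v) v = 0 := by
  have : serreT q ε u v v = (1 + q) • cbr q (cbr ε u v) v := by
    simp only [serreT, cbr]; match_scalars <;> ring
  rw [this] at h
  exact (smul_eq_zero.1 h).resolve_left h1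

theorem serreT_raise_fst {e u u' w : A} (hw : Commute e w) (hu : e * u = q⁻¹ • (u * e) + u')
    (h : serreT q ε u w w = 0) : serreT q ε u' w w = 0 := by
  have r1 := congrArg (e * ·) h
  have r2 := congrArg (· * e) h
  have hw := hw.eq
  simp only [mul_zero, zero_mul] at r1 r2
  linear_combination (norm := skip) r1 - q⁻¹ • r2
  simp only [serreT, cbr, mul_sub, sub_mul, mul_smul_comm, smul_mul_assoc, mul_assoc, mul_add,
    add_mul, hw, mul_mul_of hw, hu, mul_mul_of hu, smul_add, smul_sub]
  match_scalars <;> ring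

/-- A `q`-polarization: the expression is quadratic in `w`, whence the twist `q⁻¹ q⁻¹`, and the
twisted commutator with `e` replaces one of the two factors `w` by `v`, up to the factor `(1 + q) /
q`. -/
theorem serreT_raise_last {e u v w : A} (q0 : q ≠ 0) (h1 : 1 + q ≠ 0) (hu : Commute e u)
    (hw : e * w = q⁻¹ • (w * e) + v) (h : serreT q ε u w w = 0) : serreT q ε u v w = 0 := by
  have hu := hu.eq
  have key : serreT q ε u v w = (q * (1 + q)⁻¹) •
      (e * serreT q ε u w w - (q⁻¹ * q⁻¹) • (serreT q ε u w w * e)) := by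
    simp only [serreT, cbr, mul_sub, sub_mul, mul_smul_comm, smul_mul_assoc, mul_assoc, mul_add,
      add_mul, hu, hw, mul_mul_of hu, mul_mul_of hw, smul_add, smul_sub]
    match_scalars <;> field_simp <;> ring
  rw [key, h]; simp

/-- The remaining `w` is also raised to `v`. The twists `q` for `v` and `q⁻¹` for `w` cancel, so the
ordinary commutator with `e` is used. -/
theorem serreT_raise_mid {e u v w : A} (q0 : q ≠ 0) (h2 : q * q + 1 ≠ 0) (hu : Commute e u)
    (hw : e * w = q⁻¹ • (w * e) + v) (hv : e * v = q • (v * e)) (h : serreT q ε u v w = 0) :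
    serreT q ε u v v = 0 := by
  have hu := hu.eq
  have h2' : q ^ 2 + 1 ≠ 0 := by rwa [pow_two]
  have key : serreT q ε u v v = ((1 + q) * (q * q + 1)⁻¹) •
      (e * serreT q ε u v w - serreT q ε u v w * e) := by
    simp only [serreT, cbr, mul_sub, sub_mul, mul_smul_comm, smul_mul_assoc, mul_assoc, mul_add,
      add_mul, hu, hw, hv, mul_mul_of hu, mul_mul_of hw, mul_mul_of hv, smul_add, smul_sub]
    match_scalars <;> field_simp <;> ring
  rw [key, h]; simp

/-- The passage from (II) to (II*): raising one `w` of a relation of content `u w w` to `u` gives a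
relation of content `u u w`. -/
theorem serreS_of_serreT {e u w : A} (q0 : q ≠ 0) (hε : ε * ε = 1)
    (hw : e * w = q⁻¹ • (w * e) + u) (hu : e * u = q • (u * e)) (h : serreT q ε u w w = 0) :
    serreS q ε u u w = 0 := by
  have key : serreS q ε u u w = (-ε) •
      (e * serreT q ε u w w - q⁻¹ • (serreT q ε u w w * e)) := by
    clear h
    rcases mul_self_eq_one_iff.1 hε with rfl | rfl
    all_goals simp only [serreT, serreS, cbr, mul_sub, sub_mul, mul_smul_comm, smul_mul_assoc, mul_assoc, mul_add,
      add_mul, hw, hu, mul_mul_of hw, mul_mul_of hu, smul_add, smul_sub]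
    all_goals match_scalars <;> field_simp <;> ring
  rw [key, h]; simp

theorem serreS_raise_fst {e u v w : A} (q0 : q ≠ 0) (h1 : 1 + q ≠ 0) (hw : Commute e w)
    (hv : e * v = q⁻¹ • (v * e) + u) (h : serreS q ε v v w = 0) : serreS q ε u v w = 0 := by
  have hw := hw.eq
  have key : serreS q ε u v w = (q * (1 + q)⁻¹) •
      (e * serreS q ε v v w - (q⁻¹ * q⁻¹) • (serreS q ε v v w * e)) := by
    simp only [serreS, cbr, mul_sub, sub_mul, mul_smul_comm, smul_mul_assoc, mul_assoc, mul_add,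
      add_mul, hw, hv, mul_mul_of hw, mul_mul_of hv, smul_add, smul_sub]
    match_scalars <;> field_simp <;> ring
  rw [key, h]; simp

end SerreForms

/-! ### One half of the parastatistics relations. -/

/-- The relations of the deformed parastatistics algebra that involve `L_{ij}` for `i > j` or
three creation operators, with indices counted from the short root. -/
structure Half {F A : Type*} [Field F] [Ring A] [Algebra F A] (q b c ε : F) (n : ℕ)
    (x y k k' : ℕ → A) : Prop where
  kk' : ∀ i < n, k i * k' i = 1
  k'k : ∀ i < n, k' i * k i = 1
  comm : ∀ i < n, ∀ j < n, Commute (k i) (k j)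
  kx : ∀ i < n, ∀ j < n, QComm (vecWt q i j) (k i) (x j)
  ky : ∀ i < n, ∀ j < n, QComm (vecWt q i j)⁻¹ (k i) (y j)
  L_self : ∀ i < n, Lc ε x y i i = c • (k i - k' i)
  Lx_j : ∀ i < n, ∀ j < i, Lc ε x y i j * x j = x j * Lc ε x y i j + b • (x i * k j)
  Lx_i : ∀ i < n, ∀ j < i, Lc ε x y i j * x i = q • (x i * Lc ε x y i j)
  Lx_out : ∀ i < n, ∀ j < i, ∀ m < n, (m < j ∨ i < m) → Commute (Lc ε x y i j) (x m)
  Lx_mid : ∀ i < n, ∀ j < i, ∀ m < i, j < m →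
    Lc ε x y i j * x m = x m * Lc ε x y i j + (q - q⁻¹) • (x i * Lc ε x y m j)
  Ly_i : ∀ i < n, ∀ j < i, Lc ε x y i j * y i = y i * Lc ε x y i j - b • (y j * k i)
  Ly_j : ∀ i < n, ∀ j < i, Lc ε x y i j * y j = q⁻¹ • (y j * Lc ε x y i j)
  Ly_out : ∀ i < n, ∀ j < i, ∀ m < n, (m < j ∨ i < m) → Commute (Lc ε x y i j) (y m)
  Ly_mid : ∀ i < n, ∀ j < i, ∀ m < i, j < m →
    Lc ε x y i j * y m = y m * Lc ε x y i j - (q - q⁻¹) • (Lc ε x y i m * y j)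
  serre_T : ∀ i < n, ∀ j < i, ∀ m ≤ j, serreT q ε (x i) (x j) (x m) = 0
  serre_S : ∀ i < n, ∀ j ≤ i, ∀ m < j, serreS q ε (x i) (x j) (x m) = 0

/-! ### Derivation of these relations from root vectors. -/

section RootVectors

variable {F A : Type*} [Field F] [Ring A] [Algebra F A] {q b c ε : F} {n : ℕ}
  {x y k k' : ℕ → A}

/-- The computation of `Chev.L_succ` for arbitrary `j < i`: `x_i = [e, x_j]_{1/q}` and `e` commutes
with `y_j`. Since `b` and `k_j` are invertible, this also determines `e`, so its mere existence
suffices elsewhere. -/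
theorem IsRootVec.L_eq (hp : QParam q b c ε) {i j : ℕ} {e : A} (he : IsRootVec q n x y k k' i j e)
    (hk : k j * k' j = 1) (hk' : k' j * k j = 1) (hij : j < i) (hi : i < n)
    (hL : Lc ε x y j j = c • (k j - k' j)) : Lc ε x y i j = b • (k j * e) := by
  have hj : j < n := by omega
  have q0 := hp.q0
  have e1 : e * y j = y j * e := he.ey_out _ hj (by omega)
  have k1 : k j * e = q⁻¹ • (e * k j) :=
    (he.ke _ hj).of_eq (by rw [pairWt, if_neg (by omega), if_pos rfl])
  have k2 : k' j * e = q • (e * k' j) :=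
    ((he.ke _ hj).inv_left (pairWt_ne q0 _ _ _) hk hk').of_eq
      (by rw [pairWt, if_neg (by omega), if_pos rfl, inv_inv])
  have hx : x i = e * x j - q⁻¹ • (x j * e) := by rw [he.ex_j]; module
  have r1 := congrArg (e * ·) hL
  have r2 := congrArg (· * e) hL
  simp only [Lc] at *
  rw [hx]
  linear_combination (norm := skip) r1 - q⁻¹ • r2
  rw [← hp.hc]
  simp only [mul_sub, sub_mul, mul_smul_comm, smul_mul_assoc, mul_assoc, e1, mul_mul_of e1,
    k1, k2, smul_sub]
  match_scalars <;> field_simp <;> ring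

theorem k_L {wi wj : F} {K : A} {i j : ℕ} (h1 : QComm wi K (x i)) (h2 : QComm wj K (y j)) :
    QComm (wi * wj) K (Lc ε x y i j) :=
  (h1.mul_right h2).sub_right ((mul_comm wj wi ▸ h2.mul_right h1).smul_right ε)

/-- Both `l` and `u` are raised by `e` with twist `q⁻¹`, so `z ↦ e z - q⁻² z e` is applied to `l u =
q u l`. The two terms in `l v = v l` leave the coefficient `q - q⁻¹`. -/
theorem mid_of_raise {e l L u v : A} (q0 : q ≠ 0) (hl : e * l = q⁻¹ • (l * e) + L)
    (hu : e * u = q⁻¹ • (u * e) + v) (hlu : l * u = q • (u * l)) (hlv : l * v = v * l) :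
    L * u = u * L + (q - q⁻¹) • (v * l) := by
  have r1 := congrArg (e * ·) hlu
  have r2 := congrArg (· * e) hlu
  linear_combination (norm := skip) r1 - (q⁻¹ * q⁻¹) • r2
  simp only [mul_smul_comm, smul_mul_assoc, mul_assoc, mul_mul_of hl, mul_mul_of hu,
    add_mul, hu, hl, mul_add, hlv]
  match_scalars <;> field_simp <;> ring

/-- The counterpart for lowering: the ordinary commutator with `e` is applied to `l u = q⁻¹ u l`,
and the Cartan factor `K` that appears on the left is cancelled by `K'`. -/
theorem mid_of_lower {e l L u v K K' : A} (q0 : q ≠ 0) (hK : K' * K = 1)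
    (hl : e * l = l * e - K * L) (hu : e * u = u * e - K * v) (hlK : l * K = q • (K * l))
    (huK : u * K = q • (K * u)) (hlu : l * u = q⁻¹ • (u * l)) (hlv : l * v = v * l) :
    L * u = u * L - (q - q⁻¹) • (l * v) := by
  have key : K * (L * u) = K * (u * L - (q - q⁻¹) • (l * v)) := by
    have r1 := congrArg (e * ·) hlu
    have r2 := congrArg (· * e) hlu
    linear_combination (norm := skip) r2 - r1
    simp only [mul_smul_comm, smul_mul_assoc, mul_assoc, mul_mul_of hl, mul_mul_of hu,
      sub_mul, hu, hl, mul_sub, mul_mul_of hlK, mul_mul_of huK, hlv]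
    match_scalars <;> field_simp <;> ring
  have := congrArg (K' * ·) key
  simpa only [← mul_assoc, hK, one_mul] using this

theorem half_of_rootVec (hp : QParam q b c ε) (kk' : ∀ i < n, k i * k' i = 1)
    (k'k : ∀ i < n, k' i * k i = 1) (comm : ∀ i < n, ∀ j < n, Commute (k i) (k j))
    (kx : ∀ i < n, ∀ j < n, QComm (vecWt q i j) (k i) (x j))
    (ky : ∀ i < n, ∀ j < n, QComm (vecWt q i j)⁻¹ (k i) (y j))
    (hL : ∀ i < n, Lc ε x y i i = c • (k i - k' i))
    (he : ∀ i < n, ∀ j < i, ∃ e, IsRootVec q n x y k k' i j e)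
    (hT : 1 < n → cbr q (cbr ε (x 1) (x 0)) (x 0) = 0) : Half q b c ε n x y k k' := by
  have q0 := hp.q0
  -- The triple relations spread from indices `(1,0,0)` to `(i,0,0)`, then through `(i,j,0)` to
  -- `(i,j,j)`, and from there to the second form with indices `(i,i,j)`. The cases with three
  -- distinct indices follow by polarization at the end.
  have T1 : 1 < n → serreT q ε (x 1) (x 0) (x 0) = 0 := fun h => serreT_of_last (hT h)
  have T2 : ∀ i < n, 0 < i → serreT q ε (x i) (x 0) (x 0) = 0 := by
    intro i hi hi0
    rcases Nat.eq_or_lt_of_le (Nat.succ_le_of_lt hi0) with rfl | hi1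
    · exact T1 hi
    · obtain ⟨e, he⟩ := he i hi 1 hi1
      exact serreT_raise_fst (he.ex_out 0 (by omega) (by omega)) he.ex_j (T1 (by omega))
  have T3 : ∀ i < n, ∀ j < i, serreT q ε (x i) (x j) (x j) = 0 := by
    intro i hi j hj
    rcases Nat.eq_zero_or_pos j with rfl | hj0
    · exact T2 i hi hj
    · obtain ⟨e, he⟩ := he j (by omega) 0 hj0
      have hu := he.ex_out i hi (by omega)
      exact serreT_raise_mid q0 hp.h2 hu he.ex_j he.ex_i
        (serreT_raise_last q0 hp.h1 hu he.ex_j (T2 i hi (by omega)))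
  have S1 : ∀ i < n, ∀ j < i, serreS q ε (x i) (x i) (x j) = 0 := by
    intro i hi j hj
    obtain ⟨e, he⟩ := he i hi j hj
    exact serreS_of_serreT q0 hp.hε he.ex_j he.ex_i (T3 i hi j hj)
  have xi_k : ∀ i < n, ∀ j < n, i ≠ j → Commute (k j) (x i) := fun i hi j hj hij =>
    ((kx j hj i hi).of_eq (d := 1) (by rw [vecWt, if_neg (Ne.symm hij)])).commute
  have yi_k : ∀ i < n, ∀ j < n, i ≠ j → Commute (k j) (y i) := fun i hi j hj hij =>
    ((ky j hj i hi).of_eq (d := 1) (by rw [vecWt, if_neg (Ne.symm hij), inv_one])).commute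
  have Lx_out : ∀ i < n, ∀ j < i, ∀ m < n, (m < j ∨ i < m) → Commute (Lc ε x y i j) (x m) := by
    intro i hi j hj m hm hmo
    have hjn : j < n := by omega
    obtain ⟨e, he⟩ := he i hi j hj
    rw [he.L_eq hp (kk' j hjn) (k'k j hjn) hj hi (hL j hjn)]
    exact ((xi_k m hm j hjn (by omega)).mul_left (he.ex_out m hm hmo)).smul_left b
  have Lx_i : ∀ i < n, ∀ j < i, Lc ε x y i j * x i = q • (x i * Lc ε x y i j) := by
    intro i hi j hj
    have hjn : j < n := by omega
    obtain ⟨e, he⟩ := he i hi j hj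
    rw [he.L_eq hp (kk' j hjn) (k'k j hjn) hj hi (hL j hjn)]
    have h1 := (xi_k i hi j hjn (by omega)).eq
    simp only [mul_smul_comm, smul_mul_assoc, mul_assoc, he.ex_i, mul_mul_of h1]
    module
  have Ly_out : ∀ i < n, ∀ j < i, ∀ m < n, (m < j ∨ i < m) → Commute (Lc ε x y i j) (y m) := by
    intro i hi j hj m hm hmo
    have hjn : j < n := by omega
    obtain ⟨e, he⟩ := he i hi j hj
    rw [he.L_eq hp (kk' j hjn) (k'k j hjn) hj hi (hL j hjn)]
    exact ((yi_k m hm j hjn (by omega)).mul_left (he.ey_out m hm (by omega))).smul_left b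
  have Ly_j : ∀ i < n, ∀ j < i, Lc ε x y i j * y j = q⁻¹ • (y j * Lc ε x y i j) := by
    intro i hi j hj
    have hjn : j < n := by omega
    obtain ⟨e, he⟩ := he i hi j hj
    rw [he.L_eq hp (kk' j hjn) (k'k j hjn) hj hi (hL j hjn)]
    have h1 : e * y j = y j * e := he.ey_out j hjn (by omega)
    have h2 : k j * y j = q⁻¹ • (y j * k j) := (ky j hjn j hjn).of_eq (by simp [vecWt])
    simp only [mul_smul_comm, smul_mul_assoc, mul_assoc, h1, mul_mul_of h2]
    module
  refine ⟨kk', k'k, comm, kx, ky, hL, ?_, Lx_i, Lx_out, ?_, ?_, Ly_j, Ly_out, ?_, ?_, ?_⟩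
  · intro i hi j hj
    have hjn : j < n := by omega
    obtain ⟨e, he⟩ := he i hi j hj
    rw [he.L_eq hp (kk' j hjn) (k'k j hjn) hj hi (hL j hjn)]
    have h1 := (xi_k i hi j hjn (by omega)).eq
    have h2 : k j * x j = q • (x j * k j) := (kx j hjn j hjn).of_eq (by simp [vecWt])
    simp only [mul_smul_comm, smul_mul_assoc, mul_assoc, he.ex_j, mul_mul_of h2, mul_add, h1]
    match_scalars <;> field_simp
  · intro i hi j hj m hmi hjm
    have hmn : m < n := by omega
    have hjn : j < n := by omega
    obtain ⟨e, he⟩ := he i hi m hmi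
    have h1 : e * y j = y j * e := he.ey_out j hjn (by omega)
    have hx : x i = e * x m - q⁻¹ • (x m * e) := by rw [he.ex_j]; module
    -- The root vector from `x_m` to `x_i` also raises `L_{mj}` to `L_{ij}`, since it commutes with
    -- `y_j`.
    have hLi : e * Lc ε x y m j = q⁻¹ • (Lc ε x y m j * e) + Lc ε x y i j := by
      simp only [Lc]
      rw [hx]
      simp only [mul_sub, sub_mul, mul_smul_comm, smul_mul_assoc, mul_assoc, h1, mul_mul_of h1]
      module
    have hLm := Lx_i m hmn j hjm
    have hout : Lc ε x y m j * x i = x i * Lc ε x y m j := Lx_out m hmn j hjm i hi (by omega)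
    exact mid_of_raise q0 hLi he.ex_j hLm hout
  · intro i hi j hj
    have hjn : j < n := by omega
    obtain ⟨e, he⟩ := he i hi j hj
    rw [he.L_eq hp (kk' j hjn) (k'k j hjn) hj hi (hL j hjn)]
    have h1 := (yi_k i hi j hjn (by omega)).eq
    have h2 := (yi_k j hjn i hi (by omega)).eq
    have h3 := (comm j hjn i hi).eq
    simp only [mul_smul_comm, smul_mul_assoc, mul_assoc, he.ey_i, mul_mul_of h3, mul_sub,
      mul_mul_of (kk' j hjn), mul_mul_of h1, one_mul, h2, smul_sub]
  · intro i hi j hj m hmi hjm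
    have hmn : m < n := by omega
    have hjn : j < n := by omega
    obtain ⟨e, he⟩ := he m hmn j hjm
    have h1 : e * x i = x i * e := he.ex_out i hi (by omega)
    have h2 : x i * k m = k m * x i := (xi_k i hi m hmn (by omega)).symm
    have h3 : x i * k' j = k' j * x i := ((kx j hjn i hi).inv_left (vecWt_ne q0 _ _)
      (kk' j hjn) (k'k j hjn)|>.of_eq (d := 1) (by rw [vecWt, if_neg (by omega), inv_one])).commute.symm
    -- Here the root vector acts on the second index: it commutes with `x_i` and lowers `y_m` to
    -- `y_j`.
    have hLi : e * Lc ε x y i m = Lc ε x y i m * e - k m * (k' j * Lc ε x y i j) := by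
      simp only [Lc]
      simp only [mul_sub, sub_mul, mul_smul_comm, smul_mul_assoc, mul_assoc, h1, mul_mul_of h1,
        he.ey_i, mul_mul_of he.ey_i, mul_mul_of h2, mul_mul_of h3]
      module
    have hLm := Ly_j i hi m hmi
    have hout : Lc ε x y i m * y j = y j * Lc ε x y i m :=
      Ly_out i hi m hmi j hjn (by omega)
    have hkx := kx j hjn i hi
    have c1 : k m * Lc ε x y i m = q⁻¹ • (Lc ε x y i m * k m) :=
      (k_L (kx m hmn i hi) (ky m hmn m hmn)).of_eq
        (by rw [vecWt, vecWt, if_neg (by omega), if_pos rfl, one_mul])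
    have c2 : Commute (k' j) (Lc ε x y i m) :=
      ((k_L (kx j hjn i hi) (ky j hjn m hmn)).inv_left
        (mul_ne_zero (vecWt_ne q0 _ _) (inv_ne_zero (vecWt_ne q0 _ _))) (kk' j hjn)
        (k'k j hjn)|>.of_eq (d := 1)
        (by rw [vecWt, vecWt, if_neg (by omega), if_neg (by omega)]; simp)).commute
    have c3 : k m * y m = q⁻¹ • (y m * k m) :=
      (ky m hmn m hmn).of_eq (by rw [vecWt, if_pos rfl])
    have c4 : Commute (k' j) (y m) :=
      ((ky j hjn m hmn).inv_left (inv_ne_zero (vecWt_ne q0 _ _)) (kk' j hjn)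
        (k'k j hjn)|>.of_eq (d := 1) (by rw [vecWt, if_neg (by omega)]; simp)).commute
    refine mid_of_lower (e := e) (K := k m * k' j) (K' := k j * k' m) q0 ?_ ?_ ?_ ?_ ?_ hLm hout
    · rw [mul_assoc, mul_mul_of (k'k m hmn), one_mul, kk' j hjn]
    · rw [hLi, mul_assoc]
    · rw [he.ey_i, mul_assoc]
    · rw [mul_assoc, c2.eq, mul_mul_of c1, smul_mul_assoc, smul_smul, mul_inv_cancel₀ q0,
        one_smul, mul_assoc]
    · rw [mul_assoc, c4.eq, mul_mul_of c3, smul_mul_assoc, smul_smul, mul_inv_cancel₀ q0,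
        one_smul, mul_assoc]
  · intro i hi j hj m hm
    rcases hm.eq_or_lt with rfl | hm
    · exact T3 i hi _ hj
    · obtain ⟨e, he⟩ := he j (by omega) m hm
      exact serreT_raise_last q0 hp.h1 (he.ex_out i hi (by omega)) he.ex_j (T3 i hi m (by omega))
  · intro i hi j hj m hm
    rcases hj.eq_or_lt with rfl | hj
    · exact S1 _ hi _ hm
    · obtain ⟨e, he⟩ := he i hi j hj
      exact serreS_raise_fst q0 hp.h1 (he.ex_out m (by omega) (by omega)) he.ex_j
        (S1 j (by omega) m hm)

theorem Chev.half {E Y : ℕ → A} (h : Chev q b c ε n E Y k k') (hp : QParam q b c ε) :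
    Half q b c ε n (xs q E) (ys q Y) k k' :=
  half_of_rootVec hp h.kk' h.k'k h.comm (fun _ hi _ hj => h.k_xs hp hi hj)
    (fun _ hi _ hj => h.k_ys hp hi hj) (fun _ hi => h.L_self hp hi)
    (fun _ hi _ hj => h.exists_rootVec hp hj hi) h.lastE

end RootVectors

/-! ### Recovery of the Chevalley-Serre relations. -/

section

variable {F A : Type*} [Field F] [Ring A] [Algebra F A] {q b c ε : F} {n : ℕ}
  {x y k k' : ℕ → A}

/-- The raising Chevalley generators expressed by the `x_i`, `y_i`. -/
def ec (b ε : F) (x y k' : ℕ → A) : ℕ → A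
  | 0 => x 0
  | m + 1 => b⁻¹ • (k' m * Lc ε x y (m + 1) m)

/-- The lowering Chevalley generators expressed by the `x_i`, `y_i`. -/
def yc (b ε : F) (x y k : ℕ → A) : ℕ → A
  | 0 => y 0
  | m + 1 => b⁻¹ • (Lc ε x y m (m + 1) * k m)

open MulOpposite in
theorem op_yc (b ε : F) (x y k : ℕ → A) (m : ℕ) :
    ec b ε (fun i => op (y i)) (fun i => op (x i)) (fun i => op (k i)) m = op (yc b ε x y k m) := by
  cases m <;> simp [ec, yc, Lc]

/-- The factorization of the Serre operator read backwards: `v = [a, u]_{1/q}` is killed by the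
second factor. The variant below uses the two commuting factors in the other order. -/
theorem serre_of_qcomm {a u v : A} (q0 : q ≠ 0) (hu : a * u = q⁻¹ • (u * a) + v)
    (hv : a * v = q • (v * a)) : a * a * u - (q + q⁻¹) • (a * u * a) + u * a * a = 0 := by
  simp only [mul_assoc, hu, mul_add, mul_smul_comm, mul_mul_of hu, hv, add_mul, smul_mul_assoc]
  match_scalars <;> field_simp <;> ring

theorem serre_of_qcomm' {a u v : A} (q0 : q ≠ 0) (hu : a * u = q • (u * a) + v)
    (hv : a * v = q⁻¹ • (v * a)) : a * a * u - (q + q⁻¹) • (a * u * a) + u * a * a = 0 := by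
  simp only [mul_assoc, hu, mul_add, mul_smul_comm, mul_mul_of hu, hv, add_mul, smul_mul_assoc]
  match_scalars <;> field_simp <;> ring

namespace Half

theorem k'x (h : Half q b c ε n x y k k') (hp : QParam q b c ε) {i j : ℕ} (hi : i < n)
    (hj : j < n) : QComm (vecWt q i j)⁻¹ (k' i) (x j) :=
  (h.kx i hi j hj).inv_left (vecWt_ne hp.q0 _ _) (h.kk' i hi) (h.k'k i hi)

theorem k'y (h : Half q b c ε n x y k k') (hp : QParam q b c ε) {i j : ℕ} (hi : i < n)
    (hj : j < n) : QComm (vecWt q i j) (k' i) (y j) :=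
  ((h.ky i hi j hj).inv_left (inv_ne_zero (vecWt_ne hp.q0 _ _)) (h.kk' i hi) (h.k'k i hi)).of_eq
    (inv_inv _)

theorem k'x_ne (h : Half q b c ε n x y k k') (hp : QParam q b c ε) {i j : ℕ} (hi : i < n)
    (hj : j < n) (hij : i ≠ j) : Commute (k' i) (x j) :=
  ((h.k'x hp hi hj).of_eq (d := 1) (by rw [vecWt, if_neg hij, inv_one])).commute

theorem k'y_ne (h : Half q b c ε n x y k k') (hp : QParam q b c ε) {i j : ℕ} (hi : i < n)
    (hj : j < n) (hij : i ≠ j) : Commute (k' i) (y j) :=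
  ((h.k'y hp hi hj).of_eq (d := 1) (by rw [vecWt, if_neg hij])).commute

theorem kk'_comm (h : Half q b c ε n x y k k') {i j : ℕ} (hi : i < n) (hj : j < n) :
    Commute (k i) (k' j) :=
  (QComm.inv_left (F := F) (h.comm j hj i hi).qcomm one_ne_zero (h.kk' j hj) (h.k'k j hj)
    |>.of_eq inv_one).commute.symm

/-- The relations of `Half` for `L_{m+1,m}` are those of `b k_m e`; the factor `b⁻¹ k_m⁻¹` removes
the scalar and restores the twists of `e`. All relations among the Chevalley generators are read off
from this action. -/
theorem rootVec (h : Half q b c ε n x y k k') (hp : QParam q b c ε) {m : ℕ} (hm : m + 1 < n) :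
    IsRootVec q n x y k k' (m + 1) m (ec b ε x y k' (m + 1)) := by
  have q0 := hp.q0
  have b0 := hp.b0
  have hm' : m < n := by omega
  refine ⟨?_, ?_, ?_, ?_, ?_, ?_⟩
  · have h1 : k' m * x m = q⁻¹ • (x m * k' m) :=
      (h.k'x hp hm' hm').of_eq (by rw [vecWt, if_pos rfl])
    have h2 := (h.k'x_ne hp hm' hm (by omega)).eq
    simp only [ec, smul_mul_assoc, mul_assoc, h.Lx_j _ hm m (by omega), mul_add, mul_mul_of h1,
      mul_mul_of h2, mul_smul_comm, h.k'k m hm', mul_one]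
    match_scalars <;> field_simp
  · have h2 := (h.k'x_ne hp hm' hm (by omega)).eq
    simp only [ec, smul_mul_assoc, mul_assoc, h.Lx_i _ hm m (by omega), mul_mul_of h2,
      mul_smul_comm]
    module
  · intro i hi hio
    exact ((h.k'x_ne hp hm' hi (by omega)).mul_left
      (h.Lx_out _ hm m (by omega) i hi hio)).smul_left _
  · rintro i hi hio
    by_cases him : i = m
    · subst him
      have h1 : k' i * y i = q • (y i * k' i) :=
        (h.k'y hp hm' hm').of_eq (by rw [vecWt, if_pos rfl])
      unfold Commute SemiconjBy
      simp only [ec, smul_mul_assoc, mul_assoc, h.Ly_j _ hm i (by omega), mul_mul_of h1,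
        mul_smul_comm]
      match_scalars; field_simp
    · exact ((h.k'y_ne hp hm' hi (by omega)).mul_left
        (h.Ly_out _ hm m (by omega) i hi (by omega))).smul_left _
  · have h2 := (h.k'y_ne hp hm' hm (by omega)).eq
    have h3 : k (m + 1) * y m = y m * k (m + 1) :=
      ((h.ky _ hm m hm').of_eq (d := 1) (by rw [vecWt, if_neg (by omega), inv_one])).commute
    have h4 := (h.kk'_comm hm hm').eq
    simp only [ec, smul_mul_assoc, mul_assoc, h.Ly_i _ hm m (by omega), mul_sub, mul_mul_of h2,
      mul_smul_comm, ← h3, mul_mul_of h4]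
    match_scalars <;> field_simp
  · intro i hi
    refine ((((h.kk'_comm hi hm').qcomm (F := F)).mul_right
      (k_L (h.kx i hi _ hm) (h.ky i hi m hm'))).smul_right _).of_eq ?_
    unfold vecWt pairWt
    split_ifs <;> first | omega | simp

theorem raise_L {e : A} {i j : ℕ} (h1 : e * y j = y j * e) {u : ℕ}
    (hx : e * x i = q⁻¹ • (x i * e) + x u) :
    e * Lc ε x y i j = q⁻¹ • (Lc ε x y i j * e) + Lc ε x y u j := by
  have hx' : x u = e * x i - q⁻¹ • (x i * e) := by rw [hx]; module
  simp only [Lc]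
  rw [hx']
  simp only [mul_sub, sub_mul, mul_smul_comm, smul_mul_assoc, mul_assoc, h1, mul_mul_of h1]
  module

theorem mul_L {e : A} {i j : ℕ} {r : F} (h1 : e * y j = y j * e) (hx : e * x i = r • (x i * e)) :
    e * Lc ε x y i j = r • (Lc ε x y i j * e) := by
  simp only [Lc, mul_sub, sub_mul, mul_smul_comm, smul_mul_assoc, mul_assoc, h1, mul_mul_of h1, hx,
    mul_mul_of hx]
  module

theorem ec_far (h : Half q b c ε n x y k k') (hp : QParam q b c ε) {i j : ℕ} (hij : i + 2 ≤ j)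
    (hj : j < n) : Commute (ec b ε x y k' j) (ec b ε x y k' i) := by
  obtain ⟨j, rfl⟩ := Nat.exists_eq_add_of_le' (show 1 ≤ j by omega)
  have he := h.rootVec hp hj
  cases i with
  | zero => exact he.ex_out 0 (by omega) (by omega)
  | succ i =>
    have h1 := he.ex_out (i + 1) (by omega) (by omega)
    have h2 := he.ey_out i (by omega) (by omega)
    have h3 := ((he.ke i (by omega)).inv_left (pairWt_ne hp.q0 _ _ _) (h.kk' i (by omega))
      (h.k'k i (by omega)) |>.of_eq (d := 1)
        (by rw [pairWt, if_neg (by omega), if_neg (by omega), inv_one])).commute.symm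
    exact (h3.mul_right ((h1.mul_right h2).sub_right ((h2.mul_right h1).smul_right _))).smul_right _

theorem ec_serre (h : Half q b c ε n x y k k') (hp : QParam q b c ε) {i j : ℕ} (hi : i < n)
    (hj : j < n) (hij : i + 1 = j ∨ j + 1 = i) (hj1 : 1 ≤ j) :
    ec b ε x y k' j * ec b ε x y k' j * ec b ε x y k' i
      - (q + q⁻¹) • (ec b ε x y k' j * ec b ε x y k' i * ec b ε x y k' j)
      + ec b ε x y k' i * ec b ε x y k' j * ec b ε x y k' j = 0 := by
  have q0 := hp.q0
  rcases hij with rfl | rfl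
  · have he := h.rootVec hp hj
    cases i with
    | zero => exact serre_of_qcomm q0 he.ex_j he.ex_i
    | succ p =>
      have hpn : p < n := by omega
      have h2 : _ = _ := he.ey_out p hpn (by omega)
      have h3 := ((he.ke p hpn).inv_left (pairWt_ne hp.q0 _ _ _) (h.kk' p hpn)
        (h.k'k p hpn) |>.of_eq (d := 1)
          (by rw [pairWt, if_neg (by omega), if_neg (by omega), inv_one])).commute.symm.eq
      -- The upper neighbour raises the first index of `L_{p+1,p}`, which gives the root vector
      -- across both nodes.
      refine serre_of_qcomm (v := b⁻¹ • (k' p * Lc ε x y (p + 2) p)) q0 ?_ ?_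
      · conv_lhs => rw [ec.eq_2 _ _ _ _ _ p]
        conv_rhs => rw [ec.eq_2 _ _ _ _ _ p]
        rw [mul_smul_comm, mul_mul_of h3, mul_assoc, raise_L h2 he.ex_j]
        simp only [mul_add, mul_smul_comm, smul_mul_assoc, mul_assoc]
        module
      · rw [mul_smul_comm, mul_mul_of h3, mul_assoc, mul_L h2 he.ex_i]
        simp only [mul_smul_comm, smul_mul_assoc, mul_assoc]
        module
  · obtain ⟨p, rfl⟩ := Nat.exists_eq_add_of_le' hj1
    have he := h.rootVec hp hj
    have hpn : p < n := by omega
    have h1 : _ = _ := he.ex_out (p + 2) hi (by omega)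
    have h2 : _ = _ := he.ey_out p hpn (by omega)
    have h3 : k' (p + 1) * ec b ε x y k' (p + 1) = q⁻¹ • (ec b ε x y k' (p + 1) * k' (p + 1)) :=
      ((he.ke _ hj).inv_left (pairWt_ne hp.q0 _ _ _) (h.kk' _ hj) (h.k'k _ hj)).of_eq
        (by rw [pairWt, if_pos rfl])
    have h3' : ec b ε x y k' (p + 1) * k' (p + 1) = q • (k' (p + 1) * ec b ε x y k' (p + 1)) := by
      rw [h3, smul_smul, mul_inv_cancel₀ q0, one_smul]
    have h4 : k' p * ec b ε x y k' (p + 1) = q • (ec b ε x y k' (p + 1) * k' p) :=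
      ((he.ke _ hpn).inv_left (pairWt_ne hp.q0 _ _ _) (h.kk' _ hpn) (h.k'k _ hpn)).of_eq
        (by rw [pairWt, if_neg (by omega), if_pos rfl, inv_inv])
    have h4' : ec b ε x y k' (p + 1) * k' p = q⁻¹ • (k' p * ec b ε x y k' (p + 1)) := by
      rw [h4, smul_smul, inv_mul_cancel₀ q0, one_smul]
    have h5 : x (p + 2) * k (p + 1) = k (p + 1) * x (p + 2) :=
      ((h.kx _ hj _ hi).of_eq (d := 1) (by rw [vecWt, if_neg (by omega)])).commute.symm
    have h6 : x (p + 2) * k' p = k' p * x (p + 2) := (h.k'x_ne hp hpn hi (by omega)).symm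
    have hL : ec b ε x y k' (p + 1) * Lc ε x y (p + 2) (p + 1) =
        Lc ε x y (p + 2) (p + 1) * ec b ε x y k' (p + 1) -
          k (p + 1) * (k' p * Lc ε x y (p + 2) p) := by
      simp only [Lc, mul_sub, sub_mul, mul_smul_comm, smul_mul_assoc, mul_assoc, h1, mul_mul_of h1,
        he.ey_i, mul_mul_of he.ey_i, mul_mul_of h5, mul_mul_of h6]
      module
    -- The lower neighbour acts on the second index of `L_{p+2,p+1}`. The factor `q` arises in
    -- moving it past `k_{p+1}⁻¹`, which also cancels the `k_{p+1}` of the lowering rule.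
    refine serre_of_qcomm' (v := -(q * b⁻¹) • (k' p * Lc ε x y (p + 2) p)) q0 ?_ ?_
    · conv_lhs => rw [ec.eq_2 _ _ _ _ _ (p + 1)]
      conv_rhs => rw [ec.eq_2 _ _ _ _ _ (p + 1)]
      rw [mul_smul_comm, mul_mul_of h3', smul_mul_assoc, mul_assoc, hL, mul_sub,
        mul_mul_of (h.k'k _ hj), one_mul]
      simp only [smul_mul_assoc, mul_assoc]
      module
    · rw [mul_smul_comm, mul_mul_of h4', smul_mul_assoc, mul_assoc,
        mul_L (r := 1) h2 (by rw [one_smul, h1])]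
      simp only [mul_smul_comm, smul_mul_assoc, mul_assoc]
      module

theorem cbr_ec (h : Half q b c ε n x y k k') (hp : QParam q b c ε) {m : ℕ} (hm : m + 1 < n) :
    cbr q⁻¹ (ec b ε x y k' (m + 1)) (x m) = x (m + 1) := by
  rw [cbr, (h.rootVec hp hm).ex_j]; module

theorem ec_last (h : Half q b c ε n x y k k') (hp : QParam q b c ε) (hn : 1 < n) :
    cbr q (cbr ε (cbr q⁻¹ (ec b ε x y k' 1) (ec b ε x y k' 0)) (ec b ε x y k' 0))
      (ec b ε x y k' 0) = 0 := by
  rw [show ec b ε x y k' 0 = x 0 from rfl, h.cbr_ec hp hn]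
  exact last_of_serreT hp.h1 (h.serre_T 1 hn 0 (by omega) 0 le_rfl)

theorem k_ec (h : Half q b c ε n x y k k') (hp : QParam q b c ε) {i j : ℕ} (hi : i < n)
    (hj : j < n) : QComm (rootWt q i j) (k i) (ec b ε x y k' j) := by
  cases j with
  | zero => exact (h.kx i hi 0 hj).of_eq (by simp [vecWt, rootWt])
  | succ m =>
    refine ((h.rootVec hp hj).ke i hi).of_eq ?_
    unfold rootWt pairWt
    split_ifs <;> first | omega | rfl

theorem ec_yc_ne (h : Half q b c ε n x y k k') (hp : QParam q b c ε) {p r : ℕ} (hi : p + 1 < n)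
    (hj : r + 1 < n) (hij : p ≠ r) : Commute (ec b ε x y k' (p + 1)) (yc b ε x y k (r + 1)) := by
  have q0 := hp.q0
  have he := h.rootVec hp hi
  have h2 := he.ey_out (r + 1) hj (by omega)
  by_cases hrp : r = p + 1
  · subst hrp
    -- In this adjacent case the factor `q` from `x_{p+1}` is cancelled by the weight of the root
    -- vector under `k_{p+1}`.
    have h3 : k (p + 1) * ec b ε x y k' (p + 1) = q • (ec b ε x y k' (p + 1) * k (p + 1)) :=
      (he.ke _ hi).of_eq (by rw [pairWt, if_pos rfl])
    have h4 := mul_L (ε := ε) h2.eq he.ex_i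
    unfold Commute SemiconjBy
    simp only [yc, mul_smul_comm, smul_mul_assoc, mul_mul_of h4, mul_assoc, h3]
  · have h1 := he.ex_out r (by omega) (by omega)
    have h3 := ((he.ke r (by omega)).of_eq (d := 1)
      (by rw [pairWt, if_neg hrp, if_neg (Ne.symm hij)])).commute.symm
    exact (((h1.mul_right h2).sub_right ((h2.mul_right h1).smul_right _)).mul_right h3).smul_right _

theorem ec_yc_self (h : Half q b c ε n x y k k') (hp : QParam q b c ε) {m : ℕ} (hm : m + 1 < n) :
    b • (ec b ε x y k' (m + 1) * yc b ε x y k (m + 1)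
      - yc b ε x y k (m + 1) * ec b ε x y k' (m + 1)) =
      c • (k (m + 1) * k' m - k m * k' (m + 1)) := by
  have q0 := hp.q0
  have b0 := hp.b0
  have hm' : m < n := by omega
  have he := h.rootVec hp hm
  have h1 : k m * ec b ε x y k' (m + 1) = q⁻¹ • (ec b ε x y k' (m + 1) * k m) :=
    (he.ke _ hm').of_eq (by rw [pairWt, if_neg (by omega), if_pos rfl])
  have h1' : ec b ε x y k' (m + 1) * k m = q • (k m * ec b ε x y k' (m + 1)) := by
    rw [h1, smul_smul, mul_inv_cancel₀ q0, one_smul]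
  have h5 : x m * k (m + 1) = k (m + 1) * x m :=
    ((h.kx _ hm _ hm').of_eq (d := 1) (by rw [vecWt, if_neg (by omega)])).commute.symm
  have h6 : k' m * x m = q⁻¹ • (x m * k' m) :=
    (h.k'x hp hm' hm').of_eq (by rw [vecWt, if_pos rfl])
  have h6' : x m * k' m = q • (k' m * x m) := by
    rw [h6, smul_smul, mul_inv_cancel₀ q0, one_smul]
  -- The root vector acts on both indices: it raises `x_m`, which gives `L_{m+1,m+1}`, and lowers
  -- `y_{m+1}`, which gives `L_{mm}`. Multiplied by `k_m`, their known values combine to the Cartan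
  -- element.
  have hL : ec b ε x y k' (m + 1) * Lc ε x y m (m + 1) =
      q⁻¹ • (Lc ε x y m (m + 1) * ec b ε x y k' (m + 1)) + Lc ε x y (m + 1) (m + 1) -
        k (m + 1) * (k' m * Lc ε x y m m) := by
    simp only [Lc, mul_sub, sub_mul, mul_smul_comm, smul_mul_assoc, mul_assoc, he.ex_j,
      mul_mul_of he.ex_j, he.ey_i, mul_mul_of he.ey_i, mul_mul_of h5, mul_mul_of h6', add_mul,
      mul_add]
    match_scalars <;> field_simp
  have c1 := (h.kk'_comm hm' hm).eq
  simp only [yc, mul_smul_comm, smul_mul_assoc, mul_mul_of hL, add_mul, sub_mul, mul_assoc, h1',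
    h.L_self m hm', h.L_self (m + 1) hm, mul_sub, h.k'k m hm', mul_one,
    c1]
  match_scalars <;> field_simp <;> ring

-- The hypothesis `hs` on the opposite algebra supplies the relations among the lowering generators.
open MulOpposite in
theorem chev (h : Half q b c ε n x y k k') (hp : QParam q b c ε)
    (hs : Half q⁻¹ b (-c) ε n (fun i => op (y i)) (fun i => op (x i)) (fun i => op (k' i))
      (fun i => op (k i))) :
    Chev q b c ε n (ec b ε x y k') (yc b ε x y k) k k' where
  kk' := h.kk'
  k'k := h.k'k
  comm := h.comm
  kE _ hi _ hj := h.k_ec hp hi hj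
  kY i hi j hj := by
    -- This is the weight under `k_i⁻¹` in the opposite algebra. Inverting `k_i⁻¹` and passing to
    -- the opposite once more returns to the weight under `k_i`.
    have := hs.k_ec hp.star hi hj
    rw [op_yc, rootWt_inv] at this
    have := this.inv_left (inv_ne_zero (rootWt_ne hp.q0 _ _)) (hs.kk' i hi) (hs.k'k i hi)
    rw [inv_inv] at this
    have := this.op (rootWt_ne hp.q0 _ _)
    unfold QComm at this ⊢
    apply op_injective
    apply op_injective
    simpa using this
  EY_ne i hi j hj hij := by
    cases i with
    | zero =>
      cases j with
      | zero => exact absurd rfl hij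
      | succ r =>
        have := (hs.rootVec hp.star hj).ey_out 0 hi (by omega)
        rw [op_yc] at this
        exact this.unop.symm
    | succ p =>
      cases j with
      | zero => exact (h.rootVec hp hi).ey_out 0 hj (by omega)
      | succ r => exact h.ec_yc_ne hp hi hj (by omega)
  EY _ hi := h.ec_yc_self hp hi
  EY_zero h0 := h.L_self 0 h0
  farE _ _ hij hj := h.ec_far hp hij hj
  farY i j hij hj := by
    have := hs.ec_far hp.star hij hj
    rw [op_yc, op_yc] at this
    exact this.unop
  serreE _ hi _ hj hij hj1 := h.ec_serre hp hi hj hij hj1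
  serreY i hi j hj hij hj1 := by
    have := congrArg unop (hs.ec_serre hp.star hi hj hij hj1)
    simp only [op_yc, unop_sub, unop_add, unop_smul, unop_mul, unop_op, unop_zero, inv_inv,
      ← mul_assoc] at this
    rw [← this]; module
  lastE hn := h.ec_last hp hn
  lastY hn := by
    have := congrArg unop (hs.ec_last hp.star hn)
    have q0 := hp.q0
    simp only [op_yc, cbr, unop_sub, unop_smul, unop_mul, unop_op, unop_zero, inv_inv] at this ⊢
    linear_combination (norm := skip) (-q) • this
    simp only [mul_sub, sub_mul, mul_smul_comm, smul_mul_assoc, mul_assoc]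
    match_scalars <;> field_simp <;> ring

end Half
end

/-! ### The listed relators imply both halves. -/

section

variable {F A : Type*} [Field F] [Ring A] [Algebra F A] {q b c ε : F} {n : ℕ}

/-- The relators of the deformed parastatistics algebra, evaluated in an algebra. -/
def relatorIn (q b c ε : F) (n : ℕ) (τ : ℤˣ) (α K : ℤˣ → Fin n → A) : ParaIdx n → A
  | .k_inv s i => K s i * K (-s) i - 1
  | .k_comm i j _ => K 1 i * K 1 j - K 1 j * K 1 i
  | .k_a s i j => K 1 i * α s j * K (-1) i - q ^ (if i = j then (s : ℤ) else 0) • α s j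
  | .a_a i => cbr ε (α 1 i) (α (-1) i) - c • (K 1 i - K (-1) i)
  | .tri i j k =>
      cbr (q ^ (if i = k then -(sigma τ j k : ℤ) else 0)) (cbr ε (α 1 i) (α (-1) j)) (α 1 k)
        - ((if j = k then b • (α 1 i * K (sigma τ i j) j) else 0)
          + ((q - q⁻¹) * (theta i j k : F)) • (α 1 i * cbr ε (α 1 k) (α (-1) j)))
  | .triStar i j k =>
      cbr (q ^ (if j = k then -(sigma τ i k : ℤ) else 0)) (cbr ε (α 1 i) (α (-1) j)) (α (-1) k)
        - (-(if i = k then b • (α (-1) j * K (-(sigma τ j i)) i) else 0)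
          - ((q - q⁻¹) * (theta i j k : F)) • (cbr ε (α 1 i) (α (-1) k) * α (-1) j))
  | .serre s i₁ i₂ i₃ _ _ => serreT q ε (α s i₁) (α s i₂) (α s i₃)
  | .serreStar s i₁ i₂ i₃ _ _ => serreS q ε (α s i₁) (α s i₂) (α s i₃)

/-- Reindex a finite family by `ℕ`, counting from the last index. -/
def rext (f : Fin n → A) (m : ℕ) : A := if h : m < n then f (Fin.rev ⟨m, h⟩) else 0

theorem rext_of_lt (f : Fin n → A) {m : ℕ} (h : m < n) : rext f m = f (Fin.rev ⟨m, h⟩) :=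
  dif_pos h

theorem rext_rev (f : Fin n → A) (i : Fin n) : rext f (Fin.rev i) = f i := by
  rw [rext_of_lt f (Fin.rev i).2, Fin.eta, Fin.rev_rev]

theorem qcomm_of_conj {k k' a : A} {r : F} (h' : k' * k = 1) (h : k * a * k' = r • a) :
    QComm r k a := by
  unfold QComm
  rw [← smul_mul_assoc, ← h, mul_assoc _ k', h', mul_one]

theorem QComm.conj {k k' a : A} {r : F} (h : QComm r k a) (h' : k * k' = 1) :
    k * a * k' = r • a := by
  rw [h, smul_mul_assoc, mul_assoc, h', mul_one]

-- Reversal of products and inversion of `q` reproduce the triple form up to an invertible scalar.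
-- Hence the relations for annihilation operators are the mirror image of those for creation
-- operators.
open MulOpposite in
theorem serreT_op (q0 : q ≠ 0) (hε : ε * ε = 1) (u v w : A) :
    serreT q⁻¹ ε (op u) (op v) (op w) = (ε * q⁻¹ * q⁻¹) • op (serreT q ε u v w) := by
  rcases mul_self_eq_one_iff.1 hε with rfl | rfl
  all_goals simp only [serreT, cbr, op_sub, op_add, op_smul, op_mul, mul_sub, sub_mul, mul_smul_comm,
    smul_mul_assoc, mul_assoc]
  all_goals match_scalars <;> field_simp <;> ring

open MulOpposite in
theorem serreS_op (q0 : q ≠ 0) (hε : ε * ε = 1) (u v w : A) :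
    serreS q⁻¹ ε (op u) (op v) (op w) = (ε * q⁻¹ * q⁻¹) • op (serreS q ε u v w) := by
  rcases mul_self_eq_one_iff.1 hε with rfl | rfl
  all_goals simp only [serreS, cbr, op_sub, op_add, op_smul, op_mul, mul_sub, sub_mul, mul_smul_comm,
    smul_mul_assoc, mul_assoc]
  all_goals match_scalars <;> field_simp <;> ring

open MulOpposite in
theorem op_Lc (x y : ℕ → A) (i j : ℕ) :
    Lc ε (fun i => op (y i)) (fun i => op (x i)) i j = op (Lc ε x y j i) := by
  simp [Lc]

/-- Reversing the numbering turns `j < i` into the listed relations whose first index is the smaller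
one. The case `i = j = k`, the only place of `τ`, is not needed. -/
theorem half_of_relatorIn {τ : ℤˣ} {α K : ℤˣ → Fin n → A}
    (h : ∀ r, relatorIn q b c ε n τ α K r = 0) :
    Half q b c ε n (rext (α 1)) (rext (α (-1))) (rext (K 1)) (rext (K (-1))) := by
  have kk' : ∀ i < n, rext (K 1) i * rext (K (-1)) i = 1 := fun i hi => by
    simpa [relatorIn, sub_eq_zero, rext_of_lt _ hi] using h (.k_inv 1 (Fin.rev ⟨i, hi⟩))
  have k'k : ∀ i < n, rext (K (-1)) i * rext (K 1) i = 1 := fun i hi => by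
    simpa [relatorIn, sub_eq_zero, rext_of_lt _ hi] using h (.k_inv (-1) (Fin.rev ⟨i, hi⟩))
  have hlt : ∀ {i j : ℕ} (hj : j < i) (hi : i < n),
      Fin.rev (⟨i, hi⟩ : Fin n) < Fin.rev ⟨j, hj.trans hi⟩ := by
    intro i j hj hi; rw [Fin.rev_lt_rev]; exact hj
  have hL : ∀ {i j : ℕ} (hi : i < n) (hj : j < n), Lc ε (rext (α 1)) (rext (α (-1))) i j =
      cbr ε (α 1 (Fin.rev ⟨i, hi⟩)) (α (-1) (Fin.rev ⟨j, hj⟩)) := by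
    intro i j hi hj; rw [Lc, rext_of_lt _ hi, rext_of_lt _ hj]; rfl
  refine ⟨kk', k'k, ?_, ?_, ?_, ?_, ?_, ?_, ?_, ?_, ?_, ?_, ?_, ?_, ?_, ?_⟩
  · intro i hi j hj
    rw [rext_of_lt _ hi, rext_of_lt _ hj]
    rcases lt_trichotomy (Fin.rev (⟨i, hi⟩ : Fin n)) (Fin.rev ⟨j, hj⟩) with hij | hij | hij
    · exact sub_eq_zero.1 (h (.k_comm _ _ hij))
    · rw [hij]
    · exact (sub_eq_zero.1 (h (.k_comm _ _ hij))).symm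
  · intro i hi j hj
    refine qcomm_of_conj (k'k i hi) ?_
    have := sub_eq_zero.1 (h (.k_a 1 (Fin.rev ⟨i, hi⟩) (Fin.rev ⟨j, hj⟩)))
    rw [rext_of_lt _ hi, rext_of_lt _ hi, rext_of_lt _ hj, this, vecWt]
    by_cases hij : i = j <;> simp [hij]
  · intro i hi j hj
    refine qcomm_of_conj (k'k i hi) ?_
    have := sub_eq_zero.1 (h (.k_a (-1) (Fin.rev ⟨i, hi⟩) (Fin.rev ⟨j, hj⟩)))
    rw [rext_of_lt _ hi, rext_of_lt _ hi, rext_of_lt _ hj, this, vecWt]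
    by_cases hij : i = j <;> simp [hij]
  · intro i hi
    rw [hL hi hi, rext_of_lt _ hi, rext_of_lt _ hi]
    exact sub_eq_zero.1 (h (.a_a _))
  · intro i hi j hj
    have hj' := hj.trans hi
    have h1 := hlt hj hi
    have := h (.tri (Fin.rev ⟨i, hi⟩) (Fin.rev ⟨j, hj'⟩) (Fin.rev ⟨j, hj'⟩))
    simp only [relatorIn, sigma, theta, h1.ne, h1, h1.not_gt, lt_self_iff_false, if_true, if_false, and_false,
      and_self] at this
    rw [hL hi hj']
    simp only [rext_of_lt _ hi, rext_of_lt _ hj']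
    linear_combination (norm := skip) this
    simp [cbr]
  · intro i hi j hj
    have hj' := hj.trans hi
    have h1 := hlt hj hi
    have := h (.tri (Fin.rev ⟨i, hi⟩) (Fin.rev ⟨j, hj'⟩) (Fin.rev ⟨i, hi⟩))
    simp only [relatorIn, sigma, theta, h1.ne', h1, h1.not_gt, lt_self_iff_false, if_true, if_false, false_and, and_self] at this
    rw [hL hi hj']
    simp only [rext_of_lt _ hi]
    linear_combination (norm := skip) this
    simp [cbr]
  · intro i hi j hj m hm' hmo
    have hj' := hj.trans hi
    have h1 := hlt hj hi
    have := h (.tri (Fin.rev ⟨i, hi⟩) (Fin.rev ⟨j, hj'⟩) (Fin.rev ⟨m, hm'⟩))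
    have h23 : (Fin.rev ⟨j, hj'⟩ < Fin.rev ⟨m, hm'⟩ ∧ Fin.rev ⟨i, hi⟩ < Fin.rev ⟨m, hm'⟩) ∨ (Fin.rev ⟨m, hm'⟩ < Fin.rev ⟨i, hi⟩ ∧ Fin.rev ⟨m, hm'⟩ < Fin.rev ⟨j, hj'⟩) :=
      hmo.imp (fun hm => ⟨hlt hm hj', hlt (hm.trans hj) hi⟩)
        (fun hm => ⟨hlt hm hm', hlt (hj.trans hm) hm'⟩)
    unfold Commute SemiconjBy
    rw [hL hi hj']
    simp only [rext_of_lt _ hm']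
    rcases h23 with ⟨h2, h3⟩ | ⟨h2, h3⟩ <;>
    · simp only [relatorIn, sigma, theta, h1, h1.not_gt, h2.ne, h2.ne', h2, h2.not_gt, h3.ne, h3.ne', h3, h3.not_gt, if_true, if_false, and_false, false_and] at this
      linear_combination (norm := skip) this
      simp [cbr]
  · intro i hi j hj m hm hjm
    have hj' := hj.trans hi
    have h1 := hlt hj hi
    have hm' := hm.trans hi
    have h2 := hlt hm hi
    have h3 := hlt hjm hm'
    have := h (.tri (Fin.rev ⟨i, hi⟩) (Fin.rev ⟨j, hj'⟩) (Fin.rev ⟨m, hm'⟩))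
    simp only [relatorIn, sigma, theta, h1, h1.not_gt, h2.ne, h2, h2.not_gt, h3.ne', h3, h3.not_gt, if_true, if_false, and_self] at this
    rw [hL hi hj', hL hm' hj']
    simp only [rext_of_lt _ hi, rext_of_lt _ hm']
    linear_combination (norm := skip) this
    simp [cbr]
  · intro i hi j hj
    have hj' := hj.trans hi
    have h1 := hlt hj hi
    have := h (.triStar (Fin.rev ⟨i, hi⟩) (Fin.rev ⟨j, hj'⟩) (Fin.rev ⟨i, hi⟩))
    simp only [relatorIn, sigma, theta, h1.ne', h1, h1.not_gt, lt_self_iff_false, if_true, if_false, false_and, and_self] at this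
    rw [hL hi hj']
    simp only [rext_of_lt _ hi, rext_of_lt _ hj']
    linear_combination (norm := skip) this
    simp [cbr]
  · intro i hi j hj
    have hj' := hj.trans hi
    have h1 := hlt hj hi
    have := h (.triStar (Fin.rev ⟨i, hi⟩) (Fin.rev ⟨j, hj'⟩) (Fin.rev ⟨j, hj'⟩))
    simp only [relatorIn, sigma, theta, h1.ne, h1, h1.not_gt, lt_self_iff_false, if_true, if_false, and_false,
      and_self] at this
    rw [hL hi hj']
    simp only [rext_of_lt _ hj']
    linear_combination (norm := skip) this
    simp [cbr]
  · intro i hi j hj m hm' hmo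
    have hj' := hj.trans hi
    have h1 := hlt hj hi
    have := h (.triStar (Fin.rev ⟨i, hi⟩) (Fin.rev ⟨j, hj'⟩) (Fin.rev ⟨m, hm'⟩))
    have h23 : (Fin.rev ⟨j, hj'⟩ < Fin.rev ⟨m, hm'⟩ ∧ Fin.rev ⟨i, hi⟩ < Fin.rev ⟨m, hm'⟩) ∨ (Fin.rev ⟨m, hm'⟩ < Fin.rev ⟨i, hi⟩ ∧ Fin.rev ⟨m, hm'⟩ < Fin.rev ⟨j, hj'⟩) :=
      hmo.imp (fun hm => ⟨hlt hm hj', hlt (hm.trans hj) hi⟩)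
        (fun hm => ⟨hlt hm hm', hlt (hj.trans hm) hm'⟩)
    unfold Commute SemiconjBy
    rw [hL hi hj']
    simp only [rext_of_lt _ hm']
    rcases h23 with ⟨h2, h3⟩ | ⟨h2, h3⟩ <;>
    · simp only [relatorIn, sigma, theta, h1, h1.not_gt, h2.ne, h2.ne', h2, h2.not_gt, h3.ne, h3.ne', h3, h3.not_gt, if_true, if_false, and_false, false_and] at this
      linear_combination (norm := skip) this
      simp [cbr]
  · intro i hi j hj m hm hjm
    have hj' := hj.trans hi
    have h1 := hlt hj hi
    have hm' := hm.trans hi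
    have h2 := hlt hm hi
    have h3 := hlt hjm hm'
    have := h (.triStar (Fin.rev ⟨i, hi⟩) (Fin.rev ⟨j, hj'⟩) (Fin.rev ⟨m, hm'⟩))
    simp only [relatorIn, sigma, theta, h1, h1.not_gt, h2.ne, h2, h2.not_gt, h3.ne', h3, h3.not_gt, if_true, if_false, and_self] at this
    rw [hL hi hj', hL hi hm']
    simp only [rext_of_lt _ hj', rext_of_lt _ hm']
    linear_combination (norm := skip) this
    simp [cbr]
  · intro i hi j hj m hm
    rw [rext_of_lt _ hi, rext_of_lt _ (hj.trans hi), rext_of_lt _ (hm.trans_lt (hj.trans hi))]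
    exact h (.serre 1 _ _ _ (hlt hj hi) (by rw [Fin.rev_le_rev]; exact hm))
  · intro i hi j hj m hm
    rw [rext_of_lt _ hi, rext_of_lt _ (hj.trans_lt hi), rext_of_lt _ (hm.trans (hj.trans_lt hi))]
    exact h (.serreStar 1 _ _ _ (by rw [Fin.rev_le_rev]; exact hj) (hlt hm _))

-- The mirror image uses the listed relations whose first index is the larger one. The roles of (I)
-- and (I*) are exchanged, and the triple relations are taken for the annihilation operators.
open MulOpposite in
theorem half_op_of_relatorIn (hp : QParam q b c ε) {τ : ℤˣ} {α K : ℤˣ → Fin n → A}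
    (h : ∀ r, relatorIn q b c ε n τ α K r = 0) :
    Half q⁻¹ b (-c) ε n (fun i => op (rext (α (-1)) i)) (fun i => op (rext (α 1) i))
      (fun i => op (rext (K (-1)) i)) (fun i => op (rext (K 1) i)) := by
  have h0 := half_of_relatorIn h
  have q0 := hp.q0
  have hlt : ∀ {i j : ℕ} (hj : j < i) (hi : i < n),
      Fin.rev (⟨i, hi⟩ : Fin n) < Fin.rev ⟨j, hj.trans hi⟩ := by
    intro i j hj hi; rw [Fin.rev_lt_rev]; exact hj
  have hL : ∀ {i j : ℕ} (hi : i < n) (hj : j < n), Lc ε (rext (α 1)) (rext (α (-1))) i j =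
      cbr ε (α 1 (Fin.rev ⟨i, hi⟩)) (α (-1) (Fin.rev ⟨j, hj⟩)) := by
    intro i j hi hj; rw [Lc, rext_of_lt _ hi, rext_of_lt _ hj]; rfl
  refine ⟨?_, ?_, ?_, ?_, ?_, ?_, ?_, ?_, ?_, ?_, ?_, ?_, ?_, ?_, ?_, ?_⟩
  · intro i hi
    rw [← op_mul, h0.kk' i hi, op_one]
  · intro i hi
    rw [← op_mul, h0.k'k i hi, op_one]
  · intro i hi j hj
    exact (QComm.inv_left (F := F) (h0.kk'_comm hi hj).qcomm one_ne_zero (h0.kk' i hi)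
      (h0.k'k i hi) |>.of_eq inv_one).commute.op
  · intro i hi j hj
    exact ((h0.k'y hp hi hj).op (vecWt_ne q0 _ _)).of_eq (vecWt_inv q i j).symm
  · intro i hi j hj
    exact ((h0.k'x hp hi hj).op (inv_ne_zero (vecWt_ne q0 _ _))).of_eq (by rw [vecWt_inv])
  · intro i hi
    rw [op_Lc, h0.L_self i hi, ← op_sub, ← op_smul]
    congr 1; module
  · intro i hi j hj
    have hj' := hj.trans hi
    have h1 := hlt hj hi
    have c1 := (h0.k'y_ne hp hj' hi hj.ne).eq
    simp only [rext_of_lt _ hi, rext_of_lt _ hj'] at c1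
    have := h (.triStar (Fin.rev ⟨j, hj'⟩) (Fin.rev ⟨i, hi⟩) (Fin.rev ⟨j, hj'⟩))
    simp only [relatorIn, sigma, theta, h1.ne, h1, h1.not_gt, lt_self_iff_false, if_true, if_false, and_false, and_self] at this
    apply unop_injective
    simp only [op_Lc, unop_mul, unop_add, unop_smul, unop_op]
    rw [hL hj' hi]
    simp only [rext_of_lt _ hi, rext_of_lt _ hj', c1]
    linear_combination (norm := skip) (-1 : F) • this
    simp [cbr]
    (match_scalars <;> field_simp <;> ring)
  · intro i hi j hj
    have hj' := hj.trans hi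
    have h1 := hlt hj hi
    have := h (.triStar (Fin.rev ⟨j, hj'⟩) (Fin.rev ⟨i, hi⟩) (Fin.rev ⟨i, hi⟩))
    simp only [relatorIn, sigma, theta, h1.ne', h1, h1.not_gt, lt_self_iff_false, if_true, if_false, false_and, and_self] at this
    apply unop_injective
    simp only [op_Lc, unop_mul, unop_smul, unop_op]
    rw [hL hj' hi]
    simp only [rext_of_lt _ hi]
    -- The listed relation reads `L y = q y L`, the required one `y L = q⁻¹ L y`.
    linear_combination (norm := skip) (-q⁻¹) • this
    simp [cbr]
    (match_scalars <;> field_simp <;> ring)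
  · intro i hi j hj m hm' hmo
    have hj' := hj.trans hi
    have h1 := hlt hj hi
    have := h (.triStar (Fin.rev ⟨j, hj'⟩) (Fin.rev ⟨i, hi⟩) (Fin.rev ⟨m, hm'⟩))
    have h23 : (Fin.rev ⟨j, hj'⟩ < Fin.rev ⟨m, hm'⟩ ∧ Fin.rev ⟨i, hi⟩ < Fin.rev ⟨m, hm'⟩) ∨ (Fin.rev ⟨m, hm'⟩ < Fin.rev ⟨i, hi⟩ ∧ Fin.rev ⟨m, hm'⟩ < Fin.rev ⟨j, hj'⟩) :=
      hmo.imp (fun hm => ⟨hlt hm hj', hlt (hm.trans hj) hi⟩)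
        (fun hm => ⟨hlt hm hm', hlt (hj.trans hm) hm'⟩)
    unfold Commute SemiconjBy
    apply unop_injective
    simp only [op_Lc, unop_mul, unop_op]
    rw [hL hj' hi]
    simp only [rext_of_lt _ hm']
    rcases h23 with ⟨h2, h3⟩ | ⟨h2, h3⟩ <;>
    · simp only [relatorIn, sigma, theta, h1, h1.not_gt, h2.ne, h2.ne', h2, h2.not_gt, h3.ne, h3.ne', h3, h3.not_gt, if_true, if_false, and_false, false_and] at this
      linear_combination (norm := skip) (-1 : F) • this
      simp [cbr]
  · intro i hi j hj m hm hjm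
    have hj' := hj.trans hi
    have h1 := hlt hj hi
    have hm' := hm.trans hi
    have h2 := hlt hm hi
    have h3 := hlt hjm hm'
    have := h (.triStar (Fin.rev ⟨j, hj'⟩) (Fin.rev ⟨i, hi⟩) (Fin.rev ⟨m, hm'⟩))
    simp only [relatorIn, sigma, theta, h1, h1.not_gt, h2.ne, h2, h2.not_gt, h3.ne', h3, h3.not_gt, if_true, if_false, and_self] at this
    apply unop_injective
    simp only [op_Lc, unop_mul, unop_add, unop_smul, unop_op, inv_inv]
    rw [hL hj' hi, hL hj' hm']
    simp only [rext_of_lt _ hi, rext_of_lt _ hm']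
    linear_combination (norm := skip) (-1 : F) • this
    simp [cbr]
    module
  · intro i hi j hj
    have hj' := hj.trans hi
    have h1 := hlt hj hi
    have c1 := (h0.k'x_ne hp hi hj' hj.ne').eq
    simp only [rext_of_lt _ hi, rext_of_lt _ hj'] at c1
    have := h (.tri (Fin.rev ⟨j, hj'⟩) (Fin.rev ⟨i, hi⟩) (Fin.rev ⟨i, hi⟩))
    simp only [relatorIn, sigma, theta, h1.ne', h1, h1.not_gt, lt_self_iff_false, if_true, if_false, false_and, and_self] at this
    apply unop_injective
    simp only [op_Lc, unop_mul, unop_sub, unop_smul, unop_op]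
    rw [hL hj' hi]
    simp only [rext_of_lt _ hi, rext_of_lt _ hj', c1]
    linear_combination (norm := skip) (-1 : F) • this
    simp [cbr]
  · intro i hi j hj
    have hj' := hj.trans hi
    have h1 := hlt hj hi
    have := h (.tri (Fin.rev ⟨j, hj'⟩) (Fin.rev ⟨i, hi⟩) (Fin.rev ⟨j, hj'⟩))
    simp only [relatorIn, sigma, theta, h1.ne, h1, h1.not_gt, lt_self_iff_false, if_true, if_false, and_false, and_self] at this
    apply unop_injective
    simp only [op_Lc, unop_mul, unop_smul, unop_op]
    rw [hL hj' hi]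
    simp only [rext_of_lt _ hj']
    linear_combination (norm := skip) (-q) • this
    simp [cbr]
    (match_scalars <;> field_simp <;> ring)
  · intro i hi j hj m hm' hmo
    have hj' := hj.trans hi
    have h1 := hlt hj hi
    have := h (.tri (Fin.rev ⟨j, hj'⟩) (Fin.rev ⟨i, hi⟩) (Fin.rev ⟨m, hm'⟩))
    have h23 : (Fin.rev ⟨j, hj'⟩ < Fin.rev ⟨m, hm'⟩ ∧ Fin.rev ⟨i, hi⟩ < Fin.rev ⟨m, hm'⟩) ∨ (Fin.rev ⟨m, hm'⟩ < Fin.rev ⟨i, hi⟩ ∧ Fin.rev ⟨m, hm'⟩ < Fin.rev ⟨j, hj'⟩) :=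
      hmo.imp (fun hm => ⟨hlt hm hj', hlt (hm.trans hj) hi⟩)
        (fun hm => ⟨hlt hm hm', hlt (hj.trans hm) hm'⟩)
    unfold Commute SemiconjBy
    apply unop_injective
    simp only [op_Lc, unop_mul, unop_op]
    rw [hL hj' hi]
    simp only [rext_of_lt _ hm']
    rcases h23 with ⟨h2, h3⟩ | ⟨h2, h3⟩ <;>
    · simp only [relatorIn, sigma, theta, h1, h1.not_gt, h2.ne, h2.ne', h2, h2.not_gt, h3.ne, h3.ne', h3, h3.not_gt, if_true, if_false, and_false, false_and] at this
      linear_combination (norm := skip) (-1 : F) • this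
      simp [cbr]
  · intro i hi j hj m hm hjm
    have hj' := hj.trans hi
    have h1 := hlt hj hi
    have hm' := hm.trans hi
    have h2 := hlt hm hi
    have h3 := hlt hjm hm'
    have := h (.tri (Fin.rev ⟨j, hj'⟩) (Fin.rev ⟨i, hi⟩) (Fin.rev ⟨m, hm'⟩))
    simp only [relatorIn, sigma, theta, h1, h1.not_gt, h2.ne, h2, h2.not_gt, h3.ne', h3, h3.not_gt, if_true, if_false, and_self] at this
    apply unop_injective
    simp only [op_Lc, unop_mul, unop_sub, unop_smul, unop_op, inv_inv]
    rw [hL hj' hi, hL hm' hi]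
    simp only [rext_of_lt _ hj', rext_of_lt _ hm']
    linear_combination (norm := skip) (-1 : F) • this
    simp [cbr]
  · intro i hi j hj m hm
    rw [serreT_op q0 hp.hε, rext_of_lt _ hi, rext_of_lt _ (hj.trans hi),
      rext_of_lt _ (hm.trans_lt (hj.trans hi))]
    have := h (.serre (-1) _ _ (Fin.rev ⟨m, hm.trans_lt (hj.trans hi)⟩) (hlt hj hi)
      (by rw [Fin.rev_le_rev]; exact hm))
    rw [relatorIn] at this
    rw [this, op_zero, smul_zero]
  · intro i hi j hj m hm
    rw [serreS_op q0 hp.hε, rext_of_lt _ hi, rext_of_lt _ (hj.trans_lt hi),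
      rext_of_lt _ (hm.trans (hj.trans_lt hi))]
    have := h (.serreStar (-1) (Fin.rev ⟨i, hi⟩) _ _ (by rw [Fin.rev_le_rev]; exact hj)
      (hlt hm (hj.trans_lt hi)))
    rw [relatorIn] at this
    rw [this, op_zero, smul_zero]

end

/-! ### Both halves imply the listed relators. -/

section

variable {F A : Type*} [Field F] [Ring A] [Algebra F A] {q b c ε : F} {n : ℕ}

-- For `i < j` the relation belongs to `h`, for `i > j` to the mirror image `hs`; for `i = j` it
-- reduces to the weight of `a_m^+` under `q^{±h_i}`.
open MulOpposite in
theorem relatorIn_tri_of_half (hp : QParam q b c ε) {τ : ℤˣ} {α K : ℤˣ → Fin n → A}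
    (h : Half q b c ε n (rext (α 1)) (rext (α (-1))) (rext (K 1)) (rext (K (-1))))
    (hs : Half q⁻¹ b (-c) ε n (fun i => op (rext (α (-1)) i)) (fun i => op (rext (α 1) i))
      (fun i => op (rext (K (-1)) i)) (fun i => op (rext (K 1) i))) (i j m : Fin n) :
    relatorIn q b c ε n τ α K (.tri i j m) = 0 := by
  have q0 := hp.q0
  have hrev : ∀ {i j : Fin n}, i < j → (Fin.rev j : ℕ) < Fin.rev i := by
    intro i j hij
    exact Fin.rev_lt_rev.2 hij
  have hL : ∀ i j : Fin n, Lc ε (rext (α 1)) (rext (α (-1))) (Fin.rev i) (Fin.rev j) =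
      cbr ε (α 1 i) (α (-1) j) := by
    intro i j; rw [Lc, rext_rev, rext_rev]; rfl
  rcases lt_trichotomy i j with h1 | rfl | h1
  · rcases eq_or_ne m j with rfl | hmj
    · have e := h.Lx_j i.rev i.rev.2 m.rev (hrev h1)
      simp only [hL, rext_rev] at e
      simp only [relatorIn, sigma, theta, h1.ne, h1, h1.not_gt, if_true, if_false, and_false, and_self, lt_self_iff_false]
      linear_combination (norm := skip) (1 : F) • e
      simp [cbr]
    rcases eq_or_ne m i with rfl | hmi
    · have e := h.Lx_i m.rev m.rev.2 j.rev (hrev h1)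
      simp only [hL, rext_rev] at e
      simp only [relatorIn, sigma, theta, h1.ne', h1, h1.not_gt, if_true, if_false, false_and, and_self, lt_self_iff_false]
      linear_combination (norm := skip) (1 : F) • e
      simp [cbr]
    rcases lt_or_gt_of_ne hmi with h2 | h2
    · have h3 := h2.trans h1
      have e := (h.Lx_out i.rev i.rev.2 j.rev (hrev h1) m.rev m.rev.2 (.inr (hrev h2))).eq
      simp only [hL, rext_rev] at e
      simp only [relatorIn, sigma, theta, h1, h1.not_gt, h2.ne', h2, h2.not_gt, h3.ne', h3, h3.not_gt, if_true, if_false, false_and]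
      linear_combination (norm := skip) (1 : F) • e
      simp [cbr]
    rcases lt_or_gt_of_ne hmj with h3 | h3
    · have e := h.Lx_mid i.rev i.rev.2 j.rev (hrev h1) m.rev (hrev h2) (hrev h3)
      simp only [hL, rext_rev] at e
      simp only [relatorIn, sigma, theta, h1, h1.not_gt, h2.ne, h2, h2.not_gt, h3.ne', h3, h3.not_gt, if_true, if_false, and_self]
      linear_combination (norm := skip) (1 : F) • e
      simp [cbr]
    · have e := (h.Lx_out i.rev i.rev.2 j.rev (hrev h1) m.rev m.rev.2 (.inl (hrev h3))).eq
      simp only [hL, rext_rev] at e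
      simp only [relatorIn, sigma, theta, h1, h1.not_gt, h2.ne, h2, h2.not_gt, h3.ne, h3, h3.not_gt, if_true, if_false, and_false]
      linear_combination (norm := skip) (1 : F) • e
      simp [cbr]
  · have e0 := h.L_self i.rev i.rev.2
    have e1 : _ = _ := h.kx i.rev i.rev.2 m.rev m.rev.2
    have e2 : _ = _ := h.k'x hp i.rev.2 m.rev.2
    simp only [hL, rext_rev] at e0 e1 e2
    have ht : theta i i m = 0 := by
      rw [theta, if_neg (by omega), if_neg (by omega)]
    simp only [relatorIn, ht, e0, Int.cast_zero, mul_zero, zero_smul]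
    have hb := hp.hc
    rcases eq_or_ne i m with rfl | him
    · simp only [vecWt, if_true] at e1 e2
      -- The bracket is `c (k_i - k_i⁻¹)`. Depending on `τ`, the deformed commutator with `a_i^+`
      -- cancels the term with `k_i⁻¹` or the one with `k_i`; the surviving coefficient is `c (q -
      -- q⁻¹) = b` in both cases.
      rcases Int.units_eq_one_or τ with rfl | rfl
      all_goals
        simp [sigma, cbr, e1, e2, ← hb, sub_mul, mul_sub]
        match_scalars <;> field_simp <;> ring
    · have him' : (i.rev : ℕ) ≠ m.rev := fun h' => him (Fin.rev_injective (Fin.ext h'))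
      simp only [vecWt, if_neg him', inv_one, one_smul] at e1 e2
      simp [him, cbr, e1, e2, sub_mul, mul_sub]
  · rcases eq_or_ne m j with rfl | hmj
    · have e := congrArg unop (hs.Ly_i m.rev m.rev.2 i.rev (hrev h1))
      simp only [op_Lc, unop_mul, unop_sub, unop_smul, unop_op, hL, rext_rev] at e
      have c1 := (h.k'x_ne hp m.rev.2 i.rev.2 (hrev h1).ne').eq
      simp only [rext_rev] at c1
      rw [c1] at e
      simp only [relatorIn, sigma, theta, h1.ne', h1, h1.not_gt, if_true, if_false, false_and, and_self, lt_self_iff_false]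
      linear_combination (norm := skip) (-1 : F) • e
      simp [cbr]
    rcases eq_or_ne m i with rfl | hmi
    · have e := congrArg unop (hs.Ly_j j.rev j.rev.2 m.rev (hrev h1))
      simp only [op_Lc, unop_mul, unop_smul, unop_op, inv_inv, hL, rext_rev] at e
      simp only [relatorIn, sigma, theta, h1.ne, h1, h1.not_gt, if_true, if_false, and_false, and_self, lt_self_iff_false]
      linear_combination (norm := skip) (-q⁻¹) • e
      simp [cbr]
      first | done | module | (match_scalars <;> field_simp <;> ring)
    rcases lt_or_gt_of_ne hmj with h2 | h2
    · have h3 := h2.trans h1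
      have e := congrArg unop ((hs.Ly_out j.rev j.rev.2 i.rev (hrev h1) m.rev m.rev.2 (.inr (hrev h2))).eq)
      simp only [op_Lc, unop_mul, unop_op, hL, rext_rev] at e
      simp only [relatorIn, sigma, theta, h1, h1.not_gt, h2.ne', h2, h2.not_gt, h3.ne', h3, h3.not_gt, if_true, if_false, false_and]
      linear_combination (norm := skip) (-1 : F) • e
      simp [cbr]
      module
    rcases lt_or_gt_of_ne hmi with h3 | h3
    · have e := congrArg unop (hs.Ly_mid j.rev j.rev.2 i.rev (hrev h1) m.rev (hrev h2) (hrev h3))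
      simp only [op_Lc, unop_mul, unop_sub, unop_smul, unop_op, inv_inv, hL, rext_rev] at e
      simp only [relatorIn, sigma, theta, h1, h1.not_gt, h2.ne, h2, h2.not_gt, h3.ne', h3, h3.not_gt, if_true, if_false, and_self]
      linear_combination (norm := skip) (-1 : F) • e
      simp [cbr]
    · have e := congrArg unop ((hs.Ly_out j.rev j.rev.2 i.rev (hrev h1) m.rev m.rev.2 (.inl (hrev h3))).eq)
      simp only [op_Lc, unop_mul, unop_op, hL, rext_rev] at e
      simp only [relatorIn, sigma, theta, h1, h1.not_gt, h2.ne, h2, h2.not_gt, h3.ne, h3, h3.not_gt, if_true, if_false, and_false]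
      linear_combination (norm := skip) (-1 : F) • e
      simp [cbr]
      module

open MulOpposite in
theorem relatorIn_triStar_of_half (hp : QParam q b c ε) {τ : ℤˣ} {α K : ℤˣ → Fin n → A}
    (h : Half q b c ε n (rext (α 1)) (rext (α (-1))) (rext (K 1)) (rext (K (-1))))
    (hs : Half q⁻¹ b (-c) ε n (fun i => op (rext (α (-1)) i)) (fun i => op (rext (α 1) i))
      (fun i => op (rext (K (-1)) i)) (fun i => op (rext (K 1) i))) (i j m : Fin n) :
    relatorIn q b c ε n τ α K (.triStar i j m) = 0 := by
  have q0 := hp.q0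
  have hrev : ∀ {i j : Fin n}, i < j → (Fin.rev j : ℕ) < Fin.rev i := by
    intro i j hij
    exact Fin.rev_lt_rev.2 hij
  have hL : ∀ i j : Fin n, Lc ε (rext (α 1)) (rext (α (-1))) (Fin.rev i) (Fin.rev j) =
      cbr ε (α 1 i) (α (-1) j) := by
    intro i j; rw [Lc, rext_rev, rext_rev]; rfl
  rcases lt_trichotomy i j with h1 | rfl | h1
  · rcases eq_or_ne m j with rfl | hmj
    · have e := h.Ly_j i.rev i.rev.2 m.rev (hrev h1)
      simp only [hL, rext_rev] at e
      simp only [relatorIn, sigma, theta, h1.ne, h1, h1.not_gt, if_true, if_false, and_false, and_self, lt_self_iff_false]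
      linear_combination (norm := skip) (1 : F) • e
      simp [cbr]
    rcases eq_or_ne m i with rfl | hmi
    · have e := h.Ly_i m.rev m.rev.2 j.rev (hrev h1)
      simp only [hL, rext_rev] at e
      simp only [relatorIn, sigma, theta, h1.ne', h1, h1.not_gt, if_true, if_false, false_and, and_self, lt_self_iff_false]
      linear_combination (norm := skip) (1 : F) • e
      simp [cbr]
    rcases lt_or_gt_of_ne hmi with h2 | h2
    · have h3 := h2.trans h1
      have e := (h.Ly_out i.rev i.rev.2 j.rev (hrev h1) m.rev m.rev.2 (.inr (hrev h2))).eq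
      simp only [hL, rext_rev] at e
      simp only [relatorIn, sigma, theta, h1, h1.not_gt, h2.ne', h2, h2.not_gt, h3.ne', h3, h3.not_gt, if_true, if_false, false_and]
      linear_combination (norm := skip) (1 : F) • e
      simp [cbr]
    rcases lt_or_gt_of_ne hmj with h3 | h3
    · have e := h.Ly_mid i.rev i.rev.2 j.rev (hrev h1) m.rev (hrev h2) (hrev h3)
      simp only [hL, rext_rev] at e
      simp only [relatorIn, sigma, theta, h1, h1.not_gt, h2.ne, h2, h2.not_gt, h3.ne', h3, h3.not_gt, if_true, if_false, and_self]
      linear_combination (norm := skip) (1 : F) • e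
      simp [cbr]
    · have e := (h.Ly_out i.rev i.rev.2 j.rev (hrev h1) m.rev m.rev.2 (.inl (hrev h3))).eq
      simp only [hL, rext_rev] at e
      simp only [relatorIn, sigma, theta, h1, h1.not_gt, h2.ne, h2, h2.not_gt, h3.ne, h3, h3.not_gt, if_true, if_false, and_false]
      linear_combination (norm := skip) (1 : F) • e
      simp [cbr]
  · have e0 := h.L_self i.rev i.rev.2
    have e1 : _ = _ := h.ky i.rev i.rev.2 m.rev m.rev.2
    have e2 : _ = _ := h.k'y hp i.rev.2 m.rev.2
    simp only [hL, rext_rev] at e0 e1 e2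
    have ht : theta i i m = 0 := by
      rw [theta, if_neg (by omega), if_neg (by omega)]
    simp only [relatorIn, ht, e0, Int.cast_zero, mul_zero, zero_smul]
    have hb := hp.hc
    rcases eq_or_ne i m with rfl | him
    · simp only [vecWt, if_true] at e1 e2
      rcases Int.units_eq_one_or τ with rfl | rfl
      all_goals
        simp [sigma, cbr, e1, e2, ← hb, sub_mul, mul_sub]
        match_scalars <;> field_simp <;> ring
    · have him' : (i.rev : ℕ) ≠ m.rev := fun h' => him (Fin.rev_injective (Fin.ext h'))
      simp only [vecWt, if_neg him', inv_one, one_smul] at e1 e2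
      simp [him, cbr, e1, e2, sub_mul, mul_sub]
  · rcases eq_or_ne m j with rfl | hmj
    · have e := congrArg unop (hs.Lx_i m.rev m.rev.2 i.rev (hrev h1))
      simp only [op_Lc, unop_mul, unop_smul, unop_op, hL, rext_rev] at e
      simp only [relatorIn, sigma, theta, h1.ne', h1, h1.not_gt, if_true, if_false, false_and, and_self, lt_self_iff_false]
      linear_combination (norm := skip) (-q) • e
      simp [cbr]
      first | done | module | (match_scalars <;> field_simp <;> ring)
    rcases eq_or_ne m i with rfl | hmi
    · have e := congrArg unop (hs.Lx_j j.rev j.rev.2 m.rev (hrev h1))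
      simp only [op_Lc, unop_mul, unop_add, unop_smul, unop_op, hL, rext_rev] at e
      have c1 := (h.k'y_ne hp m.rev.2 j.rev.2 (hrev h1).ne).eq
      simp only [rext_rev] at c1
      rw [c1] at e
      simp only [relatorIn, sigma, theta, h1.ne, h1, h1.not_gt, if_true, if_false, and_false, and_self, lt_self_iff_false]
      linear_combination (norm := skip) (-1 : F) • e
      simp [cbr]
      module
    rcases lt_or_gt_of_ne hmj with h2 | h2
    · have h3 := h2.trans h1
      have e := congrArg unop ((hs.Lx_out j.rev j.rev.2 i.rev (hrev h1) m.rev m.rev.2 (.inr (hrev h2))).eq)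
      simp only [op_Lc, unop_mul, unop_op, hL, rext_rev] at e
      simp only [relatorIn, sigma, theta, h1, h1.not_gt, h2.ne', h2, h2.not_gt, h3.ne', h3, h3.not_gt, if_true, if_false, false_and]
      linear_combination (norm := skip) (-1 : F) • e
      simp [cbr]
      module
    rcases lt_or_gt_of_ne hmi with h3 | h3
    · have e := congrArg unop (hs.Lx_mid j.rev j.rev.2 i.rev (hrev h1) m.rev (hrev h2) (hrev h3))
      simp only [op_Lc, unop_mul, unop_add, unop_smul, unop_op, inv_inv, hL, rext_rev] at e
      simp only [relatorIn, sigma, theta, h1, h1.not_gt, h2.ne, h2, h2.not_gt, h3.ne', h3, h3.not_gt, if_true, if_false, and_self]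
      linear_combination (norm := skip) (-1 : F) • e
      simp [cbr]
      module
    · have e := congrArg unop ((hs.Lx_out j.rev j.rev.2 i.rev (hrev h1) m.rev m.rev.2 (.inl (hrev h3))).eq)
      simp only [op_Lc, unop_mul, unop_op, hL, rext_rev] at e
      simp only [relatorIn, sigma, theta, h1, h1.not_gt, h2.ne, h2, h2.not_gt, h3.ne, h3, h3.not_gt, if_true, if_false, and_false]
      linear_combination (norm := skip) (-1 : F) • e
      simp [cbr]
      module

open MulOpposite in
theorem relatorIn_of_half (hp : QParam q b c ε) {τ : ℤˣ} {α K : ℤˣ → Fin n → A}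
    (h : Half q b c ε n (rext (α 1)) (rext (α (-1))) (rext (K 1)) (rext (K (-1))))
    (hs : Half q⁻¹ b (-c) ε n (fun i => op (rext (α (-1)) i)) (fun i => op (rext (α 1) i))
      (fun i => op (rext (K (-1)) i)) (fun i => op (rext (K 1) i))) (r : ParaIdx n) :
    relatorIn q b c ε n τ α K r = 0 := by
  have hrev : ∀ {i j : Fin n}, i < j → (Fin.rev j : ℕ) < Fin.rev i := by
    intro i j hij
    exact Fin.rev_lt_rev.2 hij
  have q0 := hp.q0
  have hs0 : ε * q⁻¹ * q⁻¹ ≠ 0 :=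
    mul_ne_zero (mul_ne_zero (left_ne_zero_of_mul_eq_one hp.hε) (inv_ne_zero q0)) (inv_ne_zero q0)
  cases r with
  | k_inv s i =>
    rcases Int.units_eq_one_or s with rfl | rfl
    · simpa only [rext_rev, relatorIn, sub_eq_zero] using h.kk' i.rev i.rev.2
    · simpa only [rext_rev, relatorIn, sub_eq_zero, neg_neg] using h.k'k i.rev i.rev.2
  | k_comm i j hij =>
    simpa only [rext_rev, relatorIn, sub_eq_zero] using (h.comm i.rev i.rev.2 j.rev j.rev.2).eq
  | k_a s i j =>
    rw [relatorIn, sub_eq_zero]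
    have hk := h.kk' i.rev i.rev.2
    rcases Int.units_eq_one_or s with rfl | rfl
    · have := (h.kx i.rev i.rev.2 j.rev j.rev.2).conj hk
      simp only [rext_rev] at this
      rw [this, vecWt]
      by_cases hij : i = j
      · simp [hij]
      · simp only [← Fin.ext_iff, Fin.rev_inj, hij, if_false, zpow_zero]
    · have := (h.ky i.rev i.rev.2 j.rev j.rev.2).conj hk
      simp only [rext_rev] at this
      rw [this, vecWt]
      by_cases hij : i = j
      · simp [hij]
      · simp only [← Fin.ext_iff, Fin.rev_inj, hij, if_false, zpow_zero, inv_one]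
  | a_a i =>
    have := h.L_self i.rev i.rev.2
    simp only [Lc, rext_rev] at this
    rw [relatorIn, cbr, this, sub_self]
  | tri i j m => exact relatorIn_tri_of_half hp h hs i j m
  | triStar i j m => exact relatorIn_triStar_of_half hp h hs i j m
  | serre s i j m hij hjm =>
    have hjm' : (Fin.rev m : ℕ) ≤ Fin.rev j := Fin.rev_le_rev.2 hjm
    rcases Int.units_eq_one_or s with rfl | rfl
    · simpa only [rext_rev, relatorIn] using h.serre_T i.rev i.rev.2 j.rev (hrev hij) m.rev hjm'
    · have := hs.serre_T i.rev i.rev.2 j.rev (hrev hij) m.rev hjm'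
      rw [serreT_op q0 hp.hε, smul_eq_zero_iff_right hs0, op_eq_zero_iff] at this
      simpa only [rext_rev, relatorIn] using this
  | serreStar s i j m hij hjm =>
    have hij' : (Fin.rev j : ℕ) ≤ Fin.rev i := Fin.rev_le_rev.2 hij
    rcases Int.units_eq_one_or s with rfl | rfl
    · simpa only [rext_rev, relatorIn] using h.serre_S i.rev i.rev.2 j.rev hij' m.rev (hrev hjm)
    · have := hs.serre_S i.rev i.rev.2 j.rev hij' m.rev (hrev hjm)
      rw [serreS_op q0 hp.hε, smul_eq_zero_iff_right hs0, op_eq_zero_iff] at this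
      simpa only [rext_rev, relatorIn] using this

end

/-! ### Other forms of the Serre relations, scalars and brackets. -/

theorem QComm.mul_left {F A : Type*} [Field F] [Ring A] [Algebra F A] {c d : F} {a b x : A}
    (ha : QComm c a x) (hb : QComm d b x) : QComm (c * d) (a * b) x := by
  unfold QComm at *
  rw [mul_assoc, hb, mul_smul_comm, ← mul_assoc, ha, smul_mul_assoc, smul_smul, mul_assoc,
    mul_comm d]

theorem serre_eq_cbr {F A : Type*} [Field F] [Ring A] [Algebra F A] {q : F} (q0 : q ≠ 0) (a u : A) :
    a * a * u - (q + q⁻¹) • (a * u * a) + u * a * a = cbr q⁻¹ a (cbr q a u) := by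
  simp only [cbr, mul_sub, sub_mul, mul_smul_comm, smul_mul_assoc, mul_assoc]
  match_scalars <;> field_simp <;> ring

/-- The Serre relation at the short root is mapped to a multiple of itself by reversal of products.
This reconciles the mirrored form used for `Y` in `Chev` with the common form of `ChevRel`. -/
theorem cbr_last_eq {F A : Type*} [Field F] [Ring A] [Algebra F A] {q ε : F} (q0 : q ≠ 0)
    (hε : ε * ε = 1) (u v : A) : cbr q (cbr ε v (cbr q v u)) v =
      (q * ε) • cbr q (cbr ε (cbr q⁻¹ u v) v) v := by
  rcases mul_self_eq_one_iff.1 hε with rfl | rfl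
  all_goals simp only [cbr, mul_sub, sub_mul, mul_smul_comm, smul_mul_assoc, mul_assoc]
  all_goals match_scalars <;> field_simp <;> ring

section Scalars

theorem sq_ne : sq ≠ 0 := RatFunc.X_ne_zero

theorem sq_pow_add_one_ne {m : ℕ} (hm : 0 < m) : sq ^ m + 1 ≠ 0 := by
  have := RatFunc.algebraMap_ne_zero (K := ℂ) (Polynomial.X_pow_add_C_ne_zero hm (1 : ℂ))
  simpa [sq] using this

theorem sq_pow_sub_one_ne {m : ℕ} (hm : 0 < m) : sq ^ m - 1 ≠ 0 := by
  have := RatFunc.algebraMap_ne_zero (K := ℂ) (Polynomial.X_pow_sub_C_ne_zero hm (1 : ℂ))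
  simpa [sq] using this

theorem koszul_mul_self (d e : ZMod 2) : koszul d e * koszul d e = 1 := by
  unfold koszul; split_ifs <;> ring

/-- The non-vanishing conditions hold because `q^(1/2)` is an indeterminate; they reduce to `X^m ±
1` being non-zero polynomials. -/
theorem qparam (κ : Kind) :
    QParam q (qnum 2) (sq - sq⁻¹)⁻¹ (koszul κ.deg κ.deg) where
  q0 := pow_ne_zero 2 sq_ne
  b0 := by
    have h0 := sq_ne
    have h2 := sq_pow_sub_one_ne (m := 2) (by norm_num)
    have h4 := sq_pow_sub_one_ne (m := 4) (by norm_num)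
    unfold qnum
    refine div_ne_zero ?_ ?_
    · intro h; apply h4
      have : sq ^ 2 - (sq ^ 2)⁻¹ = 0 := by simpa using h
      field_simp at this
      linear_combination this
    · intro h; apply h2
      field_simp at h
      linear_combination h
  hc := by
    have : (sq ^ (2 : ℤ) : Kq) = q := by rw [q]; norm_cast
    rw [qnum, zpow_neg, this, div_eq_inv_mul]
  h2 := by
    have := sq_pow_add_one_ne (m := 4) (by norm_num)
    intro h; apply this; rw [← h, q]; ring
  h1 := by
    have := sq_pow_add_one_ne (m := 2) (by norm_num)
    intro h; apply this; rw [← h, q]; ring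
  hε := koszul_mul_self _ _

end Scalars

section Brackets

variable {A B : Type*} [Ring A] [Algebra Kq A] [Ring B] [Algebra Kq B]

theorem map_sbr (f : A →ₐ[Kq] B) (d e : ZMod 2) (c : Kq) (x y : A) :
    f (sbr d e c x y) = sbr d e c (f x) (f y) := by simp [sbr]

theorem map_qbr (f : A →ₐ[Kq] B) (c : Kq) (x y : A) :
    f (qbr c x y) = qbr c (f x) (f y) := by simp [qbr]

theorem map_cartanNum (f : A →ₐ[Kq] B) (x y : A) :
    f (cartanNum x y) = cartanNum (f x) (f y) := by simp [cartanNum]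

theorem map_descend {n : ℕ} (f : A →ₐ[Kq] B) (g : A → A → A) (g' : B → B → B)
    (h : ∀ x y, f (g x y) = g' (f x) (f y)) (e : Fin n → A) (i : Fin n) :
    f (descend g e i) = descend g' (fun j => f (e j)) i := by
  induction hk : n - i.val generalizing i with
  | zero => omega
  | succ k ih =>
    rw [descend, descend]
    split_ifs with hi
    · rw [h, ih ⟨i.val + 1, hi⟩ (by simp only; omega)]
    · rfl

theorem sbr_eq_cbr (κ : Kind) (x y : A) :
    sbr κ.deg κ.deg 1 x y = cbr (koszul κ.deg κ.deg) x y := by simp [sbr, cbr]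

theorem koszul_zero_left (e : ZMod 2) : koszul 0 e = 1 := by simp [koszul]

theorem koszul_zero_right (d : ZMod 2) : koszul d 0 = 1 := by simp [koszul]

theorem Kind.deg_add_self (κ : Kind) : κ.deg + κ.deg = 0 := by cases κ <;> rfl

theorem sbr_two_left (κ : Kind) (c : Kq) (d : ZMod 2) (x y : A) :
    sbr (κ.deg + κ.deg) d c x y = cbr c x y := by
  rw [Kind.deg_add_self, sbr, koszul_zero_left, one_mul, cbr]

theorem sbr_two_right (κ : Kind) (c : Kq) (d : ZMod 2) (x y : A) :
    sbr d (κ.deg + κ.deg) c x y = cbr c x y := by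
  rw [Kind.deg_add_self, sbr, koszul_zero_right, one_mul, cbr]

end Brackets

section Descend

variable {A : Type*} [Ring A] {n : ℕ}

theorem rext_descend_zero (f : A → A → A) (e : Fin n → A) (h : 0 < n) :
    rext (descend f e) 0 = rext e 0 := by
  rw [rext_of_lt _ h, rext_of_lt _ h, descend, dif_neg (by simp [Fin.val_rev]; omega)]

theorem rext_descend_succ (f : A → A → A) (e : Fin n → A) {m : ℕ} (h : m + 1 < n) :
    rext (descend f e) (m + 1) = f (rext e (m + 1)) (rext (descend f e) m) := by
  have hm : m < n := by omega
  have hlt : (Fin.rev (⟨m + 1, h⟩ : Fin n)).val + 1 < n := by simp only [Fin.val_rev]; omega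
  rw [rext_of_lt _ h, rext_of_lt _ h, rext_of_lt _ hm, descend, dif_pos hlt]
  congr 2
  ext; simp only [Fin.val_rev]; omega

end Descend

/-! ### Equivalence of `Chev` with the defining relations. -/

section ChevRel

variable {κ : Kind} {n : ℕ} {B : Type*} [Ring B] [Algebra Kq B]

theorem chev_of_chevRel (f : FreeAlgebra Kq (ChevGen n) →ₐ[Kq] B)
    (h : ∀ x y, ChevRel κ n x y → f x = f y) :
    Chev q (qnum 2) (sq - sq⁻¹)⁻¹ (koszul κ.deg κ.deg) n
      (rext fun i => f (fE 1 i)) (rext fun i => f (fE (-1) i))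
      (rext (descend (fun x y => x * y) fun i => f (fK 1 i)))
      (rext (descend (fun x y => x * y) fun i => f (fK (-1) i))) := by
  have hp := qparam κ
  have hinv : ∀ s i, f (fK s i) * f (fK (-s) i) = 1 := fun s i => by
    simpa using h _ _ (.k_inv s i)
  have hK1 : ∀ s i j, Commute (f (fK 1 i)) (f (fK s j)) := fun s i j => by
    unfold Commute SemiconjBy
    simpa using h _ _ (.k_comm s i j)
  have hKK : ∀ s s' i j, Commute (f (fK s i)) (f (fK s' j)) := by
    intro s s' i j
    rcases Int.units_eq_one_or s with rfl | rfl
    · exact hK1 s' i j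
    · refine (QComm.inv_left (F := Kq) (hK1 s' i j).qcomm one_ne_zero (hinv 1 i) ?_
        |>.of_eq inv_one).commute
      simpa using hinv (-1) i
  have hd0 : ∀ (h : 0 < n) s, rext (descend (fun x y => x * y) fun i => f (fK s i)) 0 =
      f (fK s (Fin.rev ⟨0, h⟩)) := fun h s => by
    rw [rext_descend_zero _ _ h, rext_of_lt _ h]
  have hd : ∀ m (hm : m + 1 < n) s, rext (descend (fun x y => x * y) fun i => f (fK s i)) (m + 1) =
      f (fK s (Fin.rev ⟨m + 1, hm⟩)) * rext (descend (fun x y => x * y) fun i => f (fK s i)) m :=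
    fun m hm s => by rw [rext_descend_succ _ _ hm, rext_of_lt _ hm]
  set kd := fun s => rext (descend (fun x y => x * y) fun i => f (fK s i)) with hkd
  have hd0' : ∀ (h : 0 < n) s, kd s 0 = f (fK s (Fin.rev ⟨0, h⟩)) := hd0
  have hd' : ∀ m (hm : m + 1 < n) s, kd s (m + 1) = f (fK s (Fin.rev ⟨m + 1, hm⟩)) * kd s m := hd
  change Chev q (qnum 2) (sq - sq⁻¹)⁻¹ (koszul κ.deg κ.deg) n _ _ (kd 1) (kd (-1))
  clear hd hd0
  clear_value kd
  have hkK : ∀ m < n, ∀ s s' j, Commute (kd s m) (f (fK s' j)) := by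
    intro m hm s s' j
    induction m with
    | zero => rw [hd0' hm]; exact hKK _ _ _ _
    | succ m ih => rw [hd' m hm]; exact (hKK _ _ _ _).mul_left (ih (by omega))
  have hkk : ∀ m < n, ∀ m' < n, ∀ s s', Commute (kd s m) (kd s' m') := by
    intro m hm m' hm' s s'
    induction m' with
    | zero => rw [hd0' hm']; exact hkK _ hm _ _ _
    | succ m' ih => rw [hd' m' hm']; exact (hkK _ hm _ _ _).mul_right (ih (by omega))
  have hki : ∀ m < n, ∀ s, kd s m * kd (-s) m = 1 := by
    intro m hm s
    induction m with
    | zero => rw [hd0' hm, hd0' hm, hinv]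
    | succ m ih =>
      rw [hd' m hm, hd' m hm, mul_assoc, mul_mul_of (hkK m (by omega) s (-s) _), mul_assoc,
        ih (by omega), mul_one, hinv]
  have hki' : ∀ m < n, kd (-1) m * kd 1 m = 1 := fun m hm => by simpa using hki m hm (-1)
  have hKE : ∀ (s : ℤˣ) i j, QComm (q ^ ((s : ℤ) * cartan i j)) (f (fK 1 i)) (f (fE s j)) := by
    intro s i j
    refine qcomm_of_conj (k' := f (fK (-1) i)) (by simpa using hinv (-1) i) ?_
    simpa using h _ _ (.k_e s i j)
  have hkE : ∀ m < n, ∀ j (hj : j < n) (s : ℤˣ),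
      QComm (rootWt q m j ^ (s : ℤ)) (kd 1 m) (f (fE s (Fin.rev ⟨j, hj⟩))) := by
    intro m hm j hj s
    induction m with
    | zero =>
      rw [hd0' hm]
      refine (hKE s _ _).of_eq ?_
      rw [mul_comm, zpow_mul]
      congr 1
      simp only [cartan, rootWt, Fin.ext_iff, Fin.val_rev]
      split_ifs <;> first | omega | simp
    | succ m ih =>
      rw [hd' m hm]
      refine ((hKE s _ _).mul_left (ih (by omega))).of_eq ?_
      rw [mul_comm (s : ℤ), zpow_mul, ← mul_zpow]
      congr 1
      have := hp.q0
      simp only [cartan, rootWt, Fin.ext_iff, Fin.val_rev]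
      -- The weights of `k_{m+1} = K_{m+1} k_m` are partial sums of a column of the Cartan matrix;
      -- all contributions cancel except at `m + 1 = j` and `m + 2 = j`.
      split_ifs <;> first | omega | (simp; try field_simp)
  have hS : ∀ s : ℤˣ, ∀ i < n, ∀ j < n, (i + 1 = j ∨ j + 1 = i) → 1 ≤ j →
      rext (fun i => f (fE s i)) j * rext (fun i => f (fE s i)) j * rext (fun i => f (fE s i)) i
        - (q + q⁻¹) • (rext (fun i => f (fE s i)) j * rext (fun i => f (fE s i)) i *
          rext (fun i => f (fE s i)) j)
        + rext (fun i => f (fE s i)) i * rext (fun i => f (fE s i)) j *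
          rext (fun i => f (fE s i)) j = 0 := by
    intro s i hi j hj hij hj1
    rw [rext_of_lt _ hi, rext_of_lt _ hj, serre_eq_cbr hp.q0]
    rcases hij with hij | hij
    · have := h _ _ (.serre_up s (Fin.rev ⟨j, hj⟩) (Fin.rev ⟨i, hi⟩)
        (by simp only [Fin.val_rev]; omega))
      rwa [map_qbr, map_qbr, map_zero] at this
    · have := h _ _ (.serre_down s (Fin.rev ⟨i, hi⟩) (Fin.rev ⟨j, hj⟩)
        (by simp only [Fin.val_rev]; omega) (by simp only [Fin.val_rev]; omega))
      rwa [map_qbr, map_qbr, map_zero] at this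
  refine ⟨fun i hi => hki i hi 1, hki', fun i hi j hj => hkk i hi j hj 1 1, ?_, ?_, ?_, ?_, ?_,
    ?_, ?_, ?_, ?_, ?_, ?_⟩
  · intro i hi j hj
    rw [rext_of_lt _ hj]
    exact (hkE i hi j hj 1).of_eq (by simp)
  · intro i hi j hj
    rw [rext_of_lt _ hj]
    exact (hkE i hi j hj (-1)).of_eq (by simp)
  · intro i hi j hj hij
    rw [rext_of_lt _ hi, rext_of_lt _ hj]
    have := h _ _ (.e_f_ne (Fin.rev ⟨i, hi⟩) (Fin.rev ⟨j, hj⟩)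
      (fun h' => hij (by simpa using h')))
    have hd : koszul (ChevGen.deg κ (ChevGen.e 1 (Fin.rev ⟨i, hi⟩)))
        (ChevGen.deg κ (ChevGen.e (-1) (Fin.rev ⟨j, hj⟩))) = 1 := by
      simp only [ChevGen.deg, Fin.val_rev]
      split_ifs
      · omega
      · exact koszul_zero_right _
      · exact koszul_zero_left _
      · exact koszul_zero_left _
    rw [map_sbr, sbr, hd, map_zero, mul_one, one_smul, sub_eq_zero] at this
    exact this
  · intro m hm
    have hm' : m < n := by omega
    have := h _ _ (.e_f (Fin.rev ⟨m + 1, hm⟩) (by simp only [Fin.val_rev]; omega))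
    rw [map_smul, map_qbr, map_cartanNum, qbr, cartanNum, one_smul] at this
    rw [rext_of_lt _ hm, rext_of_lt _ hm, this, hd' m hm, hd' m hm, mul_assoc, hki m hm' 1,
      mul_one, mul_mul_of (hkK m hm' 1 (-1) _), mul_assoc, hki m hm' 1, mul_one]
  · intro hn
    have := h _ _ (.e_f_last (Fin.rev ⟨0, hn⟩) (by simp only [Fin.val_rev]; omega))
    rw [map_sbr, map_cartanNum, cartanNum, sbr_eq_cbr, cbr] at this
    rw [rext_of_lt _ hn, rext_of_lt _ hn, this, hd0', hd0']
  · intro i j hij hj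
    have hi : i < n := by omega
    rw [rext_of_lt _ hi, rext_of_lt _ hj]
    have := h _ _ (.serre_far 1 (Fin.rev ⟨j, hj⟩) (Fin.rev ⟨i, hi⟩)
      (by simp only [Fin.val_rev]; omega))
    rwa [map_qbr, map_zero, qbr, one_smul, sub_eq_zero] at this
  · intro i j hij hj
    have hi : i < n := by omega
    rw [rext_of_lt _ hi, rext_of_lt _ hj]
    have := h _ _ (.serre_far (-1) (Fin.rev ⟨j, hj⟩) (Fin.rev ⟨i, hi⟩)
      (by simp only [Fin.val_rev]; omega))
    rwa [map_qbr, map_zero, qbr, one_smul, sub_eq_zero] at this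
  · exact hS 1
  · exact hS (-1)
  · intro hn
    have hn0 : 0 < n := by omega
    have := h _ _ (.serre_last 1 (Fin.rev ⟨1, hn⟩) (Fin.rev ⟨0, hn0⟩)
      (by simp only [Fin.val_rev]; omega) (by simp only [Fin.val_rev]; omega))
    simp only [map_qbr, map_sbr, map_zero] at this
    rw [sbr_eq_cbr] at this
    rw [rext_of_lt _ hn, rext_of_lt _ hn0]
    exact this
  · intro hn
    have hn0 : 0 < n := by omega
    have := h _ _ (.serre_last (-1) (Fin.rev ⟨1, hn⟩) (Fin.rev ⟨0, hn0⟩)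
      (by simp only [Fin.val_rev]; omega) (by simp only [Fin.val_rev]; omega))
    simp only [map_qbr, map_sbr, map_zero] at this
    rw [sbr_eq_cbr] at this
    rw [rext_of_lt _ hn, rext_of_lt _ hn0]
    rw [cbr_last_eq hp.q0 hp.hε]
    exact smul_eq_zero_of_right _ this

/-- The Cartan generators are recovered from the partial products as `K_0 = k_0` and `K_{m+1} =
k_{m+1} k_m⁻¹`. -/
theorem chevRel_of_chev {E Y k k' : ℕ → B}
    (h : Chev q (qnum 2) (sq - sq⁻¹)⁻¹ (koszul κ.deg κ.deg) n E Y k k')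
    (f : FreeAlgebra Kq (ChevGen n) →ₐ[Kq] B)
    (fE1 : ∀ i : Fin n, f (fE 1 i) = E (Fin.rev i)) (fY : ∀ i : Fin n, f (fE (-1) i) = Y (Fin.rev i))
    (fK0 : ∀ h : 0 < n, f (fK 1 (Fin.rev ⟨0, h⟩)) = k 0)
    (fK0' : ∀ h : 0 < n, f (fK (-1) (Fin.rev ⟨0, h⟩)) = k' 0)
    (f_K : ∀ m (h : m + 1 < n), f (fK 1 (Fin.rev ⟨m + 1, h⟩)) = k (m + 1) * k' m)
    (f_K' : ∀ m (h : m + 1 < n), f (fK (-1) (Fin.rev ⟨m + 1, h⟩)) = k' (m + 1) * k m)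
    {u v : FreeAlgebra Kq (ChevGen n)} (huv : ChevRel κ n u v) : f u = f v := by
  have hp := qparam κ
  have q0 := hp.q0
  have e2 : ∀ i : Fin n, ∃ m, ∃ hm : m < n, i = Fin.rev ⟨m, hm⟩ := fun i =>
    ⟨Fin.rev i, (Fin.rev i).2, (Fin.rev_rev i).symm⟩
  have hcomm : ∀ i < n, ∀ j < n, Commute (k i) (k' j) := fun i hi j hj => h.kk'_comm hi hj
  have hKk : ∀ m (hm : m < n) s, ∀ j < n, Commute (k j) (f (fK s (Fin.rev ⟨m, hm⟩))) := by
    intro m hm s j hj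
    rcases Int.units_eq_one_or s with rfl | rfl <;> cases m with
    | zero => first | (rw [fK0]; exact h.comm _ hj _ hm) | (rw [fK0']; exact hcomm _ hj _ hm)
    | succ m => first
      | (rw [f_K]; exact (h.comm _ hj _ hm).mul_right (hcomm _ hj _ (by omega)))
      | (rw [f_K']; exact (hcomm _ hj _ hm).mul_right (h.comm _ hj _ (by omega)))
  have hKk' : ∀ m (hm : m < n) s, ∀ j < n, Commute (k' j) (f (fK s (Fin.rev ⟨m, hm⟩))) := by
    intro m hm s j hj
    exact (QComm.inv_left (F := Kq) (hKk m hm s j hj).qcomm one_ne_zero (h.kk' j hj) (h.k'k j hj)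
      |>.of_eq inv_one).commute
  have hinv : ∀ s i, f (fK s i) * f (fK (-s) i) = 1 := by
    intro s i
    obtain ⟨m, hm, rfl⟩ := e2 i
    rcases Int.units_eq_one_or s with rfl | rfl
    · cases m with
      | zero => rw [fK0, fK0', h.kk' _ hm]
      | succ m =>
        rw [f_K, f_K', mul_assoc, mul_mul_of (h.k'k'_comm (by omega) hm), mul_assoc,
          h.k'k _ (by omega), mul_one, h.kk' _ hm]
    · rw [neg_neg]
      cases m with
      | zero => rw [fK0, fK0', h.k'k _ hm]
      | succ m =>
        rw [f_K, f_K', mul_assoc, mul_mul_of (h.comm _ (by omega) _ hm), mul_assoc,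
          h.kk' _ (by omega), mul_one, h.k'k _ hm]
  cases huv with
  | k_inv s i => rw [map_mul, hinv, map_one]
  | k_comm s i j =>
    obtain ⟨m, hm, rfl⟩ := e2 i
    obtain ⟨m', hm', rfl⟩ := e2 j
    rw [map_mul, map_mul]
    change Commute _ _
    cases m with
    | zero => rw [fK0]; exact hKk _ hm' _ _ hm
    | succ m => rw [f_K]; exact (hKk _ hm' _ _ hm).mul_left (hKk' _ hm' _ _ (by omega))
  | k_e s i j =>
    obtain ⟨m, hm, rfl⟩ := e2 i
    rw [map_mul, map_mul, map_smul]
    have hw : ∀ l < n, QComm (rootWt q l (Fin.rev j) ^ (s : ℤ)) (k l) (f (fE s j)) := by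
      intro l hl
      rcases Int.units_eq_one_or s with rfl | rfl
      · rw [fE1]; exact (h.kE l hl _ (Fin.rev j).2).of_eq (by simp)
      · rw [fY]; exact (h.kY l hl _ (Fin.rev j).2).of_eq (by simp)
    refine QComm.conj ?_ (hinv 1 _)
    cases m with
    | zero =>
      rw [fK0]
      refine (hw 0 hm).of_eq ?_
      rw [mul_comm, zpow_mul]
      congr 1
      simp only [cartan, rootWt, Fin.ext_iff, Fin.val_rev]
      split_ifs <;> first | omega | simp
    | succ m =>
      rw [f_K]
      have hm' : m < n := by omega
      refine ((hw _ hm).mul_left ((hw m hm').inv_left (zpow_ne_zero _ (rootWt_ne q0 _ _))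
        (h.kk' m hm') (h.k'k m hm'))).of_eq ?_
      rw [mul_comm (s : ℤ), zpow_mul, ← inv_zpow, ← mul_zpow]
      congr 1
      simp only [cartan, rootWt, Fin.ext_iff, Fin.val_rev]
      split_ifs <;> first | omega | (simp; try field_simp)
  | e_f_ne i j hij =>
    have hd : koszul (ChevGen.deg κ (ChevGen.e 1 i)) (ChevGen.deg κ (ChevGen.e (-1) j)) = 1 := by
      simp only [ChevGen.deg]
      split_ifs
      · exact absurd (Fin.ext (by omega)) hij
      · exact koszul_zero_right _
      · exact koszul_zero_left _
      · exact koszul_zero_left _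
    have := (h.EY_ne _ (Fin.rev i).2 _ (Fin.rev j).2
      (fun h' => hij (Fin.rev_injective (Fin.ext h')))).eq
    rw [map_sbr, sbr, hd, map_zero, mul_one, one_smul, sub_eq_zero, fE1, fY, this]
  | e_f i hi =>
    obtain ⟨m, hm, rfl⟩ := e2 i
    cases m with
    | zero => simp only [Fin.val_rev] at hi; omega
    | succ m =>
      have := h.EY m hm
      rw [map_smul, map_qbr, map_cartanNum, qbr, cartanNum, one_smul, fE1, fY, f_K, f_K',
        Fin.rev_rev, this, (hcomm m (by omega) _ hm).eq]
  | e_f_last i hi =>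
    obtain ⟨m, hm, rfl⟩ := e2 i
    obtain rfl : m = 0 := by simp only [Fin.val_rev] at hi; omega
    rw [map_sbr, map_cartanNum, cartanNum, sbr_eq_cbr, cbr, fE1, fY, fK0, fK0', Fin.rev_rev]
    exact h.EY_zero hm
  | serre_far s i j hij =>
    rw [map_qbr, map_zero, qbr, one_smul, sub_eq_zero]
    have hlt : (Fin.rev j : ℕ) + 2 ≤ Fin.rev i := by simp only [Fin.val_rev]; omega
    rcases Int.units_eq_one_or s with rfl | rfl
    · rw [fE1, fE1]; exact h.farE _ _ hlt (Fin.rev i).2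
    · rw [fY, fY]; exact h.farY _ _ hlt (Fin.rev i).2
  | serre_down s i j hij hj =>
    rw [map_qbr, map_qbr, map_zero]
    change cbr q⁻¹ _ (cbr q _ _) = 0
    rw [← serre_eq_cbr q0]
    have h1 : (Fin.rev i : ℕ) + 1 = Fin.rev j ∨ (Fin.rev j : ℕ) + 1 = Fin.rev i := by
      simp only [Fin.val_rev]; omega
    have h2 : 1 ≤ (Fin.rev j : ℕ) := by simp only [Fin.val_rev]; omega
    rcases Int.units_eq_one_or s with rfl | rfl
    · rw [fE1, fE1]; exact h.serreE _ (Fin.rev i).2 _ (Fin.rev j).2 h1 h2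
    · rw [fY, fY]; exact h.serreY _ (Fin.rev i).2 _ (Fin.rev j).2 h1 h2
  | serre_up s i j hij =>
    rw [map_qbr, map_qbr, map_zero]
    change cbr q⁻¹ _ (cbr q _ _) = 0
    rw [← serre_eq_cbr q0]
    have h1 : (Fin.rev j : ℕ) + 1 = Fin.rev i ∨ (Fin.rev i : ℕ) + 1 = Fin.rev j := by
      simp only [Fin.val_rev]; omega
    have h2 : 1 ≤ (Fin.rev i : ℕ) := by simp only [Fin.val_rev]; omega
    rcases Int.units_eq_one_or s with rfl | rfl
    · rw [fE1, fE1]; exact h.serreE _ (Fin.rev j).2 _ (Fin.rev i).2 h1 h2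
    · rw [fY, fY]; exact h.serreY _ (Fin.rev j).2 _ (Fin.rev i).2 h1 h2
  | serre_last s i j hij hj =>
    have hi1 : (Fin.rev i : ℕ) = 1 := by simp only [Fin.val_rev]; omega
    have hj0 : (Fin.rev j : ℕ) = 0 := by simp only [Fin.val_rev]; omega
    rw [map_qbr, map_sbr, map_qbr, map_zero, sbr_eq_cbr]
    rcases Int.units_eq_one_or s with rfl | rfl
    · rw [fE1, fE1, hi1, hj0]; exact h.lastE (by omega)
    · rw [fY, fY, hi1, hj0]
      have := h.lastY (by omega)
      rw [cbr_last_eq q0 hp.hε] at this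
      exact (smul_eq_zero.1 this).resolve_left
        (mul_ne_zero q0 (left_ne_zero_of_mul_eq_one hp.hε))

end ChevRel

/-! ### Comparison of the recursions over `ℕ` and over `Fin n`. -/

section Extension

variable {F A : Type*} [Field F] [Ring A] [Algebra F A] {n : ℕ}

theorem rext_of_ge (f : Fin n → A) {m : ℕ} (h : n ≤ m) : rext f m = 0 := dif_neg (by omega)

theorem xs_rext (q : F) (e : Fin n → A) :
    xs q (rext e) = rext (descend (fun x y => cbr q⁻¹ x y) e) := by
  funext m
  induction m with
  | zero =>
    rcases Nat.eq_zero_or_pos n with rfl | hn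
    · simp [xs, rext]
    · rw [rext_descend_zero _ _ hn, xs]
  | succ m ih =>
    rw [xs]
    by_cases hm : m + 1 < n
    · rw [rext_descend_succ _ _ hm, ih]
    -- Beyond the last node both sides take the default value `0`, so the two sequences agree as
    -- functions.
    · rw [rext_of_ge _ (not_lt.1 hm), rext_of_ge _ (not_lt.1 hm)]; simp [cbr]

theorem ys_rext (q : F) (e : Fin n → A) :
    ys q (rext e) = rext (descend (fun x y => cbr q y x) e) := by
  funext m
  induction m with
  | zero =>
    rcases Nat.eq_zero_or_pos n with rfl | hn
    · simp [ys, rext]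
    · rw [rext_descend_zero _ _ hn, ys]
  | succ m ih =>
    rw [ys]
    by_cases hm : m + 1 < n
    · rw [rext_descend_succ _ _ hm, ih]
    · rw [rext_of_ge _ (not_lt.1 hm), rext_of_ge _ (not_lt.1 hm)]; simp [cbr]

theorem forall_rev {n : ℕ} {p : Fin n → Prop} (h : ∀ m (hm : m < n), p (Fin.rev ⟨m, hm⟩))
    (i : Fin n) : p i := by
  have := h _ (Fin.rev i).2
  rwa [Fin.eta, Fin.rev_rev] at this

end Extension

/-! ### The two changes of generators are mutually inverse. -/

section Recover

variable {F A : Type*} [Field F] [Ring A] [Algebra F A] {q b c ε : F} {n : ℕ}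

/-- Each recovered root vector raises `x_m` to `x_{m+1}`, so the iterated bracket rebuilds the
sequence step by step. -/
theorem Half.xs_ec {x y k k' : ℕ → A} (h : Half q b c ε n x y k k') (hp : QParam q b c ε) {m : ℕ}
    (hm : m < n) : xs q (ec b ε x y k') m = x m := by
  induction m with
  | zero => rfl
  | succ m ih => rw [xs, ih (by omega), h.cbr_ec hp hm]

theorem xs_congr (q : F) {e e' : ℕ → A} (h : ∀ m < n, e m = e' m) {m : ℕ} (hm : m < n) :
    xs q e m = xs q e' m := by
  induction m with
  | zero => exact h 0 hm
  | succ m ih => rw [xs, xs, ih (by omega), h _ hm]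

theorem ys_congr (q : F) {e e' : ℕ → A} (h : ∀ m < n, e m = e' m) {m : ℕ} (hm : m < n) :
    ys q e m = ys q e' m := by
  induction m with
  | zero => exact h 0 hm
  | succ m ih => rw [ys, ys, ih (by omega), h _ hm]

/-- Immediate from `L_{m+1,m} = b k_m E_{m+1}`. -/
theorem Chev.ec_xs {E Y k k' : ℕ → A} (h : Chev q b c ε n E Y k k') (hp : QParam q b c ε) {m : ℕ}
    (hm : m < n) : ec b ε (xs q E) (ys q Y) k' m = E m := by
  cases m with
  | zero => rfl
  | succ m =>
    have hm' : m < n := by omega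
    rw [ec, h.L_succ hp hm (h.L_self hp hm'), mul_smul_comm, mul_mul_of (h.k'k m hm'), one_mul,
      smul_smul, inv_mul_cancel₀ hp.b0, one_smul]

open MulOpposite in
theorem Chev.half_op {E Y k k' : ℕ → A} (h : Chev q b c ε n E Y k k') (hp : QParam q b c ε) :
    Half q⁻¹ b (-c) ε n (fun i => op (ys q Y i)) (fun i => op (xs q E i)) (fun i => op (k' i))
      (fun i => op (k i)) := by
  have := (h.star hp).half hp.star
  rwa [show xs q⁻¹ (fun i => op (Y i)) = fun i => op (ys q Y i) from funext (op_ys q Y),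
    show ys q⁻¹ (fun i => op (E i)) = fun i => op (xs q E i) from funext (op_xs q E)] at this

open MulOpposite in
theorem Chev.yc_ys {E Y k k' : ℕ → A} (h : Chev q b c ε n E Y k k') (hp : QParam q b c ε) {m : ℕ}
    (hm : m < n) : yc b ε (xs q E) (ys q Y) k m = Y m := by
  have := (h.star hp).ec_xs hp.star hm
  rw [show xs q⁻¹ (fun i => op (Y i)) = fun i => op (ys q Y i) from funext (op_ys q Y),
    show ys q⁻¹ (fun i => op (E i)) = fun i => op (xs q E i) from funext (op_xs q E), op_yc] at this
  exact op_injective this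

open MulOpposite in
theorem Half.ys_yc {x y k k' : ℕ → A} (hp : QParam q b c ε)
    (hs : Half q⁻¹ b (-c) ε n (fun i => op (y i)) (fun i => op (x i)) (fun i => op (k' i))
      (fun i => op (k i))) {m : ℕ}
    (hm : m < n) : ys q (yc b ε x y k) m = y m := by
  have := hs.xs_ec hp.star hm
  rw [show ec b ε (fun i => op (y i)) (fun i => op (x i)) (fun i => op (k i)) =
    fun i => op (yc b ε x y k i) from funext (op_yc b ε x y k), op_ys] at this
  exact op_injective this

end Recover

/-! ### The isomorphism. -/

section Concrete

variable {κ : Kind} {n : ℕ} {τ : ℤˣ} {B : Type*} [Ring B] [Algebra Kq B]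

theorem map_cbr {A : Type*} [Ring A] [Algebra Kq A] (f : A →ₐ[Kq] B) (c : Kq) (x y : A) :
    f (cbr c x y) = cbr c (f x) (f y) := by simp [cbr]

theorem map_relator (f : FreeAlgebra Kq (ParaGen n) →ₐ[Kq] B) (r : ParaIdx n) :
    f (relator κ n τ r) = relatorIn q (qnum 2) (sq - sq⁻¹)⁻¹ (koszul κ.deg κ.deg) n τ
      (fun s i => f (fa s i)) (fun s i => f (fk s i)) r := by
  cases r <;>
    simp only [relator, relatorIn, map_sub, map_add, map_mul, map_one, map_smul, map_cbr, abr,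
      sbr_two_left, sbr_two_right, sbr_eq_cbr, cartanNum, serreT, serreS, apply_ite f, map_neg,
      map_zero]

/-- The relations hold in the quantized enveloping algebra. -/
theorem QUEA.chev (κ : Kind) (n : ℕ) :
    Chev q (qnum 2) (sq - sq⁻¹)⁻¹ (koszul κ.deg κ.deg) n
      (rext (QUEA.E κ n 1)) (rext (QUEA.E κ n (-1)))
      (rext (chevK κ n 1)) (rext (chevK κ n (-1))) :=
  chev_of_chevRel (κ := κ) (RingQuot.mkAlgHom Kq (ChevRel κ n))
    fun _ _ h => RingQuot.mkAlgHom_rel Kq h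

theorem xs_E (κ : Kind) (n : ℕ) : xs q (rext (QUEA.E κ n 1)) = rext (chevA κ n 1) := by
  rw [xs_rext]; congr 1

theorem ys_E (κ : Kind) (n : ℕ) : ys q (rext (QUEA.E κ n (-1))) = rext (chevA κ n (-1)) := by
  rw [ys_rext]; congr 1

theorem ParaAlg.relatorIn_eq_zero (κ : Kind) (n : ℕ) (τ : ℤˣ) (r : ParaIdx n) :
    relatorIn q (qnum 2) (sq - sq⁻¹)⁻¹ (koszul κ.deg κ.deg) n τ
      (ParaAlg.a κ n τ) (ParaAlg.k κ n τ) r = 0 := by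
  have := RingQuot.mkAlgHom_rel Kq (show ParaRel κ n τ (relator κ n τ r) 0 from ⟨r, rfl, rfl⟩)
  rw [map_relator, map_zero] at this
  exact this

theorem ParaAlg.half (κ : Kind) (n : ℕ) (τ : ℤˣ) :
    Half q (qnum 2) (sq - sq⁻¹)⁻¹ (koszul κ.deg κ.deg) n
      (rext (ParaAlg.a κ n τ 1)) (rext (ParaAlg.a κ n τ (-1)))
      (rext (ParaAlg.k κ n τ 1)) (rext (ParaAlg.k κ n τ (-1))) :=
  half_of_relatorIn (ParaAlg.relatorIn_eq_zero κ n τ)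

open MulOpposite in
theorem ParaAlg.half_op (κ : Kind) (n : ℕ) (τ : ℤˣ) :
    Half q⁻¹ (qnum 2) (-(sq - sq⁻¹)⁻¹) (koszul κ.deg κ.deg) n
      (fun i => op (rext (ParaAlg.a κ n τ (-1)) i)) (fun i => op (rext (ParaAlg.a κ n τ 1) i))
      (fun i => op (rext (ParaAlg.k κ n τ (-1)) i)) (fun i => op (rext (ParaAlg.k κ n τ 1) i)) :=
  half_op_of_relatorIn (qparam κ) (ParaAlg.relatorIn_eq_zero κ n τ)

/-- The images of the parastatistics generators in the quantized enveloping algebra. -/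
noncomputable def chevGen (κ : Kind) (n : ℕ) : ParaGen n → QUEA κ n
  | .a s i => chevA κ n s i
  | .k s i => chevK κ n s i

/-- The images of the Chevalley generators in the deformed parastatistics algebra. -/
noncomputable def paraGen (κ : Kind) (n : ℕ) (τ : ℤˣ) : ChevGen n → ParaAlg κ n τ
  | .e s i => paraE κ n τ s i
  | .k s i => paraK κ n τ s i

theorem lift_chevGen_rel {x y : FreeAlgebra Kq (ParaGen n)} (h : ParaRel κ n τ x y) :
    FreeAlgebra.lift Kq (chevGen κ n) x = FreeAlgebra.lift Kq (chevGen κ n) y := by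
  obtain ⟨r, rfl, rfl⟩ := h
  have h1 := (QUEA.chev κ n).half (qparam κ)
  have h2 := (QUEA.chev κ n).half_op (qparam κ)
  rw [xs_E, ys_E] at h1 h2
  rw [map_relator, map_zero]
  simp only [FreeAlgebra.lift_ι_apply]
  exact relatorIn_of_half (qparam κ) (α := chevA κ n) (K := chevK κ n) h1 h2 r

theorem paraE_one (i : Fin n) : paraE κ n τ 1 i = ec (qnum 2) (koszul κ.deg κ.deg)
    (rext (ParaAlg.a κ n τ 1)) (rext (ParaAlg.a κ n τ (-1))) (rext (ParaAlg.k κ n τ (-1)))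
    (Fin.rev i) := by
  revert i
  apply forall_rev
  intro m hm
  rw [Fin.rev_rev]
  cases m with
  | zero =>
    rw [ec, paraE, dif_neg (by simp only [Fin.val_rev]; omega), rext_of_lt _ hm]
  | succ m =>
    have hm' : m < n := by omega
    have e : (⟨(Fin.rev (⟨m + 1, hm⟩ : Fin n)).val + 1, by simp only [Fin.val_rev]; omega⟩ : Fin n)
        = Fin.rev ⟨m, hm'⟩ := by ext; simp only [Fin.val_rev]; omega
    rw [ec, paraE, dif_pos (by simp only [Fin.val_rev]; omega), if_pos rfl, e, Lc,
      rext_of_lt _ hm, rext_of_lt _ hm', rext_of_lt _ hm', abr, sbr_eq_cbr, cbr]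

theorem paraE_neg_one (i : Fin n) : paraE κ n τ (-1) i = yc (qnum 2) (koszul κ.deg κ.deg)
    (rext (ParaAlg.a κ n τ 1)) (rext (ParaAlg.a κ n τ (-1))) (rext (ParaAlg.k κ n τ 1))
    (Fin.rev i) := by
  revert i
  apply forall_rev
  intro m hm
  rw [Fin.rev_rev]
  cases m with
  | zero =>
    rw [yc, paraE, dif_neg (by simp only [Fin.val_rev]; omega), rext_of_lt _ hm]
  | succ m =>
    have hm' : m < n := by omega
    have e : (⟨(Fin.rev (⟨m + 1, hm⟩ : Fin n)).val + 1, by simp only [Fin.val_rev]; omega⟩ : Fin n)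
        = Fin.rev ⟨m, hm'⟩ := by ext; simp only [Fin.val_rev]; omega
    rw [yc, paraE, dif_pos (by simp only [Fin.val_rev]; omega), if_neg (by decide), e, Lc,
      rext_of_lt _ hm, rext_of_lt _ hm', rext_of_lt _ hm', abr, sbr_eq_cbr, cbr]

theorem paraK_zero (s : ℤˣ) (h : 0 < n) :
    paraK κ n τ s (Fin.rev ⟨0, h⟩) = rext (ParaAlg.k κ n τ s) 0 := by
  rw [paraK, dif_neg (by simp only [Fin.val_rev]; omega), rext_of_lt _ h]

theorem paraK_succ (s : ℤˣ) {m : ℕ} (h : m + 1 < n) :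
    paraK κ n τ s (Fin.rev ⟨m + 1, h⟩) =
      rext (ParaAlg.k κ n τ s) (m + 1) * rext (ParaAlg.k κ n τ (-s)) m := by
  have hm' : m < n := by omega
  have e : (⟨(Fin.rev (⟨m + 1, h⟩ : Fin n)).val + 1, by simp only [Fin.val_rev]; omega⟩ : Fin n)
      = Fin.rev ⟨m, hm'⟩ := by ext; simp only [Fin.val_rev]; omega
  rw [paraK, dif_pos (by simp only [Fin.val_rev]; omega), e, rext_of_lt _ h, rext_of_lt _ hm']

theorem lift_paraGen_rel {x y : FreeAlgebra Kq (ChevGen n)} (h : ChevRel κ n x y) :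
    FreeAlgebra.lift Kq (paraGen κ n τ) x = FreeAlgebra.lift Kq (paraGen κ n τ) y := by
  refine chevRel_of_chev ((ParaAlg.half κ n τ).chev (qparam κ) (ParaAlg.half_op κ n τ)) _
    ?_ ?_ ?_ ?_ ?_ ?_ h
  · intro i; rw [FreeAlgebra.lift_ι_apply]; exact paraE_one i
  · intro i; rw [FreeAlgebra.lift_ι_apply]; exact paraE_neg_one i
  · intro h; rw [FreeAlgebra.lift_ι_apply]; exact paraK_zero _ h
  · intro h; rw [FreeAlgebra.lift_ι_apply]; exact paraK_zero _ h
  · intro m h; rw [FreeAlgebra.lift_ι_apply]; exact paraK_succ _ h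
  · intro m h; rw [FreeAlgebra.lift_ι_apply]; simpa [paraGen] using paraK_succ (κ := κ) (τ := τ) (-1) h

/-- The homomorphism from the parastatistics algebra to the quantized enveloping algebra. -/
noncomputable def toQUEA (κ : Kind) (n : ℕ) (τ : ℤˣ) : ParaAlg κ n τ →ₐ[Kq] QUEA κ n :=
  RingQuot.liftAlgHom Kq ⟨FreeAlgebra.lift Kq (chevGen κ n), fun _ _ h => lift_chevGen_rel h⟩

/-- The homomorphism from the quantized enveloping algebra to the parastatistics algebra. -/
noncomputable def ofQUEA (κ : Kind) (n : ℕ) (τ : ℤˣ) : QUEA κ n →ₐ[Kq] ParaAlg κ n τ :=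
  RingQuot.liftAlgHom Kq ⟨FreeAlgebra.lift Kq (paraGen κ n τ), fun _ _ h => lift_paraGen_rel h⟩

theorem toQUEA_gen (g : ParaGen n) : toQUEA κ n τ (ParaAlg.gen κ n τ g) = chevGen κ n g := by
  rw [toQUEA, ParaAlg.gen, RingQuot.liftAlgHom_mkAlgHom_apply, FreeAlgebra.lift_ι_apply]

theorem ofQUEA_gen (g : ChevGen n) : ofQUEA κ n τ (QUEA.gen κ n g) = paraGen κ n τ g := by
  rw [ofQUEA, QUEA.gen, RingQuot.liftAlgHom_mkAlgHom_apply, FreeAlgebra.lift_ι_apply]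

/-- A homomorphism carries the iterated bracket of the Chevalley generators to that of their images,
which `Half.xs_ec` and `Half.ys_yc` evaluate. -/
theorem ofQUEA_chevA (s : ℤˣ) (i : Fin n) :
    ofQUEA κ n τ (chevA κ n s i) = ParaAlg.a κ n τ s i := by
  have hi := (Fin.rev i).2
  rcases Int.units_eq_one_or s with rfl | rfl
  · rw [chevA, if_pos rfl, map_descend _ _ (fun x y => cbr q⁻¹ x y) (fun x y => map_qbr _ _ _ _),
      ← rext_rev (descend _ _), ← xs_rext, ← rext_rev (ParaAlg.a κ n τ 1),
      ← (ParaAlg.half κ n τ).xs_ec (qparam κ) hi]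
    refine xs_congr q (fun m hm => ?_) hi
    rw [rext_of_lt _ hm, QUEA.E, ofQUEA_gen, paraGen, paraE_one, Fin.rev_rev]
  · rw [chevA, if_neg (by decide), map_descend _ _ (fun x y => cbr q y x)
      (fun x y => map_qbr _ _ _ _),
      ← rext_rev (descend _ _), ← ys_rext, ← rext_rev (ParaAlg.a κ n τ (-1)),
      ← Half.ys_yc (qparam κ) (ParaAlg.half_op κ n τ) hi]
    refine ys_congr q (fun m hm => ?_) hi
    rw [rext_of_lt _ hm, QUEA.E, ofQUEA_gen, paraGen, paraE_neg_one, Fin.rev_rev]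

theorem rext_k_inv (s : ℤˣ) {m : ℕ} (hm : m < n) :
    rext (ParaAlg.k κ n τ (-s)) m * rext (ParaAlg.k κ n τ s) m = 1 := by
  rcases Int.units_eq_one_or s with rfl | rfl
  · exact (ParaAlg.half κ n τ).k'k m hm
  · rw [neg_neg]; exact (ParaAlg.half κ n τ).kk' m hm

theorem ofQUEA_chevK (s : ℤˣ) (i : Fin n) :
    ofQUEA κ n τ (chevK κ n s i) = ParaAlg.k κ n τ s i := by
  rw [chevK, map_descend _ _ (fun x y => x * y) (fun x y => map_mul _ _ _),
    ← rext_rev (descend _ _), ← rext_rev (ParaAlg.k κ n τ s)]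
  have hi := (Fin.rev i).2
  generalize (Fin.rev i : ℕ) = m at hi
  induction m with
  | zero =>
    rw [rext_descend_zero _ _ hi, rext_of_lt _ hi, QUEA.K, ofQUEA_gen, paraGen, paraK_zero]
  | succ m ih =>
    rw [rext_descend_succ _ _ hi, ih (by omega), rext_of_lt _ hi, QUEA.K, ofQUEA_gen, paraGen,
      paraK_succ, mul_assoc, rext_k_inv _ (by omega), mul_one]

theorem toQUEA_rext_a (s : ℤˣ) (m : ℕ) :
    toQUEA κ n τ (rext (ParaAlg.a κ n τ s) m) = rext (chevA κ n s) m := by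
  unfold rext; split_ifs
  · exact toQUEA_gen _
  · exact map_zero _

theorem toQUEA_rext_k (s : ℤˣ) (m : ℕ) :
    toQUEA κ n τ (rext (ParaAlg.k κ n τ s) m) = rext (chevK κ n s) m := by
  unfold rext; split_ifs
  · exact toQUEA_gen _
  · exact map_zero _

theorem toQUEA_paraE (s : ℤˣ) (i : Fin n) :
    toQUEA κ n τ (paraE κ n τ s i) = QUEA.E κ n s i := by
  have hi := (Fin.rev i).2
  rcases Int.units_eq_one_or s with rfl | rfl
  · rw [paraE_one, ← rext_rev (QUEA.E κ n 1), ← (QUEA.chev κ n).ec_xs (qparam κ) hi, xs_E, ys_E]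
    generalize (Fin.rev i : ℕ) = m
    cases m <;> simp [ec, Lc, toQUEA_rext_a, toQUEA_rext_k]
  · rw [paraE_neg_one, ← rext_rev (QUEA.E κ n (-1)), ← (QUEA.chev κ n).yc_ys (qparam κ) hi, xs_E,
      ys_E]
    generalize (Fin.rev i : ℕ) = m
    cases m <;> simp [yc, Lc, toQUEA_rext_a, toQUEA_rext_k]

theorem chevK_inv (s : ℤˣ) {m : ℕ} (hm : m < n) :
    rext (chevK κ n s) m * rext (chevK κ n (-s)) m = 1 := by
  rcases Int.units_eq_one_or s with rfl | rfl
  · exact (QUEA.chev κ n).kk' m hm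
  · rw [neg_neg]; exact (QUEA.chev κ n).k'k m hm

theorem toQUEA_paraK (s : ℤˣ) (i : Fin n) :
    toQUEA κ n τ (paraK κ n τ s i) = QUEA.K κ n s i := by
  revert i
  apply forall_rev
  intro m hm
  cases m with
  | zero =>
    rw [paraK_zero, toQUEA_rext_k, ← rext_of_lt (QUEA.K κ n s) hm]
    exact rext_descend_zero _ _ hm
  | succ m =>
    rw [paraK_succ, map_mul, toQUEA_rext_k, toQUEA_rext_k,
      show rext (chevK κ n s) (m + 1) = _ from rext_descend_succ _ _ hm, mul_assoc,
      show rext (descend (fun x y => x * y) (QUEA.K κ n s)) m * _ = 1 from chevK_inv s (by omega),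
      mul_one, rext_of_lt _ hm]

/-- The isomorphism of the parastatistics algebra with the quantized enveloping algebra. -/
noncomputable def paraEquiv (κ : Kind) (n : ℕ) (τ : ℤˣ) : ParaAlg κ n τ ≃ₐ[Kq] QUEA κ n :=
  AlgEquiv.ofAlgHom (toQUEA κ n τ) (ofQUEA κ n τ)
    (by
      apply RingQuot.ringQuot_ext'
      apply FreeAlgebra.hom_ext
      funext g
      change toQUEA κ n τ (ofQUEA κ n τ (QUEA.gen κ n g)) = QUEA.gen κ n g
      rw [ofQUEA_gen]
      cases g with
      | e s i => exact toQUEA_paraE s i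
      | k s i => exact toQUEA_paraK s i)
    (by
      apply RingQuot.ringQuot_ext'
      apply FreeAlgebra.hom_ext
      funext g
      change ofQUEA κ n τ (toQUEA κ n τ (ParaAlg.gen κ n τ g)) = ParaAlg.gen κ n τ g
      rw [toQUEA_gen]
      cases g with
      | a s i => exact ofQUEA_chevA s i
      | k s i => exact ofQUEA_chevK s i)

end Concrete

/-! ### Homogeneous parts of an algebra with graded generators. -/

section HomPart

variable {A B : Type*} [Ring A] [Algebra Kq A] [Ring B] [Algebra Kq B] {G G' : Type}
  {deg : G → ZMod 2} {f : G → A} {deg' : G' → ZMod 2} {f' : G' → B}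

theorem gen_mem_homPart (g : G) : f g ∈ homPart deg f (deg g) :=
  Submodule.subset_span ⟨[g], by simp, by simp⟩

theorem one_mem_homPart : (1 : A) ∈ homPart deg f 0 :=
  Submodule.subset_span ⟨[], by simp, by simp⟩

theorem mul_mem_homPart {d e : ZMod 2} {x y : A} (hx : x ∈ homPart deg f d)
    (hy : y ∈ homPart deg f e) : x * y ∈ homPart deg f (d + e) := by
  have := Submodule.mul_mem_mul hx hy
  rw [homPart, homPart, Submodule.span_mul_span] at this
  refine Submodule.span_mono ?_ this
  rintro _ ⟨_, ⟨w, hw, rfl⟩, _, ⟨w', hw', rfl⟩, rfl⟩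
  exact ⟨w ++ w', by simp [hw, hw'], by simp⟩

theorem mul_mem_homPart_of_eq {d e d' : ZMod 2} (h : d + e = d') {x y : A}
    (hx : x ∈ homPart deg f d) (hy : y ∈ homPart deg f e) : x * y ∈ homPart deg f d' :=
  h ▸ mul_mem_homPart hx hy

theorem map_homPart_le (φ : A →ₐ[Kq] B) (h : ∀ g, φ (f g) ∈ homPart deg' f' (deg g)) (d : ZMod 2) :
    (homPart deg f d).map φ.toLinearMap ≤ homPart deg' f' d := by
  rw [homPart, Submodule.map_span, Submodule.span_le]
  rintro _ ⟨_, ⟨w, rfl, rfl⟩, rfl⟩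
  induction w with
  | nil => simpa using one_mem_homPart
  | cons g w ih =>
    simp only [List.map_cons, List.sum_cons, List.prod_cons, SetLike.mem_coe,
      AlgHom.toLinearMap_apply, map_mul] at ih ⊢
    exact mul_mem_homPart (h g) ih

theorem qbr_mem_homPart {d : ZMod 2} {x y : A} (c : Kq) (hx : x ∈ homPart deg f 0)
    (hy : y ∈ homPart deg f d) : qbr c x y ∈ homPart deg f d := by
  refine Submodule.sub_mem _ ?_ (Submodule.smul_mem _ _ ?_)
  · simpa using mul_mem_homPart hx hy
  · simpa using mul_mem_homPart hy hx

theorem qbr_mem_homPart' {d : ZMod 2} {x y : A} (c : Kq) (hx : x ∈ homPart deg f d)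
    (hy : y ∈ homPart deg f 0) : qbr c x y ∈ homPart deg f d := by
  refine Submodule.sub_mem _ ?_ (Submodule.smul_mem _ _ ?_)
  · simpa using mul_mem_homPart hx hy
  · simpa using mul_mem_homPart hy hx

end HomPart

theorem descend_mem {A : Type*} {n : ℕ} {p q : A → Prop} {g : A → A → A} {e : Fin n → A}
    (hg : ∀ x y, q x → p y → p (g x y)) (hq : ∀ i : Fin n, i.val + 1 < n → q (e i))
    (hp : ∀ i : Fin n, i.val + 1 = n → p (e i)) (i : Fin n) : p (descend g e i) := by
  induction hk : n - i.val generalizing i with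
  | zero => omega
  | succ k ih =>
    rw [descend]
    split_ifs with hi
    · exact hg _ _ (hq i hi) (ih ⟨i.val + 1, hi⟩ (by simp only; omega))
    · exact hp i (by omega)

/-- The sign of a degree. -/
noncomputable def degSign (d : ZMod 2) : Kq := if d = 1 then -1 else 1

theorem degSign_add (d e : ZMod 2) : degSign (d + e) = degSign d * degSign e := by
  have h : ∀ d : ZMod 2, d = 0 ∨ d = 1 := by decide
  rcases h d with rfl | rfl <;> rcases h e with rfl | rfl <;>
    simp [degSign, show (1 + 1 : ZMod 2) = 0 from rfl]

/-! ### The superalgebra grading. -/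

section Parity

/-- Every relator is either even or odd in the operators `α`, so it is kept or changes sign. This
makes the parity endomorphism well defined in the parabose case; in the parafermi case it is the
identity. -/
theorem relatorIn_neg {F A : Type*} [Field F] [Ring A] [Algebra F A] {q b c ε : F} {n : ℕ} {τ : ℤˣ}
    {α K : ℤˣ → Fin n → A} {r : ParaIdx n} (h : relatorIn q b c ε n τ α K r = 0) :
    relatorIn q b c ε n τ (fun s i => -α s i) K r = 0 := by
  cases r with
  | k_inv | k_comm => exact h
  | a_a => simpa [relatorIn, cbr] using h
  | _ =>
    rw [← neg_eq_zero, ← h]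
    simp only [relatorIn, cbr, serreT, serreS, neg_mul, mul_neg, neg_neg, smul_neg]
    try split_ifs
    all_goals module

variable {κ : Kind} {n : ℕ} {τ : ℤˣ}

theorem lift_parity_rel {x y : FreeAlgebra Kq (ParaGen n)} (h : ParaRel κ n τ x y) :
    FreeAlgebra.lift Kq (fun g => degSign (g.deg κ) • ParaAlg.gen κ n τ g) x =
      FreeAlgebra.lift Kq (fun g => degSign (g.deg κ) • ParaAlg.gen κ n τ g) y := by
  obtain ⟨r, rfl, rfl⟩ := h
  have h := ParaAlg.relatorIn_eq_zero κ n τ r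
  rw [map_relator, map_zero]
  simp only [FreeAlgebra.lift_ι_apply, ParaGen.deg]
  cases κ with
  | fermi => simp only [degSign, Kind.deg, zero_ne_one, if_false, one_smul]; exact h
  | bose =>
    simp only [degSign, Kind.deg, zero_ne_one, if_false, if_true, one_smul]
    exact relatorIn_neg h

/-- The parity endomorphism of the deformed parastatistics algebra. -/
noncomputable def parity (κ : Kind) (n : ℕ) (τ : ℤˣ) : ParaAlg κ n τ →ₐ[Kq] ParaAlg κ n τ :=
  RingQuot.liftAlgHom Kq ⟨FreeAlgebra.lift Kq
    (fun g => degSign (g.deg κ) • ParaAlg.gen κ n τ g), fun _ _ h => lift_parity_rel h⟩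

theorem parity_gen (g : ParaGen n) :
    parity κ n τ (ParaAlg.gen κ n τ g) = degSign (g.deg κ) • ParaAlg.gen κ n τ g := by
  rw [parity, ParaAlg.gen, RingQuot.liftAlgHom_mkAlgHom_apply, FreeAlgebra.lift_ι_apply]
  rfl

theorem parity_of_mem_part {d : ZMod 2} {x : ParaAlg κ n τ} (hx : x ∈ ParaAlg.part κ n τ d) :
    parity κ n τ x = degSign d • x := by
  induction hx using Submodule.span_induction with
  | mem x hx =>
    obtain ⟨w, rfl, rfl⟩ := hx
    induction w with
    | nil => simp [degSign]
    | cons g w ih =>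
      simp only [List.map_cons, List.sum_cons, List.prod_cons, map_mul, parity_gen, degSign_add, ih,
        smul_mul_smul_comm]
  | zero => simp
  | add x y _ _ hx hy => rw [map_add, hx, hy, smul_add]
  | smul c x _ hx => rw [map_smul, hx, smul_comm]

theorem zmod_two_cases (d : ZMod 2) : d = 0 ∨ d = 1 := by revert d; decide

/-- The sum of the two parts contains the scalars and the generators and is closed under products.
-/
theorem part_sup_part : ParaAlg.part κ n τ 0 ⊔ ParaAlg.part κ n τ 1 = ⊤ := by
  have hle : ∀ d, ParaAlg.part κ n τ d ≤ ParaAlg.part κ n τ 0 ⊔ ParaAlg.part κ n τ 1 := fun d => by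
    rcases zmod_two_cases d with rfl | rfl
    exacts [le_sup_left, le_sup_right]
  have hw : ∀ w : List (ParaGen n), (w.map (ParaAlg.gen κ n τ)).prod ∈
      ParaAlg.part κ n τ 0 ⊔ ParaAlg.part κ n τ 1 := fun w =>
    hle _ (Submodule.subset_span ⟨w, rfl, rfl⟩)
  have hmul : ∀ x ∈ ParaAlg.part κ n τ 0 ⊔ ParaAlg.part κ n τ 1,
      ∀ y ∈ ParaAlg.part κ n τ 0 ⊔ ParaAlg.part κ n τ 1,
      x * y ∈ ParaAlg.part κ n τ 0 ⊔ ParaAlg.part κ n τ 1 := by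
    intro x hx y hy
    obtain ⟨x0, hx0, x1, hx1, rfl⟩ := Submodule.mem_sup.1 hx
    obtain ⟨y0, hy0, y1, hy1, rfl⟩ := Submodule.mem_sup.1 hy
    rw [add_mul, mul_add, mul_add]
    exact add_mem (add_mem (hle _ (mul_mem_homPart hx0 hy0)) (hle _ (mul_mem_homPart hx0 hy1)))
      (add_mem (hle _ (mul_mem_homPart hx1 hy0)) (hle _ (mul_mem_homPart hx1 hy1)))
  rw [eq_top_iff]
  intro x _
  obtain ⟨x, rfl⟩ := RingQuot.mkAlgHom_surjective Kq (ParaRel κ n τ) x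
  induction x using FreeAlgebra.induction with
  | grade0 c =>
    rw [AlgHom.commutes, Algebra.algebraMap_eq_smul_one]
    exact Submodule.smul_mem _ _ (hw [])
  | grade1 g => simpa [ParaAlg.gen] using hw [g]
  | mul x y hx hy => rw [map_mul]; exact hmul _ (hx trivial) _ (hy trivial)
  | add x y hx hy => rw [map_add]; exact add_mem (hx trivial) (hy trivial)

/-- Parity acts by `1` on one part and by `-1` on the other, so an element of both satisfies `2 x =
0`. -/
theorem isCompl_part : IsCompl (ParaAlg.part κ n τ 0) (ParaAlg.part κ n τ 1) := by
  refine ⟨?_, codisjoint_iff.2 part_sup_part⟩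
  rw [Submodule.disjoint_def]
  intro x h0 h1
  have h0 := parity_of_mem_part h0
  rw [parity_of_mem_part h1] at h0
  have : (2 : Kq) • x = 0 := by
    simp only [degSign, if_true, if_neg (zero_ne_one : (0 : ZMod 2) ≠ 1), one_smul] at h0
    rw [two_smul]
    nth_rw 1 [← h0]
    exact neg_add_cancel x
  exact (smul_eq_zero.1 this).resolve_left two_ne_zero

theorem nonempty_gradedAlgebra_part (κ : Kind) (n : ℕ) (τ : ℤˣ) :
    Nonempty (GradedAlgebra (ParaAlg.part κ n τ)) := by
  have h : DirectSum.IsInternal (ParaAlg.part κ n τ) :=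
    (DirectSum.isInternal_submodule_iff_isCompl _ (zero_ne_one : (0 : ZMod 2) ≠ 1)
      (by ext d; simpa using zmod_two_cases d)).2 isCompl_part
  have : SetLike.GradedMonoid (ParaAlg.part κ n τ) :=
    { one_mem := one_mem_homPart
      mul_mem := fun _ _ _ _ hx hy => mul_mem_homPart hx hy }
  have := h.chooseDecomposition
  exact ⟨{ }⟩

end Parity

/-! ### Compatibility of the isomorphism with the gradings. -/

section Parts

variable {κ : Kind} {n : ℕ} {τ : ℤˣ}

theorem QUEA.E_mem_part {i : Fin n} (s : ℤˣ) :
    QUEA.E κ n s i ∈ QUEA.part κ n (if i.val + 1 = n then κ.deg else 0) :=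
  gen_mem_homPart (deg := ChevGen.deg κ) (.e s i)

theorem chevA_mem_part (s : ℤˣ) (i : Fin n) : chevA κ n s i ∈ QUEA.part κ n κ.deg := by
  have h0 : ∀ s, ∀ i : Fin n, i.val + 1 < n → QUEA.E κ n s i ∈ QUEA.part κ n 0 := fun s i hi => by
    simpa [hi.ne] using QUEA.E_mem_part (κ := κ) (i := i) s
  have h1 : ∀ s, ∀ i : Fin n, i.val + 1 = n → QUEA.E κ n s i ∈ QUEA.part κ n κ.deg :=
    fun s i hi => by simpa [hi] using QUEA.E_mem_part (κ := κ) (i := i) s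
  unfold chevA
  split_ifs
  · exact descend_mem (q := (· ∈ QUEA.part κ n 0)) (p := (· ∈ QUEA.part κ n κ.deg))
      (fun _ _ => qbr_mem_homPart _) (h0 _) (h1 _) i
  · exact descend_mem (q := (· ∈ QUEA.part κ n 0)) (p := (· ∈ QUEA.part κ n κ.deg))
      (fun _ _ hx hy => qbr_mem_homPart' _ hy hx) (h0 _) (h1 _) i

theorem chevK_mem_part (s : ℤˣ) (i : Fin n) : chevK κ n s i ∈ QUEA.part κ n 0 := by
  have h : ∀ i, QUEA.K κ n s i ∈ QUEA.part κ n 0 := fun i =>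
    gen_mem_homPart (deg := ChevGen.deg κ) (.k s i)
  exact descend_mem (q := (· ∈ QUEA.part κ n 0)) (p := (· ∈ QUEA.part κ n 0))
    (fun _ _ => mul_mem_homPart_of_eq (add_zero 0)) (fun i _ => h i) (fun i _ => h i) i

theorem ParaAlg.a_mem_part (s : ℤˣ) (i : Fin n) : ParaAlg.a κ n τ s i ∈ ParaAlg.part κ n τ κ.deg :=
  gen_mem_homPart (deg := ParaGen.deg κ) (.a s i)

theorem ParaAlg.k_mem_part (s : ℤˣ) (i : Fin n) : ParaAlg.k κ n τ s i ∈ ParaAlg.part κ n τ 0 :=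
  gen_mem_homPart (deg := ParaGen.deg κ) (.k s i)

theorem ParaAlg.abr_mem_part (s t : ℤˣ) (i j : Fin n) :
    abr κ (ParaAlg.a κ n τ s i) (ParaAlg.a κ n τ t j) ∈ ParaAlg.part κ n τ 0 := by
  have h : ∀ s t : ℤˣ, ∀ i j : Fin n,
      ParaAlg.a κ n τ s i * ParaAlg.a κ n τ t j ∈ ParaAlg.part κ n τ 0 := fun s t i j =>
    mul_mem_homPart_of_eq κ.deg_add_self (ParaAlg.a_mem_part s i) (ParaAlg.a_mem_part t j)
  exact Submodule.sub_mem _ (h _ _ _ _) (Submodule.smul_mem _ _ (h _ _ _ _))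

theorem paraE_mem_part (s : ℤˣ) (i : Fin n) :
    paraE κ n τ s i ∈ ParaAlg.part κ n τ (if i.val + 1 = n then κ.deg else 0) := by
  unfold paraE
  by_cases h : i.val + 1 < n
  · rw [dif_pos h, if_neg h.ne]
    split_ifs
    · exact Submodule.smul_mem _ _ (mul_mem_homPart_of_eq (add_zero 0) (ParaAlg.k_mem_part _ _)
        (ParaAlg.abr_mem_part _ _ _ _))
    · exact Submodule.smul_mem _ _ (mul_mem_homPart_of_eq (add_zero 0) (ParaAlg.abr_mem_part _ _ _ _)
        (ParaAlg.k_mem_part _ _))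
  · rw [dif_neg h, if_pos (by omega)]
    exact ParaAlg.a_mem_part _ _

theorem paraK_mem_part (s : ℤˣ) (i : Fin n) : paraK κ n τ s i ∈ ParaAlg.part κ n τ 0 := by
  unfold paraK
  split_ifs
  · exact mul_mem_homPart_of_eq (add_zero 0) (ParaAlg.k_mem_part _ _) (ParaAlg.k_mem_part _ _)
  · exact ParaAlg.k_mem_part _ _

theorem map_part (d : ZMod 2) :
    (ParaAlg.part κ n τ d).map (paraEquiv κ n τ).toLinearMap = QUEA.part κ n d := by
  apply le_antisymm
  · refine map_homPart_le (toQUEA κ n τ) (fun g => ?_) d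
    rw [toQUEA_gen]
    cases g
    exacts [chevA_mem_part _ _, chevK_mem_part _ _]
  -- Surjectivity onto the part of degree `d` holds because the inverse homomorphism also preserves
  -- degrees.
  · intro x hx
    refine ⟨ofQUEA κ n τ x, map_homPart_le (ofQUEA κ n τ) (fun g => ?_) d ⟨x, hx, rfl⟩,
      (paraEquiv κ n τ).apply_symm_apply x⟩
    rw [ofQUEA_gen]
    cases g
    exacts [paraE_mem_part _ _, paraK_mem_part _ _]

end Parts

/-! ### Coefficients of words in the free algebra. -/

section Words

variable {R G : Type*} [Field R] [DecidableEq G]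

/-- Removal of the first letter `g` from the words over `G`, on functions of words. -/
def wordAct (g : G) : Module.End R (List G → R) where
  toFun f
    | [] => 0
    | h :: t => if h = g then f t else 0
  map_add' f f' := by
    funext w
    cases w with
    | nil => simp
    | cons h t => simp only [Pi.add_apply]; split_ifs <;> simp
  map_smul' c f := by
    funext w
    cases w with
    | nil => simp
    | cons h t => simp

/-- The coefficient of a word in an element of the free algebra. -/
def wordCoeff (w : List G) : FreeAlgebra R G →ₗ[R] R :=
  LinearMap.proj w ∘ₗ LinearMap.applyₗ (Pi.single [] 1) ∘ₗ
    (FreeAlgebra.lift R (wordAct (R := R) (G := G))).toLinearMap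

@[simp] theorem wordCoeff_cons_ι_mul (g h : G) (t : List G) (x : FreeAlgebra R G) :
    wordCoeff (h :: t) (FreeAlgebra.ι R g * x) = if h = g then wordCoeff t x else 0 := by
  simp [wordCoeff, wordAct]

@[simp] theorem wordCoeff_cons_ι (g h : G) (t : List G) :
    wordCoeff (h :: t) (FreeAlgebra.ι R g) = if h = g ∧ t = [] then 1 else 0 := by
  simp [wordCoeff, wordAct, Pi.single_apply, ite_and]

@[simp] theorem wordCoeff_nil_ι (g : G) : wordCoeff [] (FreeAlgebra.ι R g) = 0 := by
  simp [wordCoeff, wordAct]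

@[simp] theorem wordCoeff_cons_one (h : G) (t : List G) :
    wordCoeff (h :: t) (1 : FreeAlgebra R G) = 0 := by
  simp [wordCoeff]

end Words

/-! ### Linear independence of the relators. -/

section Independence

theorem linearIndependent_of_dual {R M ι : Type*} [Field R] [AddCommGroup M] [Module R M]
    {v : ι → M} (l : ι → M →ₗ[R] R) (h0 : ∀ i, l i (v i) ≠ 0) (h : ∀ i j, i ≠ j → l i (v j) = 0) :
    LinearIndependent R v := by
  rw [linearIndependent_iff']
  intro s g hg i hi
  have := congrArg (l i) hg
  rw [map_sum, map_zero, Finset.sum_eq_single i] at this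
  · rw [map_smul, smul_eq_mul] at this
    exact (mul_eq_zero.1 this).resolve_right (h0 i)
  · intro j _ hj
    rw [map_smul, h i j hj.symm, smul_zero]
  · exact fun h => absurd hi h

/-- The weight of the second word in the functionals dual to the relations of degree three. -/
noncomputable def dualWeight (κ : Kind) {n : ℕ} (i j : Fin n) : Kq :=
  if i = j then 0 else q * (q + koszul κ.deg κ.deg)

open Classical in
/-- Functionals on the free algebra, dual to the relators. -/
noncomputable def relatorDual (κ : Kind) (n : ℕ) :
    ParaIdx n → FreeAlgebra Kq (ParaGen n) →ₗ[Kq] Kq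
  | .k_inv s i => wordCoeff [.k s i, .k (-s) i]
  | .k_comm i j _ => wordCoeff [.k 1 i, .k 1 j]
  | .k_a s i j => wordCoeff [.k 1 i, .a s j, .k (-1) i]
  | .a_a i => wordCoeff [.a 1 i, .a (-1) i]
  | .tri i j k => wordCoeff [.a (-1) j, .a 1 i, .a 1 k]
  | .triStar i j k => wordCoeff [.a (-1) k, .a (-1) j, .a 1 i]
  | .serre s i j k _ _ => wordCoeff [.a s i, .a s k, .a s j] +
      dualWeight κ j k • wordCoeff [.a s j, .a s i, .a s k]
  | .serreStar s i j k _ _ => wordCoeff [.a s j, .a s i, .a s k] +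
      dualWeight κ i j • wordCoeff [.a s i, .a s k, .a s j]

theorem relator_eq_relatorIn (κ : Kind) (n : ℕ) (τ : ℤˣ) (r : ParaIdx n) :
    relator κ n τ r = relatorIn q (qnum 2) (sq - sq⁻¹)⁻¹ (koszul κ.deg κ.deg) n τ fa fk r :=
  map_relator (AlgHom.id Kq _) r

-- Outside the triple relations (II) and (II*), each chosen word occurs in a single relator. In (I)
-- it is the only word that starts with an annihilation operator, in (I*) the only cubic word in the
-- `a^±` that ends with a creation operator. For `i < j < k`, the relators (II) and (II*) share
-- their words: with `t = q (q + ε)`, the coefficients of `a_i a_k a_j` and `a_j a_i a_k` are `(1,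
-- -t)` in (II) and `(-t, 1)` in (II*). Adding `t` times the other coefficient therefore annihilates
-- the partner. When two indices agree there is no partner with the same content, and the weight is
-- `0`.
open Classical in
theorem relatorDual_of_ne {κ : Kind} {n : ℕ} {τ : ℤˣ} {r r' : ParaIdx n} (h : r ≠ r') :
    relatorDual κ n r (relator κ n τ r') = 0 := by
  rw [relator_eq_relatorIn]
  have h1 : (1 : ℤˣ) ≠ -1 := by decide
  cases r with
  | serre s i j k =>
    cases r' with
    | serre s' | serreStar s' =>
      by_cases hs : s = s'
      · subst hs
        simp [relatorDual, relatorIn, cbr, serreT, serreS, mul_sub, sub_mul, mul_add,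
      mul_assoc]
        rw [dualWeight]
        generalize q = x, koszul κ.deg κ.deg = y
        grind
      · simp [relatorDual, relatorIn, cbr, serreT, serreS, mul_sub, sub_mul, mul_assoc, hs]
    | _ =>
      rcases Int.units_eq_one_or s with rfl | rfl <;>
        simp [relatorDual, relatorIn, cbr, mul_sub, sub_mul, mul_assoc,
          apply_ite (wordCoeff _)]
  | serreStar s i j k =>
    cases r' with
    | serre s' | serreStar s' =>
      by_cases hs : s = s'
      · subst hs
        simp [relatorDual, relatorIn, cbr, serreT, serreS, mul_sub, sub_mul, mul_add,
      mul_assoc]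
        rw [dualWeight]
        generalize q = x, koszul κ.deg κ.deg = y
        grind
      · simp [relatorDual, relatorIn, cbr, serreT, serreS, mul_sub, sub_mul, mul_assoc, hs]
    | _ =>
      rcases Int.units_eq_one_or s with rfl | rfl <;>
        simp [relatorDual, relatorIn, cbr, mul_sub, sub_mul, mul_assoc,
          apply_ite (wordCoeff _)]
  | _ =>
    cases r' <;>
      simp [relatorDual, relatorIn, cbr, serreT, serreS, mul_sub, sub_mul, mul_assoc,
        apply_ite (wordCoeff _)] <;>
      grind

/-- This is `1 - t²`, the value of the dual functional on its own triple relator when the indices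
are distinct. It is a polynomial in `q^(1/2)`, and it does not vanish at `q^(1/2) = 2`, where `t` is
`20` or `12`. -/
theorem one_sub_sq_ne_zero (κ : Kind) : 1 - (q * (q + koszul κ.deg κ.deg)) ^ 2 ≠ 0 := by
  open Polynomial in
  have h : ∀ c : ℂ, (1 - (X ^ 2 * (X ^ 2 + C c)) ^ 2 : ℂ[X]).eval 2 ≠ 0 →
      1 - (q * (q + algebraMap ℂ Kq c)) ^ 2 ≠ 0 := fun c hc => by
    have h0 : (1 - (X ^ 2 * (X ^ 2 + C c)) ^ 2 : ℂ[X]) ≠ 0 := fun h0 => hc (by rw [h0, eval_zero])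
    have := RatFunc.algebraMap_ne_zero (K := ℂ) h0
    simpa [q, sq] using this
  cases κ with
  | fermi => simpa [koszul, Kind.deg] using h 1 (by norm_num)
  | bose => simpa [koszul, Kind.deg] using h (-1) (by norm_num)

theorem relatorDual_self_ne_zero (κ : Kind) {n : ℕ} (τ : ℤˣ) (r : ParaIdx n) :
    relatorDual κ n r (relator κ n τ r) ≠ 0 := by
  rw [relator_eq_relatorIn]
  have hp := qparam κ
  have hε : koszul κ.deg κ.deg ≠ 0 := left_ne_zero_of_mul_eq_one hp.hε
  have h1 : (1 : ℤˣ) ≠ -1 := by decide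
  have hq : 1 + q ≠ 0 := by
    rw [add_comm, q]; exact sq_pow_add_one_ne two_pos
  have ht := one_sub_sq_ne_zero κ
  cases r with
  | k_comm i j h => simp [relatorDual, relatorIn, h.ne]
  | serre s i j k h h' =>
    intro h0
    simp only [relatorDual, dualWeight] at h0
    rcases h'.eq_or_lt with rfl | h'
    -- With two equal indices both summands of the relator contribute to the word, and its
    -- coefficient is `1 + q`.
    · simp [relatorIn, cbr, serreT, mul_sub, sub_mul, mul_assoc, h.ne] at h0
      exact hq h0
    · simp [relatorIn, cbr, serreT, mul_sub, sub_mul, mul_assoc, h.ne, h.ne', h'.ne, h'.ne',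
        (h.trans h').ne] at h0
      exact ht (by linear_combination h0)
  | serreStar s i j k h h' =>
    intro h0
    simp only [relatorDual, dualWeight] at h0
    rcases h.eq_or_lt with rfl | h
    · simp [relatorIn, cbr, serreS, mul_sub, sub_mul, mul_assoc, h'.ne] at h0
      exact hq h0
    · simp [relatorIn, cbr, serreS, mul_sub, sub_mul, mul_assoc, h.ne, h.ne', h'.ne, h'.ne',
        (h.trans h').ne] at h0
      exact ht (by linear_combination h0)
  | triStar i j k =>
    simp [relatorDual, relatorIn, cbr, mul_sub, sub_mul, mul_assoc, apply_ite (wordCoeff _)]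
    split_ifs <;> simp [hε, hp.q0, zpow_ne_zero]
  | _ =>
    simp [relatorDual, relatorIn, cbr, mul_sub, sub_mul, mul_assoc, hε,
      apply_ite (wordCoeff _)]

theorem linearIndependent_relator (κ : Kind) (n : ℕ) (τ : ℤˣ) :
    LinearIndependent Kq (relator κ n τ) :=
  linearIndependent_of_dual (relatorDual κ n) (relatorDual_self_ne_zero κ τ)
    fun _ _ => relatorDual_of_ne

end Independence
end Parastat

theorem theorem1 (κ : Parastat.Kind) (n : ℕ) (τ : ℤˣ) :
    LinearIndependent Parastat.Kq (Parastat.relator κ n τ) ∧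
    Nonempty (GradedAlgebra (Parastat.ParaAlg.part κ n τ)) ∧
    ∃ φ : Parastat.ParaAlg κ n τ ≃ₐ[Parastat.Kq] Parastat.QUEA κ n,
      (∀ (s : ℤˣ) (i : Fin n), φ (Parastat.ParaAlg.a κ n τ s i) = Parastat.chevA κ n s i) ∧
      (∀ (s : ℤˣ) (i : Fin n), φ (Parastat.ParaAlg.k κ n τ s i) = Parastat.chevK κ n s i) ∧
      (∀ (s : ℤˣ) (i : Fin n), φ.symm (Parastat.QUEA.E κ n s i) = Parastat.paraE κ n τ s i) ∧
      (∀ (s : ℤˣ) (i : Fin n), φ.symm (Parastat.QUEA.K κ n s i) = Parastat.paraK κ n τ s i) ∧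
      (∀ d : ZMod 2, (Parastat.ParaAlg.part κ n τ d).map φ.toLinearMap =
        Parastat.QUEA.part κ n d) :=
  ⟨Parastat.linearIndependent_relator κ n τ, Parastat.nonempty_gradedAlgebra_part κ n τ,
    Parastat.paraEquiv κ n τ, fun _ _ => Parastat.toQUEA_gen _, fun _ _ => Parastat.toQUEA_gen _,
    fun _ _ => Parastat.ofQUEA_gen _, fun _ _ => Parastat.ofQUEA_gen _, Parastat.map_part⟩
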